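/- **Proposition 3.1 (elliptic spectral curve).** Let $\wp,\zeta,\sigma$ be the Weierstrass functions of a period lattice $\Lambda\subset\mathbb C$ and let $\Phi(x,z)=\frac{\sigma(z-x)}{\sigma(z)\sigma(x)}e^{\zeta(z)x}$. Let $N,l$ be natural numbers. The phase space consists of the $(x,p,a,b)$ with $x_i,p_i\in\mathbb C$, $a_i,b_i\in\mathbb C^l$ $(1\le i\le N)$, $x_i-x_j\notin\Lambda$ for $i\ne j$, and $f_{ii}=2$ for all $i$, where $f_{ij}=\sum_{\alpha}b_i^\alpha a_{j,\alpha}$; write $F=(f_{ij})$. Let $$L_{ij}(z)=p_i\delta_{ij}+(1-\delta_{ij})f_{ij}\Phi(x_i-x_j,z),\qquad R(k,z)=\det(2kI+L(z)).$$ Call a point of the phase space *generic* if $F$ (a matrix of rank at most $\min(l,N)$) has $\min(l,N)$ distinct nonzero eigenvalues, and if the coefficient of $s^{\min(l,N)}$ in $\det(2\kappa I+Q+sF)$, as a polynomial in $\kappa$, is nonzero and has only simple roots, where $Q_{ij}=p_i\delta_{ij}+(1-\delta_{ij})f_{ij}\zeta(x_i-x_j)$. Then the generic points are dense in the phase space.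 Moreover, let $(x(t),p(t),a(t),b(t))$ be, for $t$ in an open interval $T$, a curve in the phase space that solves $$\dot x_i=p_i,\qquad \dot p_i=\sum_{j\ne i}f_{ij}f_{ji}\wp'(x_i-x_j),$$ $$\dot a_i=-\sum_{j\neq i}a_jf_{ji}\wp(x_i-x_j)-\lambda_ia_i,\qquad \dot b_i=\sum_{j\ne i}b_jf_{ij}\wp(x_i-x_j)+\lambda_ib_i$$ with some scalar functions $\lambda_i(t)$ (for instance $\lambda_i=0$), and let $R(k,z)$ be formed at time $t$. Then: 1. For all $t\in T$, $z\notin\Lambda$ and $k\in\mathbb C$ we have $R(k,z)=\sum_{i=0}^N r_i(z)k^i$, where the $r_i$ are elliptic functions with period lattice $\Lambda$, independent of $t$, of the form $$r_i(z)=I_i^0+\sum_{s=0}^{N-i-2}I_{i,s}\,\partial_z^s\wp(z)$$ with constants $I_i^0,I_{i,s}$. 2. There are numbers $\nu_1,\dots,\nu_N\in\mathbb C$, with $\nu_i=1$ for $i>l$, and functions $h_1,\dots,h_N$, all independent of $t$, such that for all $z\neq0$ in a neighbourhood of $0$, all $t\in T$ and all $k\in\mathbb C$ $$R(k,z)=2^N\prod_{i=1}^N\bigl(k+\nu_iz^{-1}+h_i(z)\bigr),$$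 and $z\,h_i(z)\to0$ as $z\to0$. If the curve passes through a generic point at some time in $T$, the $h_i$ can be taken holomorphic in a neighbourhood of $z=0$. -/

import Mathlib

open Filter Topology

noncomputable section

namespace SpinCM

/-! ### Weierstrass functions of a period lattice

Mathlib provides the lattice `L.lattice` and the Weierstrass function `L.weierstrassP`. -/

/-- The Weierstrass zeta function `ζ(z) = 1/z + ∑_{ω ≠ 0} (1/(z-ω) + 1/ω + z/ω²)`.
The summand at `ω = 0` is `1/z`, since division by `0` gives `0`. -/
def zeta (L : PeriodPair) (z : ℂ) : ℂ :=
  ∑' ω : L.lattice, (1 / (z - ω) + 1 / (ω : ℂ) + z / (ω : ℂ) ^ 2)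

/-- The Weierstrass sigma function `σ(z) = z ∏_{ω ≠ 0} (1 - z/ω) exp(z/ω + z²/(2ω²))`.
The factor at `ω = 0` is `1`, since division by `0` gives `0`. -/
def sigma (L : PeriodPair) (z : ℂ) : ℂ :=
  z * ∏' ω : L.lattice,
    ((1 - z / (ω : ℂ)) * Complex.exp (z / (ω : ℂ) + z ^ 2 / (2 * (ω : ℂ) ^ 2)))

/-- `Φ(x,z) = σ(z-x) / (σ(z) σ(x)) · exp(ζ(z) x)`. -/
def Phi (L : PeriodPair) (x z : ℂ) : ℂ :=
  sigma L (z - x) / (sigma L z * sigma L x) * Complex.exp (zeta L z * x)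

/-- Elliptic functions: meromorphic on `ℂ` and periodic with respect to the lattice. -/
def IsElliptic (L : PeriodPair) (f : ℂ → ℂ) : Prop :=
  Meromorphic f ∧ ∀ ω ∈ L.lattice, ∀ z, f (z + ω) = f z

/-! ### The spin Calogero-Moser system -/

/-- The ambient space of the variables `(x, p, a, b)`: positions `x i`, momenta `p i`, vectors
`a i` and covectors `b i` of dimension `l`. -/
abbrev Phase (N l : ℕ) : Type :=
  (Fin N → ℂ) × (Fin N → ℂ) × (Fin N → Fin l → ℂ) × (Fin N → Fin l → ℂ)

variable {N l : ℕ}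

/-- positions -/
def pos (q : Phase N l) : Fin N → ℂ := q.1

/-- momenta -/
def mom (q : Phase N l) : Fin N → ℂ := q.2.1

/-- the vectors `a i` -/
def vec (q : Phase N l) : Fin N → Fin l → ℂ := q.2.2.1

/-- the covectors `b i` -/
def covec (q : Phase N l) : Fin N → Fin l → ℂ := q.2.2.2

/-- The matrix `F` with entries `f i j = b i · a j`. -/
def F (q : Phase N l) : Matrix (Fin N) (Fin N) ℂ :=
  Matrix.of fun i j => ∑ α, covec q i α * vec q j α

/-- The phase space: distinct particles on the elliptic curve, with `b i · a i = 2`. -/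
def phaseSpace (L : PeriodPair) (N l : ℕ) : Set (Phase N l) :=
  {q | (∀ i j, i ≠ j → pos q i - pos q j ∉ L.lattice) ∧ ∀ i, F q i i = 2}

/-- `γ` solves, on the set `T` of times, the equations of motion with potential `℘` on the
submanifold `b i · a i = 2`; the functions `lam i` are the gauge multipliers
(`lam = 0` gives the equations of the Hamiltonian system itself). -/
structure IsTrajectory (L : PeriodPair) (T : Set ℝ) (lam : ℝ → Fin N → ℂ)
    (γ : ℝ → Phase N l) : Prop where
  mem_phaseSpace : ∀ t ∈ T, γ t ∈ phaseSpace L N l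
  deriv_pos : ∀ t ∈ T, ∀ i, HasDerivAt (fun s => pos (γ s) i) (mom (γ t) i) t
  deriv_mom : ∀ t ∈ T, ∀ i, HasDerivAt (fun s => mom (γ s) i)
    (∑ j ∈ Finset.univ.erase i, F (γ t) i j * F (γ t) j i *
      deriv L.weierstrassP (pos (γ t) i - pos (γ t) j)) t
  deriv_vec : ∀ t ∈ T, ∀ i α, HasDerivAt (fun s => vec (γ s) i α)
    (-(∑ j ∈ Finset.univ.erase i, vec (γ t) j α * F (γ t) j i *
      L.weierstrassP (pos (γ t) i - pos (γ t) j)) - lam t i * vec (γ t) i α) t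
  deriv_covec : ∀ t ∈ T, ∀ i α, HasDerivAt (fun s => covec (γ s) i α)
    ((∑ j ∈ Finset.univ.erase i, covec (γ t) j α * F (γ t) i j *
      L.weierstrassP (pos (γ t) i - pos (γ t) j)) + lam t i * covec (γ t) i α) t

/-- The Lax matrix `L i j = p i δ i j + (1 - δ i j) f i j Φ(x i - x j, z)`; along a trajectory
`p i` is the velocity of `x i`. -/
def lax (L : PeriodPair) (q : Phase N l) (z : ℂ) : Matrix (Fin N) (Fin N) ℂ :=
  Matrix.of fun i j => if i = j then mom q i else F q i j * Phi L (pos q i - pos q j) z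

/-- `R(k,z) = det (2 k I + L(z))`. -/
def R (L : PeriodPair) (q : Phase N l) (k z : ℂ) : ℂ :=
  ((2 * k) • (1 : Matrix (Fin N) (Fin N) ℂ) + lax L q z).det

/-! ### Generic points of the phase space -/

/-- The matrix `Q i j = p i δ i j + (1 - δ i j) f i j ζ(x i - x j)`. -/
def Q (L : PeriodPair) (q : Phase N l) : Matrix (Fin N) (Fin N) ℂ :=
  Matrix.of fun i j => if i = j then mom q i else F q i j * zeta L (pos q i - pos q j)

/-- The coefficient of `s ^ min l N` in `det (2 κ I + Q + s F)`, a polynomial in `κ`. In the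
matrix below the inner polynomial variable is `κ` and the outer one is `s`. -/
def kernelPoly (L : PeriodPair) (q : Phase N l) : Polynomial ℂ :=
  (Matrix.det (Matrix.of fun i j : Fin N =>
    (Polynomial.C (Polynomial.C (Q L q i j) + if i = j then 2 * Polynomial.X else 0) +
      Polynomial.X * Polynomial.C (Polynomial.C (F q i j)) :
      Polynomial (Polynomial ℂ)))).coeff (min l N)

/-- Generic points: `F`, whose rank is at most `min l N`, has `min l N` distinct nonzero
eigenvalues, and `kernelPoly` has only simple roots. -/
def IsGeneric (L : PeriodPair) (q : Phase N l) : Prop :=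
  (spectrum ℂ (F q) \ {0}).ncard = min l N ∧ (kernelPoly L q).Separable

end SpinCM

end

/-! Conservation. The equations of motion imply the Lax equation `L' = M L - L M`
(`hasDerivAt_lax`), so by Jacobi's formula every `det (2k + L)` is constant in time. The Lax
equation rests on two identities for `Φ`: the product formula `Φ(x) Φ(-x) = ℘(z) - ℘(x)`, whose
derivative in `x` produces the force, and the addition formula `Phi_mul_dPhi_sub`, which handles the
off-diagonal entries. Both are proved by comparing elliptic functions of `z` with double poles on
the lattice.

Coefficients. `L(z)` is periodic in `z` but has an essential singularity at `0`. Conjugation by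
`diag (exp (ζ(z) x_i))` turns it into `laxR`, which is not periodic but has only a simple pole. The
determinant keeps the good property of each, so the coefficient of `k^i` is elliptic with poles only
on the lattice, of order at most `N - i`. Subtracting derivatives of `℘` lowers the order until a
simple pole is left. An elliptic function with one simple pole per cell is constant, because the
quasi-periods of `ζ` are not proportional to the periods (`not_forall_quasiPeriod_eq`).

Factorization. Near `0`, `laxR = (2 - F)/z + Q + O(z)`, the diagonal fitting because `f_ii = 2`.
Hence `z k` runs over the eigenvalues of an analytic matrix `B(z)` with `B(0) = F/2 - 1`. Continuity
of roots gives `ν_i = 1 - e_i/2`, with `e_i` the eigenvalues of `F`, and `z h_i → 0`; the rank bound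
on `F` gives `ν_i = 1` for `i > l`. At a generic point the nonzero eigenvalues are simple and give
analytic branches by the implicit function theorem. On the remaining branches put `k = -1/z + κ`:
with `m = min(l, N)`, the determinant `det (2κ + Q + O(z) - F/z)` times `(-z)^m` tends to
`kernelPoly`, whose simple roots give the missing branches.

Density. Each of the two genericity conditions says that a polynomial of bounded degree has full
degree and simple roots. Along a complex analytic path this is the nonvanishing of an analytic
function, so it holds near the start of the path as soon as it holds somewhere on it. It therefore
suffices to find, over any given positions, one point for each condition: a Fourier matrix for the
eigenvalues, and a block matrix with large momenta for `kernelPoly`. -/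

namespace SpinCM

/-! ### The sigma and zeta functions -/

/-- The quadratic Weierstrass elementary factor is `1 + O(u³)`. -/
lemma norm_one_sub_mul_exp_sub_one_le {u : ℂ} (hu : ‖u‖ ≤ 1 / 2) :
    ‖(1 - u) * Complex.exp (u + u ^ 2 / 2) - 1‖ ≤ 2 * ‖u‖ ^ 3 := by
  have h1 : 1 - u ≠ 0 := by
    intro h
    rw [← sub_eq_zero.mp h] at hu
    norm_num at hu
  -- The factor is `exp w`, where `w` is the cubic remainder of `log (1 - u)`. The Taylor bound
  -- gives `‖w‖ ≤ ‖u‖³`, and `‖exp w - 1‖ ≤ 2 ‖w‖` for `‖w‖ ≤ 1`.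
  have hlog := Complex.norm_log_sub_logTaylor_le 2 (z := -u) (by rw [norm_neg]; linarith)
  have hT : Complex.logTaylor (2 + 1) (-u) = -u - u ^ 2 / 2 := by
    simp [Complex.logTaylor_succ, Complex.logTaylor_zero]
    ring
  rw [hT, norm_neg, ← sub_eq_add_neg] at hlog
  set w := Complex.log (1 - u) - (-u - u ^ 2 / 2) with hw
  have hinv : (1 - ‖u‖)⁻¹ ≤ 2 := by
    rw [inv_le_comm₀ (by linarith) (by norm_num)]
    linarith
  have hw3 : ‖w‖ ≤ ‖u‖ ^ 3 := by
    refine hlog.trans ?_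
    norm_num
    have : ‖u‖ ^ 3 * (1 - ‖u‖)⁻¹ ≤ ‖u‖ ^ 3 * 2 := by gcongr
    have h0 : 0 ≤ ‖u‖ ^ 3 := by positivity
    linarith
  have hexp : (1 - u) * Complex.exp (u + u ^ 2 / 2) = Complex.exp w := by
    have : w = Complex.log (1 - u) + (u + u ^ 2 / 2) := by rw [hw]; ring
    rw [this, Complex.exp_add (Complex.log _), Complex.exp_log h1]
  rw [hexp]
  refine (Complex.norm_exp_sub_one_le (hw3.trans ?_)).trans (by linarith)
  exact pow_le_one₀ (norm_nonneg u) (by linarith)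

/-- The factors of the product that defines `sigma`. -/
noncomputable def sigmaFactor (w z : ℂ) : ℂ :=
  (1 - z / w) * Complex.exp (z / w + z ^ 2 / (2 * w ^ 2))

/-- The summands of the series that defines `zeta`. -/
noncomputable def zetaTerm (w z : ℂ) : ℂ := 1 / (z - w) + 1 / w + z / w ^ 2

/-- `sigma` without its zero at the origin. -/
noncomputable def sigmaExcept (L : PeriodPair) (z : ℂ) : ℂ := ∏' w : L.lattice, sigmaFactor w z

lemma sigma_eq (L : PeriodPair) (z : ℂ) : sigma L z = z * sigmaExcept L z := rfl

lemma zeta_eq (L : PeriodPair) (z : ℂ) : zeta L z = ∑' w : L.lattice, zetaTerm w z := rfl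

@[simp] lemma sigmaFactor_zero_left (z : ℂ) : sigmaFactor 0 z = 1 := by simp [sigmaFactor]

@[simp] lemma sigmaFactor_zero_right (w : ℂ) : sigmaFactor w 0 = 1 := by simp [sigmaFactor]

lemma differentiable_sigmaFactor (w : ℂ) : Differentiable ℂ (sigmaFactor w) := by
  unfold sigmaFactor
  fun_prop

lemma norm_sigmaFactor_sub_one_le {r : ℝ} {z w : ℂ} (hz : ‖z‖ < r) (hw : 2 * r ≤ ‖w‖) :
    ‖sigmaFactor w z - 1‖ ≤ 2 * r ^ 3 * ‖w‖ ^ (-3 : ℝ) := by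
  have hr : 0 < r := (norm_nonneg z).trans_lt hz
  have hw0 : 0 < ‖w‖ := by linarith
  have h := norm_one_sub_mul_exp_sub_one_le (u := z / w) (by
    rw [norm_div, div_le_iff₀ hw0]
    linarith)
  have he : z / w + z ^ 2 / (2 * w ^ 2) = z / w + (z / w) ^ 2 / 2 := by rw [div_pow]; ring
  rw [sigmaFactor, he]
  refine h.trans ?_
  rw [norm_div, div_pow, show (-3 : ℝ) = ((-3 : ℤ) : ℝ) by norm_num, Real.rpow_intCast]
  rw [zpow_neg, show (3 : ℤ) = ((3 : ℕ) : ℤ) by norm_num, zpow_natCast, mul_assoc, div_eq_mul_inv]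
  gcongr

lemma norm_zetaTerm_le {r : ℝ} {z w : ℂ} (hz : ‖z‖ < r) (hw : 2 * r ≤ ‖w‖) :
    ‖zetaTerm w z‖ ≤ 2 * r ^ 2 * ‖w‖ ^ (-3 : ℝ) := by
  have hr : 0 < r := (norm_nonneg z).trans_lt hz
  have hw0 : 0 < ‖w‖ := by linarith
  have hw1 : w ≠ 0 := norm_pos_iff.mp hw0
  have hzw : ‖w‖ / 2 ≤ ‖z - w‖ := by
    rw [norm_sub_rev]
    exact .trans (by linarith) (norm_sub_norm_le w z)
  have hzw1 : z - w ≠ 0 := norm_pos_iff.mp (by linarith)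
  have he : zetaTerm w z = z ^ 2 / (w ^ 2 * (z - w)) := by
    rw [zetaTerm]; field_simp; ring
  rw [he, norm_div, norm_mul, norm_pow, norm_pow,
    show (-3 : ℝ) = ((-3 : ℤ) : ℝ) by norm_num, Real.rpow_intCast, zpow_neg,
    show (3 : ℤ) = ((3 : ℕ) : ℤ) by norm_num, zpow_natCast]
  calc ‖z‖ ^ 2 / (‖w‖ ^ 2 * ‖z - w‖) ≤ r ^ 2 / (‖w‖ ^ 2 * (‖w‖ / 2)) := by gcongr
    _ = 2 * r ^ 2 * (‖w‖ ^ 3)⁻¹ := by field_simp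

lemma summable_lattice_norm_rpow (L : PeriodPair) :
    Summable fun w : L.lattice => ‖(w : ℂ)‖ ^ (-3 : ℝ) :=
  ZLattice.summable_norm_rpow L.lattice (-3) (by simp; norm_num)

lemma eventually_lattice_norm_ge (L : PeriodPair) (r : ℝ) :
    ∀ᶠ w : L.lattice in cofinite, r ≤ ‖(w : ℂ)‖ := by
  refine (isCompact_iff_finite.mp (isCompact_closedBall (0 : L.lattice) r)).subset ?_
  intro w hw
  simp only [Set.mem_compl_iff, Set.mem_ofPred_eq, not_le] at hw
  simpa using! hw.le

lemma multipliableLocallyUniformlyOn_sigmaFactor (L : PeriodPair) (r : ℝ) :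
    MultipliableLocallyUniformlyOn (fun (w : L.lattice) z => sigmaFactor w z)
      (Metric.ball 0 r) := by
  have := Summable.multipliableLocallyUniformlyOn_one_add (K := Metric.ball (0 : ℂ) r)
    (f := fun (w : L.lattice) z => sigmaFactor w z - 1) Metric.isOpen_ball
    ((summable_lattice_norm_rpow L).mul_left (2 * r ^ 3)) ?_ ?_
  · simpa using this
  · filter_upwards [eventually_lattice_norm_ge L (2 * r)] with w hw z hz
    exact norm_sigmaFactor_sub_one_le (by simpa using hz) hw
  · exact fun w => ((differentiable_sigmaFactor w).continuous.sub continuous_const).continuousOn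

lemma differentiable_sigmaExcept (L : PeriodPair) : Differentiable ℂ (sigmaExcept L) := by
  intro z
  have h := (multipliableLocallyUniformlyOn_sigmaFactor L (‖z‖ + 1)).hasProdLocallyUniformlyOn
  rw [hasProdLocallyUniformlyOn_iff_tendstoLocallyUniformlyOn] at h
  have hd := h.differentiableOn (.of_forall fun s => ?_) Metric.isOpen_ball
  · exact hd.differentiableAt (Metric.isOpen_ball.mem_nhds (by simp))
  · exact DifferentiableOn.fun_finsetProd fun w _ => (differentiable_sigmaFactor w).differentiableOn

lemma differentiable_sigma (L : PeriodPair) : Differentiable ℂ (sigma L) := by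
  have := differentiable_sigmaExcept L
  have h : sigma L = fun z => z * sigmaExcept L z := rfl
  rw [h]
  fun_prop

lemma sigmaFactor_ne_zero {w z : ℂ} (h : w = 0 ∨ z ≠ w) : sigmaFactor w z ≠ 0 := by
  rcases eq_or_ne w 0 with rfl | hw
  · simp
  · refine mul_ne_zero ?_ (Complex.exp_ne_zero _)
    rw [sub_ne_zero]
    intro h'
    rw [eq_div_iff hw, one_mul] at h'
    exact (h.resolve_left hw) h'.symm

lemma sigmaExcept_ne_zero (L : PeriodPair) {z : ℂ} (hz : z = 0 ∨ z ∉ L.lattice) :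
    sigmaExcept L z ≠ 0 := by
  have := tprod_one_add_ne_zero_of_summable (f := fun w : L.lattice => sigmaFactor w z - 1) ?_ ?_
  · simpa [sigmaExcept] using this
  · intro w
    rw [add_sub_cancel]
    refine sigmaFactor_ne_zero ?_
    rcases eq_or_ne (w : ℂ) 0 with h | h
    · exact .inl h
    · right
      rintro rfl
      rcases hz with hz | hz
      · exact h hz
      · exact hz w.2
  · refine Summable.of_norm_bounded_eventually
      ((summable_lattice_norm_rpow L).mul_left (2 * (‖z‖ + 1) ^ 3)) ?_
    filter_upwards [eventually_lattice_norm_ge L (2 * (‖z‖ + 1))] with w hw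
    rw [norm_norm]
    exact norm_sigmaFactor_sub_one_le (by linarith) hw

lemma sigma_ne_zero (L : PeriodPair) {z : ℂ} (hz : z ∉ L.lattice) : sigma L z ≠ 0 :=
  mul_ne_zero (by rintro rfl; exact hz (zero_mem _)) (sigmaExcept_ne_zero L (.inr hz))

lemma sigmaExcept_eq_zero (L : PeriodPair) {z : ℂ} (hz : z ∈ L.lattice) (h0 : z ≠ 0) :
    sigmaExcept L z = 0 := by
  refine tprod_of_exists_eq_zero ⟨⟨z, hz⟩, ?_⟩
  simp [sigmaFactor, div_self h0]

lemma sigma_eq_zero (L : PeriodPair) {z : ℂ} (hz : z ∈ L.lattice) : sigma L z = 0 := by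
  rcases eq_or_ne z 0 with rfl | h0
  · simp [sigma_eq]
  · rw [sigma_eq, sigmaExcept_eq_zero L hz h0, mul_zero]

@[simp] lemma sigmaExcept_zero (L : PeriodPair) : sigmaExcept L 0 = 1 := by
  simp [sigmaExcept]

lemma hasDerivAt_sigma_zero (L : PeriodPair) : HasDerivAt (sigma L) 1 0 := by
  have h := (hasDerivAt_id (0 : ℂ)).mul (differentiable_sigmaExcept L 0).hasDerivAt
  simpa using! h

lemma logDeriv_sigmaFactor {w z : ℂ} (hw : w ≠ 0) (h : z ≠ w) :
    logDeriv (sigmaFactor w) z = zetaTerm w z := by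
  have hzw : z - w ≠ 0 := sub_ne_zero.mpr h
  have hwz : w - z ≠ 0 := sub_ne_zero.mpr h.symm
  have h1 : HasDerivAt (fun z : ℂ => 1 - z / w) (-(1 / w)) z := by
    simpa using ((hasDerivAt_id z).div_const w).const_sub 1
  have h2 : HasDerivAt (fun z : ℂ => z / w + z ^ 2 / (2 * w ^ 2))
      (1 / w + 2 * z / (2 * w ^ 2)) z := by
    simpa using! ((hasDerivAt_id z).div_const w).add (((hasDerivAt_id z).pow 2).div_const (2 * w ^ 2))
  have h3 := h1.mul h2.cexp
  have hd : deriv (sigmaFactor w) z = _ := h3.deriv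
  rw [logDeriv_apply, hd, sigmaFactor, zetaTerm, div_eq_iff]
  · field_simp
    ring
  · exact sigmaFactor_ne_zero (.inr h)

lemma summable_zetaTerm (L : PeriodPair) (z : ℂ) : Summable fun w : L.lattice => zetaTerm w z := by
  refine Summable.of_norm_bounded_eventually
      ((summable_lattice_norm_rpow L).mul_left (2 * (‖z‖ + 1) ^ 2)) ?_
  filter_upwards [eventually_lattice_norm_ge L (2 * (‖z‖ + 1))] with w hw
  exact norm_zetaTerm_le (by linarith) hw

lemma logDeriv_sigmaExcept (L : PeriodPair) {z : ℂ} (hz : z ∉ L.lattice) :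
    logDeriv (sigmaExcept L) z = zeta L z - 1 / z := by
  have hz0 : z ≠ 0 := by rintro rfl; exact hz (zero_mem _)
  have hne : ∀ w : L.lattice, z ≠ w := by rintro w rfl; exact hz w.2
  -- The indices `0` do not match: the factor of `sigmaExcept` there is the constant `1`, while the
  -- summand of `zeta` is `1/z`. This is the origin of the term `1/z` in the statement.
  have hld : ∀ w : L.lattice,
      logDeriv (sigmaFactor w) z = if w = 0 then 0 else zetaTerm w z := by
    intro w
    split_ifs with h
    · subst h
      have : sigmaFactor ((0 : L.lattice) : ℂ) = fun _ => (1 : ℂ) := by ext; simp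
      rw [this, logDeriv_const]
      rfl
    · exact logDeriv_sigmaFactor (by simpa using h) (hne w)
  have hsplit := (summable_zetaTerm L z).tsum_eq_add_tsum_ite 0
  have hs0 : Summable fun w : L.lattice => if w = 0 then 0 else zetaTerm w z := by
    classical
    have := (summable_zetaTerm L z).update (0 : L.lattice) 0
    refine this.congr fun w => ?_
    by_cases h : w = 0 <;> simp [h]
  have hmain := logDeriv_tprod_eq_tsum (s := Metric.ball (0 : ℂ) (‖z‖ + 1)) Metric.isOpen_ball
    (x := z) (by simp) (f := fun (w : L.lattice) z => sigmaFactor w z)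
    (fun w => sigmaFactor_ne_zero (.inr (hne w)))
    (fun w => (differentiable_sigmaFactor w).differentiableOn)
    (by simpa only [hld] using hs0)
    (multipliableLocallyUniformlyOn_sigmaFactor L _) (sigmaExcept_ne_zero L (.inr hz))
  have h1 : logDeriv (sigmaExcept L) z = ∑' w : L.lattice, if w = 0 then 0 else zetaTerm w z := by
    rw [← tsum_congr hld]
    exact hmain
  rw [h1, zeta_eq, hsplit]
  simp [zetaTerm]

lemma analyticAt_logDeriv_sigmaExcept (L : PeriodPair) :
    AnalyticAt ℂ (logDeriv (sigmaExcept L)) 0 := by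
  have h : AnalyticAt ℂ (sigmaExcept L) 0 := (differentiable_sigmaExcept L).analyticAt 0
  exact h.deriv.div h (by simp)

lemma deriv_sigma (L : PeriodPair) {z : ℂ} (hz : z ∉ L.lattice) :
    deriv (sigma L) z = zeta L z * sigma L z := by
  have hz0 : z ≠ 0 := by rintro rfl; exact hz (zero_mem _)
  have h := logDeriv_sigmaExcept L hz
  have h0 := sigmaExcept_ne_zero L (.inr hz)
  rw [logDeriv_apply, div_eq_iff h0] at h
  have hd := ((hasDerivAt_id z).mul (differentiable_sigmaExcept L z).hasDerivAt).deriv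
  have hs : deriv (sigma L) z = _ := hd
  rw [hs, h, sigma_eq]
  simp only [id]
  field_simp
  ring

lemma hasDerivAt_sigma (L : PeriodPair) {z : ℂ} (hz : z ∉ L.lattice) :
    HasDerivAt (sigma L) (zeta L z * sigma L z) z :=
  deriv_sigma L hz ▸ (differentiable_sigma L z).hasDerivAt

lemma hasSumLocallyUniformly_zetaTerm (L : PeriodPair) :
    HasSumLocallyUniformly (fun (w : L.lattice) (z : ℂ) => zetaTerm w z) (zeta L) := by
  refine L.hasSumLocallyUniformly_aux (u := fun r w => 2 * r ^ 2 * ‖(w : ℂ)‖ ^ (-3 : ℝ)) _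
    (fun r _ => (summable_lattice_norm_rpow L).mul_left _) fun r hr =>
    eventually_atTop.mpr ⟨2 * r, ?_⟩
  rintro _ h z hz w rfl
  exact norm_zetaTerm_le hz h

lemma hasDerivAt_zetaTerm {w z : ℂ} (h : z ≠ w) :
    HasDerivAt (zetaTerm w) (-(1 / (z - w) ^ 2 - 1 / w ^ 2)) z := by
  have hzw : z - w ≠ 0 := sub_ne_zero.mpr h
  have h1 := ((hasDerivAt_id z).sub_const w).inv hzw
  have h2 := (h1.add_const (1 / w)).add ((hasDerivAt_id z).div_const (w ^ 2))
  convert! h2 using 1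
  · ext; simp [zetaTerm]
  · simp; ring

/-- Termwise differentiation, justified by locally uniform convergence off the lattice. The
convention `1/0 = 0` makes the index `0` contribute `-1/z²`, as in `℘`. -/
lemma hasDerivAt_zeta (L : PeriodPair) {z : ℂ} (hz : z ∉ L.lattice) :
    HasDerivAt (zeta L) (-L.weierstrassP z) z := by
  have hopen : IsOpen ((L.lattice : Set ℂ)ᶜ) := L.isClosed_lattice.isOpen_compl
  have hne : ∀ (w : L.lattice), ∀ z ∈ (L.lattice : Set ℂ)ᶜ, z ≠ w := by
    rintro w _ hz rfl; exact hz w.2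
  have hT := (hasSumLocallyUniformly_zetaTerm L).tendstoLocallyUniformlyOn (s := (L.lattice : Set ℂ)ᶜ)
  have hdiff : ∀ s : Finset L.lattice,
      DifferentiableOn ℂ (fun z => ∑ w ∈ s, zetaTerm w z) (L.lattice : Set ℂ)ᶜ := fun s =>
    .fun_sum fun w _ z hz => (hasDerivAt_zetaTerm (hne w z hz)).differentiableAt.differentiableWithinAt
  have hD := hT.differentiableOn (.of_forall hdiff) hopen
  have hder := (hT.deriv (.of_forall hdiff) hopen).tendsto_at hz
  have hP : Tendsto (fun s : Finset L.lattice => ∑ w ∈ s, -(1 / (z - w) ^ 2 - 1 / (w : ℂ) ^ 2))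
      atTop (𝓝 (-L.weierstrassP z)) := (L.hasSum_weierstrassP z).neg
  have : deriv (zeta L) z = -L.weierstrassP z := by
    refine tendsto_nhds_unique hder (hP.congr fun s => ?_)
    exact (HasDerivAt.fun_sum fun w _ => hasDerivAt_zetaTerm (hne w z hz)).deriv.symm
  exact this ▸ (hD.differentiableAt (hopen.mem_nhds hz)).hasDerivAt

lemma zetaTerm_neg (w z : ℂ) : zetaTerm (-w) (-z) = -zetaTerm w z := by
  simp only [zetaTerm, sub_neg_eq_add, neg_add_eq_sub, even_two, Even.neg_pow, neg_div, one_div,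
    inv_neg]
  rw [← neg_sub z w, inv_neg]
  ring

@[simp] lemma zeta_neg (L : PeriodPair) (z : ℂ) : zeta L (-z) = -zeta L z := by
  rw [zeta_eq, zeta_eq, ← (Equiv.neg L.lattice).tsum_eq, ← tsum_neg]
  exact tsum_congr fun w => by simpa using zetaTerm_neg w z

@[simp] lemma sigma_neg (L : PeriodPair) (z : ℂ) : sigma L (-z) = -sigma L z := by
  have : sigmaExcept L (-z) = sigmaExcept L z := by
    rw [sigmaExcept, sigmaExcept, ← (Equiv.neg L.lattice).tprod_eq]
    exact tprod_congr fun w => by simp [sigmaFactor]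
  rw [sigma_eq, this, sigma_eq, neg_mul]

/-! ### Quasi-periodicity of zeta and sigma -/

lemma isPreconnected_compl_lattice (L : PeriodPair) : IsPreconnected ((L.lattice : Set ℂ)ᶜ) :=
  (Set.Countable.isConnected_compl_of_one_lt_rank (by simp)
    (countable_of_Lindelof_of_discrete (X := L.lattice))).2

lemma isOpen_compl_lattice (L : PeriodPair) : IsOpen ((L.lattice : Set ℂ)ᶜ) :=
  L.isClosed_lattice.isOpen_compl

lemma add_mem_lattice_iff (L : PeriodPair) {w : ℂ} (hw : w ∈ L.lattice) {z : ℂ} :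
    z + w ∈ L.lattice ↔ z ∈ L.lattice :=
  L.lattice.toAddSubgroup.add_mem_cancel_right hw

lemma neg_mem_lattice_iff (L : PeriodPair) {z : ℂ} : -z ∈ L.lattice ↔ z ∈ L.lattice :=
  L.lattice.toAddSubgroup.neg_mem_iff

lemma weierstrassP_add_of_mem (L : PeriodPair) {w : ℂ} (hw : w ∈ L.lattice) (z : ℂ) :
    L.weierstrassP (z + w) = L.weierstrassP z :=
  L.weierstrassP_add_coe z ⟨w, hw⟩

/-- A function on the complement of the lattice with vanishing derivative is constant. -/
lemma exists_eq_const_of_hasDerivAt_zero (L : PeriodPair) {f : ℂ → ℂ}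
    (hf : ∀ z ∉ L.lattice, HasDerivAt f 0 z) : ∃ c, ∀ z ∉ L.lattice, f z = c := by
  refine ⟨f (L.ω₁ / 2), fun z hz => ?_⟩
  exact (isOpen_compl_lattice L).is_const_of_deriv_eq_zero (isPreconnected_compl_lattice L)
    (fun z hz => (hf z hz).differentiableAt.differentiableWithinAt)
    (fun z hz => (hf z hz).deriv) hz L.ω₁_div_two_notMem_lattice

/-- The difference has derivative `-℘(z + w) + ℘(z) = 0` on the complement of the lattice, which is
connected. -/
lemma exists_zeta_add (L : PeriodPair) {w : ℂ} (hw : w ∈ L.lattice) :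
    ∃ η, ∀ z ∉ L.lattice, zeta L (z + w) = zeta L z + η := by
  obtain ⟨c, hc⟩ := exists_eq_const_of_hasDerivAt_zero L
    (f := fun z => zeta L (z + w) - zeta L z) (fun z hz => by
      have h1 := (hasDerivAt_zeta L (z := z + w) (by rwa [add_mem_lattice_iff L hw])).comp_add_const
      have h2 := h1.sub (hasDerivAt_zeta L hz)
      rwa [weierstrassP_add_of_mem L hw, sub_self] at h2)
  exact ⟨c, fun z hz => by rw [← hc z hz]; ring⟩

/-- The quasi-periods of the zeta function. -/
noncomputable def quasiPeriod (L : PeriodPair) (w : ℂ) : ℂ := zeta L (L.ω₁ / 2 + w) - zeta L (L.ω₁ / 2)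

lemma zeta_add (L : PeriodPair) {w : ℂ} (hw : w ∈ L.lattice) {z : ℂ} (hz : z ∉ L.lattice) :
    zeta L (z + w) = zeta L z + quasiPeriod L w := by
  obtain ⟨η, hη⟩ := exists_zeta_add L hw
  rw [quasiPeriod, hη z hz, hη _ L.ω₁_div_two_notMem_lattice]
  ring

/-- The quotient of the two sides has logarithmic derivative `ζ(z + w) - η - ζ(z) = 0`. The value of
`c` is never needed, since it cancels in `psi`. -/
lemma exists_sigma_add (L : PeriodPair) {w : ℂ} (hw : w ∈ L.lattice) :
    ∃ c ≠ 0, ∀ z, sigma L (z + w) = c * Complex.exp (quasiPeriod L w * z) * sigma L z := by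
  set η := quasiPeriod L w
  obtain ⟨c, hc⟩ := exists_eq_const_of_hasDerivAt_zero L
    (f := fun z => sigma L (z + w) / (Complex.exp (η * z) * sigma L z)) (fun z hz => by
      have hzw : z + w ∉ L.lattice := by rwa [add_mem_lattice_iff L hw]
      have h1 := (hasDerivAt_sigma L hzw).comp_add_const
      have h2 : HasDerivAt (fun z => Complex.exp (η * z)) (Complex.exp (η * z) * η) z := by
        simpa using ((hasDerivAt_id z).const_mul η).cexp
      have h3 := h1.div (h2.mul (hasDerivAt_sigma L hz))
        (mul_ne_zero (Complex.exp_ne_zero _) (sigma_ne_zero L hz))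
      convert! h3 using 1
      rw [zeta_add L hw hz, eq_comm, div_eq_zero_iff]
      left
      simp only [Pi.mul_apply]
      ring)
  refine ⟨c, ?_, fun z => ?_⟩
  · have h := hc _ L.ω₁_div_two_notMem_lattice
    rintro rfl
    rw [div_eq_zero_iff, mul_eq_zero] at h
    have hω : L.ω₁ / 2 + w ∉ L.lattice := by
      rw [add_mem_lattice_iff L hw]
      exact L.ω₁_div_two_notMem_lattice
    rcases h with h | h | h
    · exact sigma_ne_zero L hω h
    · exact Complex.exp_ne_zero _ h
    · exact sigma_ne_zero L L.ω₁_div_two_notMem_lattice h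
  · by_cases hz : z ∈ L.lattice
    · rw [sigma_eq_zero L hz, mul_zero, sigma_eq_zero L (add_mem hz hw)]
    · have h := hc z hz
      rw [div_eq_iff (mul_ne_zero (Complex.exp_ne_zero _) (sigma_ne_zero L hz))] at h
      rw [h]
      ring

end SpinCM

namespace SpinCM

/-! ### Elliptic functions without poles -/

/-- `f` agrees near `z`, except possibly at `z`, with a function that is analytic at `z`. -/
def IsRegularAt (f : ℂ → ℂ) (z : ℂ) : Prop := ∃ g, AnalyticAt ℂ g z ∧ f =ᶠ[𝓝[≠] z] g

lemma _root_.AnalyticAt.isRegularAt {f : ℂ → ℂ} {z : ℂ} (h : AnalyticAt ℂ f z) :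
    IsRegularAt f z := ⟨f, h, .rfl⟩

lemma eventually_nhdsNE_add {p : ℂ → Prop} {z w : ℂ} (h : ∀ᶠ u in 𝓝[≠] z, p u) :
    ∀ᶠ u in 𝓝[≠] (z + w), p (u - w) := by
  rw [eventually_nhdsWithin_iff] at h ⊢
  have ht : Tendsto (fun u => u - w) (𝓝 (z + w)) (𝓝 z) := by
    have : Continuous fun u : ℂ => u - w := by fun_prop
    simpa using this.tendsto (z + w)
  filter_upwards [ht.eventually h] with u hu hne
  exact hu fun h => hne (by rw [← Set.mem_singleton_iff.mp h]; simp)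

lemma IsRegularAt.add_period {f : ℂ → ℂ} {z w : ℂ} (h : IsRegularAt f z)
    (hper : ∀ᶠ u in 𝓝[≠] z, f (u + w) = f u) : IsRegularAt f (z + w) := by
  obtain ⟨g, hg, hfg⟩ := h
  refine ⟨fun u => g (u - w), ?_, ?_⟩
  · have h2 : AnalyticAt ℂ (fun u : ℂ => u - w) (z + w) := by fun_prop
    exact AnalyticAt.fun_comp (by simpa using hg) h2
  · filter_upwards [eventually_nhdsNE_add (w := w) (hper.and hfg)] with u hu
    rw [← hu.2, ← hu.1, sub_add_cancel]

/-- An elliptic function without poles is constant. -/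
theorem exists_eq_const_of_isRegularAt (L : PeriodPair) {f : ℂ → ℂ}
    (hper : ∀ w ∈ L.lattice, ∀ z, ∀ᶠ u in 𝓝[≠] z, f (u + w) = f u)
    (hreg : ∀ z, IsRegularAt f z) : ∃ c, ∀ z, ContinuousAt f z → f z = c := by
  -- The local analytic extensions glue: near `z`, both `G` and `g z` are the limits of `f` through
  -- punctured neighbourhoods. So `G` is entire and periodic, hence bounded, and Liouville's theorem
  -- applies.
  choose g hg hfg using hreg
  set G : ℂ → ℂ := fun z => g z z with hG
  have hlim : ∀ z, Tendsto f (𝓝[≠] z) (𝓝 (G z)) := fun z =>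
    ((hg z).continuousAt.tendsto.mono_left nhdsWithin_le_nhds).congr' (hfg z).symm
  have hGg : ∀ z, G =ᶠ[𝓝 z] g z := by
    intro z
    have h1 : ∀ᶠ u in 𝓝[≠] z, G u = g z u := by
      have h2 : ∀ᶠ u in 𝓝[≠] z, ∀ᶠ v in 𝓝 u, v ∈ ({z} : Set ℂ)ᶜ → f v = g z v :=
        (eventually_nhdsWithin_iff.mp (hfg z)).eventually_nhds.filter_mono nhdsWithin_le_nhds
      filter_upwards [h2, self_mem_nhdsWithin,
        (hg z).eventually_analyticAt.filter_mono nhdsWithin_le_nhds] with u hu hne hgu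
      have h3 : f =ᶠ[𝓝[≠] u] g z := by
        have h4 : ∀ᶠ v in 𝓝 u, v ∈ ({z} : Set ℂ)ᶜ := isOpen_compl_singleton.mem_nhds hne
        exact ((hu.and h4).mono fun v hv => hv.1 hv.2).filter_mono nhdsWithin_le_nhds
      exact tendsto_nhds_unique ((hlim u).congr' h3)
        (hgu.continuousAt.tendsto.mono_left nhdsWithin_le_nhds)
    rw [eventually_nhdsWithin_iff] at h1
    filter_upwards [h1] with u hu
    rcases eq_or_ne u z with rfl | hne
    · rfl
    · exact hu hne
  have hGd : Differentiable ℂ G := fun z => ((hg z).congr (hGg z).symm).differentiableAt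
  have hGper : ∀ z, ∀ w ∈ L.lattice, G (z + w) = G z := by
    intro z w hw
    refine tendsto_nhds_unique (f := f) (hlim (z + w)) ?_
    have h1 : Tendsto (fun u => u - w) (𝓝[≠] (z + w)) (𝓝[≠] z) :=
      fun s hs => eventually_nhdsNE_add (p := (· ∈ s)) hs
    refine ((hlim z).comp h1).congr' ?_
    filter_upwards [eventually_nhdsNE_add (w := w) (hper w hw z)] with u hu
    simp only [Function.comp_apply]
    rw [← hu, sub_add_cancel]
  have hb := (IsZLattice.isCompact_range_of_periodic L.lattice G hGd.continuous hGper).isBounded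
  refine ⟨G 0, fun z hz => ?_⟩
  rw [← hGd.apply_eq_apply_of_bounded hb z 0]
  exact tendsto_nhds_unique (hz.tendsto.mono_left nhdsWithin_le_nhds) (hlim z)

lemma eventually_notMem_lattice (L : PeriodPair) (z : ℂ) : ∀ᶠ u in 𝓝[≠] z, u ∉ L.lattice := by
  filter_upwards [self_mem_nhdsWithin,
    mem_nhdsWithin_of_mem_nhds (L.compl_lattice_sdiff_singleton_mem_nhds z)] with u h1 h2 h3
  exact h2 ⟨h3, h1⟩

/-- A function with the lattice as periods and without poles is constant. -/
theorem exists_eq_const_off_lattice (L : PeriodPair) {f : ℂ → ℂ}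
    (hper : ∀ w ∈ L.lattice, ∀ z ∉ L.lattice, f (z + w) = f z)
    (han : ∀ z ∉ L.lattice, AnalyticAt ℂ f z) (h0 : IsRegularAt f 0) :
    ∃ c, ∀ z ∉ L.lattice, f z = c := by
  have hper' : ∀ w ∈ L.lattice, ∀ z, ∀ᶠ u in 𝓝[≠] z, f (u + w) = f u := fun w hw z =>
    (eventually_notMem_lattice L z).mono fun u hu => hper w hw u hu
  obtain ⟨c, hc⟩ := exists_eq_const_of_isRegularAt L hper' fun z => by
    by_cases hz : z ∈ L.lattice
    · simpa using h0.add_period (w := z) (hper' z hz 0)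
    · exact (han z hz).isRegularAt
  exact ⟨c, fun z hz => hc z (han z hz).continuousAt⟩

lemma analyticAt_dslope {g : ℂ → ℂ} {c : ℂ} (hg : AnalyticAt ℂ g c) :
    AnalyticAt ℂ (dslope g c) c := by
  rw [Complex.analyticAt_iff_eventually_differentiableAt] at hg ⊢
  obtain ⟨t, hd, hto, hct⟩ := eventually_nhds_iff.mp hg
  have hdd : DifferentiableOn ℂ (dslope g c) t :=
    (Complex.differentiableOn_dslope (hto.mem_nhds hct)).mpr
      fun u hu => (hd u hu).differentiableWithinAt
  filter_upwards [hto.mem_nhds hct] with u hu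
  exact hdd.differentiableAt (hto.mem_nhds hu)

/-! ### The pole of the zeta function -/

lemma zeta_eq_inv_add (L : PeriodPair) {z : ℂ} (hz : z ∉ L.lattice) :
    zeta L z = 1 / z + logDeriv (sigmaExcept L) z := by
  rw [logDeriv_sigmaExcept L hz]
  ring

/-- An odd function vanishes at `0`. Oddness comes from that of `ζ` and is available only off the
lattice, hence the passage to the limit. -/
lemma logDeriv_sigmaExcept_zero (L : PeriodPair) : logDeriv (sigmaExcept L) 0 = 0 := by
  have hlim : Tendsto (logDeriv (sigmaExcept L)) (𝓝[≠] 0) (𝓝 (logDeriv (sigmaExcept L) 0)) :=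
    (analyticAt_logDeriv_sigmaExcept L).continuousAt.tendsto.mono_left nhdsWithin_le_nhds
  have hneg : Tendsto (fun z : ℂ => -z) (𝓝[≠] 0) (𝓝[≠] 0) := by
    refine tendsto_nhdsWithin_iff.mpr ⟨?_, ?_⟩
    · have : Continuous fun z : ℂ => -z := continuous_neg
      exact (by simpa using this.tendsto 0 : Tendsto (fun z : ℂ => -z) (𝓝 0) (𝓝 0)).mono_left
        nhdsWithin_le_nhds
    · filter_upwards [self_mem_nhdsWithin] with z hz
      simpa using hz
  have h2 : Tendsto (logDeriv (sigmaExcept L)) (𝓝[≠] 0) (𝓝 (-logDeriv (sigmaExcept L) 0)) := by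
    refine ((hlim.comp hneg).neg).congr' ?_
    filter_upwards [eventually_notMem_lattice L 0] with z hz
    have hz' : -z ∉ L.lattice := by rwa [neg_mem_lattice_iff]
    simp only [Function.comp_apply, logDeriv_sigmaExcept L hz, logDeriv_sigmaExcept L hz', zeta_neg,
      one_div, inv_neg]
    ring
  have := tendsto_nhds_unique hlim h2
  exact self_eq_neg.mp this

lemma weierstrassP_eq_inv_sq_add (L : PeriodPair) (z : ℂ) :
    L.weierstrassP z = 1 / z ^ 2 + L.weierstrassPExcept 0 z := by
  have := L.weierstrassPExcept_add 0 z
  simp at this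
  rw [← this]
  simp
  ring

lemma analyticAt_weierstrassP (L : PeriodPair) {z : ℂ} (hz : z ∉ L.lattice) :
    AnalyticAt ℂ L.weierstrassP z := L.analyticOnNhd_weierstrassP z hz

lemma analyticAt_zeta (L : PeriodPair) {z : ℂ} (hz : z ∉ L.lattice) :
    AnalyticAt ℂ (zeta L) z := by
  refine DifferentiableOn.analyticAt (s := (L.lattice : Set ℂ)ᶜ)
    (fun u hu => (hasDerivAt_zeta L hu).differentiableAt.differentiableWithinAt)
    ((isOpen_compl_lattice L).mem_nhds hz)

/-! ### Periods and quasi-periods are not proportional -/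

/-- A solution of `S'' = a² S` with `S 0 = 0`, `S' 0 = 1`, is determined on its zeros. -/
lemma exp_eq_exp_neg_of_zero {S S' : ℂ → ℂ} {a w : ℂ} (hS : ∀ z, HasDerivAt S (S' z) z)
    (hS' : ∀ z, HasDerivAt S' (a ^ 2 * S z) z) (h0 : S 0 = 0) (h1 : S' 0 = 1) (hw : S w = 0) :
    Complex.exp (a * w) = Complex.exp (-(a * w)) ∧ (a = 0 → w = 0) := by
  -- For `b = ±a` the function `S' + b S` solves `y' = b y`, `y 0 = 1`. At a zero `w` of `S` both
  -- choices give `S' w`, so `exp (a w) = exp (-a w)`.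
  have key : ∀ b, b ^ 2 = a ^ 2 → ∀ z, S' z + b * S z = Complex.exp (b * z) := by
    intro b hb z
    have hd : ∀ z, HasDerivAt (fun z => (S' z + b * S z) * Complex.exp (-(b * z))) 0 z := by
      intro z
      have h2 : HasDerivAt (fun z => Complex.exp (-(b * z))) (Complex.exp (-(b * z)) * (-b)) z := by
        simpa using! (((hasDerivAt_id z).const_mul b).neg).cexp
      have h3 := ((hS' z).add ((hS z).const_mul b)).mul h2
      convert! h3 using 1
      simp only [Pi.add_apply]
      rw [← hb]
      ring
    have hc := is_const_of_deriv_eq_zero (fun z => (hd z).differentiableAt)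
      (fun z => (hd z).deriv) z 0
    simp only [h0, h1, mul_zero, add_zero, neg_zero, Complex.exp_zero, mul_one] at hc
    rwa [Complex.exp_neg, mul_inv_eq_one₀ (Complex.exp_ne_zero _)] at hc
  refine ⟨?_, ?_⟩
  · have h2 := key a rfl w
    have h3 := key (-a) (by ring) w
    rw [hw, mul_zero, add_zero] at h2 h3
    rw [← h2, h3, neg_mul]
  · rintro rfl
    have h2 : ∀ z, S' z = 1 := fun z => by simpa using key 0 rfl z
    have hd : ∀ z, HasDerivAt (fun z => S z - z) 0 z := fun z => by
      have := (hS z).sub (hasDerivAt_id z)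
      rwa [h2, sub_self] at this
    have hc := is_const_of_deriv_eq_zero (fun z => (hd z).differentiableAt)
      (fun z => (hd z).deriv) w 0
    simpa [h0, hw] using hc

/-- The quasi-periods of the zeta function are not proportional to the periods. -/
theorem not_forall_quasiPeriod_eq (L : PeriodPair) (C : ℂ) :
    ¬ ∀ w ∈ L.lattice, quasiPeriod L w = -(C * w) := by
  intro hC
  -- A weak form of Legendre's relation. If the quasi-periods were `-C w`, then `φ` would be
  -- elliptic, and so would `φ' + φ²`. The double poles of the latter cancel, and it has no simple
  -- pole because the regular part of `ζ` vanishes at `0`; so it is a constant `A = a²`.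
  set φ : ℂ → ℂ := fun z => zeta L z + C * z with hφ
  have hφper : ∀ w ∈ L.lattice, ∀ z ∉ L.lattice, φ (z + w) = φ z := fun w hw z hz => by
    simp only [hφ, zeta_add L hw hz, hC w hw]
    ring
  obtain ⟨A, hA⟩ := exists_eq_const_off_lattice L (f := fun z => -L.weierstrassP z + C + φ z ^ 2)
    (fun w hw z hz => by rw [hφper w hw z hz, weierstrassP_add_of_mem L hw])
    (fun z hz => by
      have h1 := analyticAt_weierstrassP L hz
      have h2 := analyticAt_zeta L hz
      fun_prop) (by
      set g := logDeriv (sigmaExcept L) with hg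
      have hga : AnalyticAt ℂ g 0 := analyticAt_logDeriv_sigmaExcept L
      have hgd : AnalyticAt ℂ (dslope g 0) 0 := analyticAt_dslope hga
      refine ⟨fun z => -L.weierstrassPExcept 0 z + 3 * C + 2 * dslope g 0 z + (g z + C * z) ^ 2,
        ?_, ?_⟩
      · have := L.analyticAt_weierstrassPExcept 0
        fun_prop
      · filter_upwards [eventually_notMem_lattice L 0, self_mem_nhdsWithin] with z hz hz0
        have hz0 : z ≠ 0 := hz0
        simp only [hφ]
        rw [zeta_eq_inv_add L hz, weierstrassP_eq_inv_sq_add, dslope_of_ne _ hz0, slope_def_field,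
          ← hg, show g 0 = 0 from logDeriv_sigmaExcept_zero L]
        field_simp
        ring)
  obtain ⟨a, ha⟩ := IsAlgClosed.exists_pow_nat_eq A (n := 2) (by norm_num)
  -- `S` is the function with `S' = φ S`, hence `S'' = (φ' + φ²) S = a² S`. It vanishes on the whole
  -- lattice, but solutions of this equation have their zeros on one real line, so `ω₁` and `ω₂`
  -- would be dependent over `ℝ`.
  set S : ℂ → ℂ := fun z => sigma L z * Complex.exp (C * z ^ 2 / 2) with hS
  set S' : ℂ → ℂ := fun z => (deriv (sigma L) z + C * z * sigma L z) *
    Complex.exp (C * z ^ 2 / 2) with hS'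
  have he : ∀ z, HasDerivAt (fun z => Complex.exp (C * z ^ 2 / 2))
      (Complex.exp (C * z ^ 2 / 2) * (C * z)) z := fun z => by
    have := ((((hasDerivAt_id z).pow 2).const_mul C).div_const 2).cexp
    convert! this using 1
    simp
    ring
  have hσ := differentiable_sigma L
  have hσ' : Differentiable ℂ (deriv (sigma L)) := hσ.deriv
  have hSd : ∀ z, HasDerivAt S (S' z) z := fun z => by
    have := (hσ z).hasDerivAt.mul (he z)
    convert! this using 1
    simp only [hS']
    ring
  have hS'd : Differentiable ℂ S' := by fun_prop
  have hSS : ∀ z, deriv S' z = a ^ 2 * S z := by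
    have hc1 : Continuous (deriv S') := (hS'd.deriv).continuous
    have hc2 : Continuous fun z => a ^ 2 * S z :=
      continuous_const.mul (Differentiable.continuous fun z => (hSd z).differentiableAt)
    have hdense : Dense ((L.lattice : Set ℂ)ᶜ) :=
      Set.Countable.dense_compl ℂ (countable_of_Lindelof_of_discrete (X := L.lattice))
    refine fun z => congrFun (Continuous.ext_on hdense hc1 hc2 fun z hz => ?_) z
    have h1 : S' =ᶠ[𝓝 z] fun z => φ z * S z := by
      filter_upwards [(isOpen_compl_lattice L).mem_nhds hz] with u hu
      simp only [hS', hS, hφ, deriv_sigma L hu]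
      ring
    have h2 : HasDerivAt (fun z => φ z * S z) _ z :=
      (((hasDerivAt_zeta L hz).add ((hasDerivAt_id z).const_mul C))).mul (hSd z)
    have h4 : S' z = φ z * S z := h1.eq_of_nhds
    rw [h1.deriv_eq, h2.deriv, ha, ← hA z hz, h4]
    simp only [Pi.add_apply, id, mul_one, hφ]
    ring
  have hS'' : ∀ z, HasDerivAt S' (a ^ 2 * S z) z := fun z => hSS z ▸ (hS'd z).hasDerivAt
  have h0 : S 0 = 0 := by simp [hS, sigma_eq_zero L (zero_mem _)]
  have h1 : S' 0 = 1 := by simp [hS', (hasDerivAt_sigma_zero L).deriv]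
  have hzero : ∀ w ∈ L.lattice, S w = 0 := fun w hw => by simp [hS, sigma_eq_zero L hw]
  obtain ⟨he1, hz1⟩ := exp_eq_exp_neg_of_zero hSd hS'' h0 h1 (hzero _ L.ω₁_mem_lattice)
  obtain ⟨he2, -⟩ := exp_eq_exp_neg_of_zero hSd hS'' h0 h1 (hzero _ L.ω₂_mem_lattice)
  have hω1 : L.ω₁ ≠ 0 := fun h => L.ω₁_div_two_notMem_lattice (by simp [h])
  have hω2 : L.ω₂ ≠ 0 := fun h => L.ω₂_div_two_notMem_lattice (by simp [h])
  have ha0 : a ≠ 0 := fun h => hω1 (hz1 h)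
  obtain ⟨m, hm⟩ := Complex.exp_eq_exp_iff_exists_int.mp he1
  obtain ⟨n, hn⟩ := Complex.exp_eq_exp_iff_exists_int.mp he2
  have hm' : a * L.ω₁ = m * (Real.pi * Complex.I) := by linear_combination hm / 2
  have hn' : a * L.ω₂ = n * (Real.pi * Complex.I) := by linear_combination hn / 2
  have hπ : (Real.pi * Complex.I : ℂ) ≠ 0 := by simp [Real.pi_ne_zero]
  have hrel : (n : ℂ) * L.ω₁ = m * L.ω₂ := by
    apply mul_left_cancel₀ ha0
    linear_combination (n : ℂ) * hm' - (m : ℂ) * hn'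
  have hlin := LinearIndependent.pair_iff.mp L.indep (n : ℝ) (-(m : ℝ)) (by
    simp only [Complex.real_smul, Complex.ofReal_intCast, Complex.ofReal_neg]
    rw [hrel]
    ring)
  have hn0 : (n : ℂ) = 0 := by exact_mod_cast hlin.1
  rw [hn0, zero_mul] at hn'
  exact (mul_ne_zero ha0 hω2) hn'

/-! ### Elliptic functions with poles on the lattice -/

lemma exists_of_analyticAt_eq_zero {g : ℂ → ℂ} (hg : AnalyticAt ℂ g 0) :
    ∃ h, AnalyticAt ℂ h 0 ∧ ∀ z, g z = g 0 + z * h z := by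
  refine ⟨dslope g 0, analyticAt_dslope hg, fun z => ?_⟩
  have := sub_smul_dslope g 0 z
  simp only [sub_zero, smul_eq_mul] at this
  rw [this]
  ring

/-- An elliptic function whose only poles are at most simple poles at the lattice is constant. -/
lemma exists_eq_const_of_simple_pole (L : PeriodPair) {f : ℂ → ℂ}
    (hper : ∀ w ∈ L.lattice, ∀ z ∉ L.lattice, f (z + w) = f z)
    (han : ∀ z ∉ L.lattice, AnalyticAt ℂ f z)
    (hpole : ∃ c g, AnalyticAt ℂ g 0 ∧ ∀ᶠ z in 𝓝[≠] 0, f z = c / z + g z) :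
    ∃ c, ∀ z ∉ L.lattice, f z = c := by
  obtain ⟨c, g, hg, hfg⟩ := hpole
  have hder : ∀ w ∈ L.lattice, ∀ z ∉ L.lattice, deriv f (z + w) = deriv f z := by
    intro w hw z hz
    rw [← deriv_comp_add_const]
    refine Filter.EventuallyEq.deriv_eq ?_
    filter_upwards [(isOpen_compl_lattice L).mem_nhds hz] with u hu using hper w hw u hu
  -- With `c` the residue, `f' + c ℘` has no poles and is a constant `K`. Thus `f = c ζ + K z + D`,
  -- and periodicity of `f` forces `c η(w) + K w = 0` on the lattice, which is impossible unless `c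
  -- = K = 0`.
  obtain ⟨K, hK⟩ := exists_eq_const_off_lattice L (f := fun z => deriv f z + c * L.weierstrassP z)
    (fun w hw z hz => by rw [hder w hw z hz, weierstrassP_add_of_mem L hw])
    (fun z hz => by
      have h1 := analyticAt_weierstrassP L hz
      have h2 := (han z hz).deriv
      fun_prop) (by
      refine ⟨fun z => deriv g z + c * L.weierstrassPExcept 0 z, ?_, ?_⟩
      · have := L.analyticAt_weierstrassPExcept 0
        have := hg.deriv
        fun_prop
      · have h1 : ∀ᶠ z in 𝓝[≠] (0 : ℂ), ∀ᶠ u in 𝓝 z, f u = c / u + g u := by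
          have h2 := (eventually_nhdsWithin_iff.mp hfg).eventually_nhds.filter_mono
            (nhdsWithin_le_nhds (s := ({0} : Set ℂ)ᶜ))
          filter_upwards [h2, self_mem_nhdsWithin] with z hz hz0
          filter_upwards [hz, isOpen_compl_singleton.mem_nhds hz0] with u hu hu0 using hu hu0
        filter_upwards [h1, self_mem_nhdsWithin,
          hg.eventually_analyticAt.filter_mono nhdsWithin_le_nhds] with z hz hz0 hgz
        have hz0 : z ≠ 0 := hz0
        have h3 : HasDerivAt (fun u => c / u + g u) (-c / z ^ 2 + deriv g z) z := by
          have := (((hasDerivAt_inv hz0).const_mul c)).add hgz.differentiableAt.hasDerivAt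
          convert! this using 1
          ring
        rw [EventuallyEq.deriv_eq (f := fun u => c / u + g u) hz, h3.deriv,
          weierstrassP_eq_inv_sq_add]
        ring)
  obtain ⟨D, hD⟩ := exists_eq_const_of_hasDerivAt_zero L
    (f := fun z => f z - c * zeta L z - K * z) (fun z hz => by
      have h1 := ((han z hz).differentiableAt.hasDerivAt.sub
        ((hasDerivAt_zeta L hz).const_mul c)).sub ((hasDerivAt_id z).const_mul K)
      convert! h1 using 1
      rw [← hK z hz]
      ring)
  have hrel : ∀ w ∈ L.lattice, c * quasiPeriod L w + K * w = 0 := by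
    intro w hw
    have hz := L.ω₁_div_two_notMem_lattice
    have h1 := hD _ hz
    have h2 := hD (L.ω₁ / 2 + w) (by rwa [add_mem_lattice_iff L hw])
    rw [hper w hw _ hz, zeta_add L hw hz] at h2
    linear_combination h1 - h2
  have hc : c = 0 := by
    by_contra hc
    refine not_forall_quasiPeriod_eq L (K / c) fun w hw => ?_
    have := hrel w hw
    field_simp
    linear_combination this
  have hK0 : K = 0 := by
    have := hrel _ L.ω₁_mem_lattice
    rw [hc, zero_mul, zero_add] at this
    refine (mul_eq_zero.mp this).resolve_right fun h => L.ω₁_div_two_notMem_lattice ?_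
    simp [h]
  exact ⟨D, fun z hz => by simpa [hc, hK0] using hD z hz⟩

lemma analyticAt_iteratedDeriv_weierstrassP (L : PeriodPair) (s : ℕ) {z : ℂ} (hz : z ∉ L.lattice) :
    AnalyticAt ℂ (iteratedDeriv s L.weierstrassP) z := by
  induction s with
  | zero => simpa using analyticAt_weierstrassP L hz
  | succ s ih =>
    rw [iteratedDeriv_succ]
    exact ih.deriv

lemma iteratedDeriv_weierstrassP_add (L : PeriodPair) (s : ℕ) {w : ℂ} (hw : w ∈ L.lattice) (z : ℂ) :
    iteratedDeriv s L.weierstrassP (z + w) = iteratedDeriv s L.weierstrassP z := by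
  have h := iteratedDeriv_comp_add_const s L.weierstrassP w
  have h2 : (fun z => L.weierstrassP (z + w)) = L.weierstrassP :=
    funext fun z => weierstrassP_add_of_mem L hw z
  rw [h2] at h
  exact (congrFun h z).symm

lemma meromorphic_iteratedDeriv_weierstrassP (L : PeriodPair) (s : ℕ) :
    Meromorphic (iteratedDeriv s L.weierstrassP) := by
  induction s with
  | zero => simpa using L.meromorphic_weierstrassP
  | succ s ih =>
    rw [iteratedDeriv_succ]
    exact ih.deriv

lemma iteratedDeriv_weierstrassP_pole (L : PeriodPair) (s : ℕ) :
    ∃ g, AnalyticAt ℂ g 0 ∧ ∀ z ∉ L.lattice, iteratedDeriv s L.weierstrassP z =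
      (-1) ^ s * (s + 1).factorial / z ^ (s + 2) + iteratedDeriv s g z := by
  refine ⟨L.weierstrassPExcept 0, L.analyticAt_weierstrassPExcept 0, ?_⟩
  have hana : ∀ s, ∀ z ∉ L.lattice, AnalyticAt ℂ (iteratedDeriv s (L.weierstrassPExcept 0)) z := by
    intro s z hz
    have h0 := L.analyticOnNhd_weierstrassPExcept 0 z fun h => hz h.1
    induction s with
    | zero => simpa using h0
    | succ s ih =>
      rw [iteratedDeriv_succ]
      exact ih.deriv
  induction s with
  | zero =>
    intro z hz
    simpa using weierstrassP_eq_inv_sq_add L z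
  | succ s ih =>
    intro z hz
    have hz0 : z ≠ 0 := by rintro rfl; exact hz (zero_mem _)
    have h1 : iteratedDeriv s L.weierstrassP =ᶠ[𝓝 z] fun z =>
        (-1) ^ s * (s + 1).factorial / z ^ (s + 2) +
          iteratedDeriv s (L.weierstrassPExcept 0) z := by
      filter_upwards [(isOpen_compl_lattice L).mem_nhds hz] with u hu using ih u hu
    have h2 : HasDerivAt (fun z : ℂ => (-1) ^ s * ((s + 1).factorial : ℂ) / z ^ (s + 2))
        ((-1) ^ (s + 1) * ((s + 2).factorial : ℂ) / z ^ (s + 3)) z := by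
      have h3 := ((hasDerivAt_pow (s + 2) z).inv (pow_ne_zero _ hz0)).const_mul
        ((-1) ^ s * ((s + 1).factorial : ℂ))
      convert! h3 using 1
      rw [Nat.factorial_succ (s + 1)]
      push_cast
      field_simp
      ring
    have h4 := h2.add (hana s z hz).differentiableAt.hasDerivAt
    rw [iteratedDeriv_succ, iteratedDeriv_succ, h1.deriv_eq]
    exact h4.deriv

lemma analyticAt_iteratedDeriv {g : ℂ → ℂ} {z : ℂ} (hg : AnalyticAt ℂ g z) (s : ℕ) :
    AnalyticAt ℂ (iteratedDeriv s g) z := by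
  induction s with
  | zero => simpa using hg
  | succ s ih =>
    rw [iteratedDeriv_succ]
    exact ih.deriv

/-- Elliptic functions whose only poles are poles of order at most `n` at the lattice are
combinations of the derivatives of `℘`. -/
theorem exists_eq_sum_iteratedDeriv_weierstrassP (L : PeriodPair) (n : ℕ) : ∀ {f : ℂ → ℂ},
    (∀ w ∈ L.lattice, ∀ z ∉ L.lattice, f (z + w) = f z) →
    (∀ z ∉ L.lattice, AnalyticAt ℂ f z) →
    (∃ g, AnalyticAt ℂ g 0 ∧ ∀ᶠ z in 𝓝[≠] 0, z ^ n * f z = g z) →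
    ∃ (c₀ : ℂ) (c : ℕ → ℂ), ∀ z ∉ L.lattice,
      f z = c₀ + ∑ s ∈ Finset.range (n - 1), c s * iteratedDeriv s L.weierstrassP z := by
  induction n with
  | zero =>
    intro f hper han ⟨g, hg, hfg⟩
    obtain ⟨c, hc⟩ := exists_eq_const_off_lattice L hper han
      ⟨g, hg, hfg.mono fun z hz => by simpa using hz⟩
    exact ⟨c, 0, by simpa using hc⟩
  | succ n ih =>
    intro f hper han ⟨g, hg, hfg⟩
    obtain ⟨h, hh, hgh⟩ := exists_of_analyticAt_eq_zero hg
    rcases n with _ | n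
    · obtain ⟨c, hc⟩ := exists_eq_const_of_simple_pole L hper han ⟨g 0, h, hh, by
        filter_upwards [hfg, self_mem_nhdsWithin] with z hz hz0
        have hz0 : z ≠ 0 := hz0
        rw [hgh z] at hz
        field_simp
        linear_combination hz⟩
      exact ⟨c, 0, by simpa using hc⟩
    · obtain ⟨p, hp, hPp⟩ := iteratedDeriv_weierstrassP_pole L n
      -- `g 0` is the coefficient of `z^-(n+2)` in `f`; the denominator is that coefficient for the
      -- `n`-th derivative of `℘`. Subtracting `b` times this derivative lowers the pole order to `n
      -- + 1`.
      set b : ℂ := g 0 / ((-1) ^ n * (n + 1).factorial) with hb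
      have hfac : ((-1) ^ n * (n + 1).factorial : ℂ) ≠ 0 :=
        mul_ne_zero (pow_ne_zero _ (by norm_num)) (by exact_mod_cast (n + 1).factorial_ne_zero)
      have hbg : b * ((-1) ^ n * (n + 1).factorial) = g 0 := div_mul_cancel₀ _ hfac
      obtain ⟨c₀, c, hc⟩ := ih (f := fun z => f z - b * iteratedDeriv n L.weierstrassP z)
        (fun w hw z hz => by rw [hper w hw z hz, iteratedDeriv_weierstrassP_add L n hw])
        (fun z hz => by
          have h1 := analyticAt_iteratedDeriv_weierstrassP L n hz
          have h2 := han z hz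
          fun_prop)
        ⟨fun z => h z - b * z ^ (n + 1) * iteratedDeriv n p z, by
          have := analyticAt_iteratedDeriv hp n
          fun_prop, by
          filter_upwards [hfg, self_mem_nhdsWithin, eventually_notMem_lattice L 0]
            with z hz hz0 hzL
          have hz0 : z ≠ 0 := hz0
          rw [hgh z] at hz
          rw [hPp z hzL]
          apply mul_left_cancel₀ hz0
          have h5 : z * (z ^ (n + 1) * (f z - b * ((-1) ^ n * (n + 1).factorial / z ^ (n + 2)
              + iteratedDeriv n p z))) = z ^ (n + 1 + 1) * f z - b * ((-1) ^ n * (n + 1).factorial)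
              - z * (b * z ^ (n + 1) * iteratedDeriv n p z) := by
            field_simp
            ring
          rw [h5, hz, hbg]
          ring⟩
      refine ⟨c₀, Function.update c n b, fun z hz => ?_⟩
      have h6 := hc z hz
      have h7 : n + 1 + 1 - 1 = n + 1 := by omega
      rw [h7, Finset.sum_range_succ, Function.update_self]
      have h8 : ∑ s ∈ Finset.range n, Function.update c n b s * iteratedDeriv s L.weierstrassP z =
          ∑ s ∈ Finset.range (n + 1 - 1), c s * iteratedDeriv s L.weierstrassP z := by
        refine Finset.sum_congr (by simp) fun s hs => ?_
        have hs' : s < n := Finset.mem_range.mp hs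
        rw [Function.update_of_ne hs'.ne]
      rw [h8]
      linear_combination h6

end SpinCM

namespace SpinCM

/-! ### The function `Φ` -/

/-- `Φ` without its exponential factor. -/
noncomputable def psi (L : PeriodPair) (x z : ℂ) : ℂ := sigma L (z - x) / (sigma L z * sigma L x)

/-- The derivative of `psi L x z` in `x`. -/
noncomputable def dpsi (L : PeriodPair) (x z : ℂ) : ℂ :=
  -(deriv (sigma L) (z - x) + zeta L x * sigma L (z - x)) / (sigma L z * sigma L x)

/-- The derivative of `Phi L x z` in `x`. -/
noncomputable def dPhi (L : PeriodPair) (x z : ℂ) : ℂ :=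
  (dpsi L x z + zeta L z * psi L x z) * Complex.exp (zeta L z * x)

lemma Phi_eq (L : PeriodPair) (x z : ℂ) : Phi L x z = psi L x z * Complex.exp (zeta L z * x) := rfl

lemma hasDerivAt_psi (L : PeriodPair) {x z : ℂ} (hx : x ∉ L.lattice) (hz : z ∉ L.lattice) :
    HasDerivAt (fun x => psi L x z) (dpsi L x z) x := by
  have hσz := sigma_ne_zero L hz
  have hσx := sigma_ne_zero L hx
  have h1 : HasDerivAt (fun x => sigma L (z - x)) (-deriv (sigma L) (z - x)) x :=
    HasDerivAt.comp_const_sub z x (differentiable_sigma L (z - x)).hasDerivAt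
  have h2 := h1.div ((hasDerivAt_sigma L hx).const_mul (sigma L z)) (mul_ne_zero hσz hσx)
  convert! h2 using 1
  rw [dpsi]
  field_simp
  ring

lemma hasDerivAt_Phi (L : PeriodPair) {x z : ℂ} (hx : x ∉ L.lattice) (hz : z ∉ L.lattice) :
    HasDerivAt (fun x => Phi L x z) (dPhi L x z) x := by
  have h1 : HasDerivAt (fun x => Complex.exp (zeta L z * x))
      (Complex.exp (zeta L z * x) * zeta L z) x := by
    simpa using! ((hasDerivAt_id x).const_mul (zeta L z)).cexp
  convert! (hasDerivAt_psi L hx hz).mul h1 using 1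
  rw [dPhi]
  ring

lemma analyticAt_sigma (L : PeriodPair) (z : ℂ) : AnalyticAt ℂ (sigma L) z :=
  (differentiable_sigma L).analyticAt z

lemma analyticAt_psi (L : PeriodPair) {x z : ℂ} (hx : x ∉ L.lattice) (hz : z ∉ L.lattice) :
    AnalyticAt ℂ (psi L x) z := by
  have h1 := analyticAt_sigma L z
  have h2 : AnalyticAt ℂ (fun z => sigma L (z - x)) z :=
    AnalyticAt.fun_comp (analyticAt_sigma L (z - x)) (by fun_prop)
  exact h2.div (h1.mul analyticAt_const) (mul_ne_zero (sigma_ne_zero L hz) (sigma_ne_zero L hx))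

lemma analyticAt_dpsi (L : PeriodPair) {x z : ℂ} (hx : x ∉ L.lattice) (hz : z ∉ L.lattice) :
    AnalyticAt ℂ (dpsi L x) z := by
  have h1 := analyticAt_sigma L z
  have h2 : AnalyticAt ℂ (fun z => sigma L (z - x)) z :=
    AnalyticAt.fun_comp (analyticAt_sigma L (z - x)) (by fun_prop)
  have h3 : AnalyticAt ℂ (fun z => deriv (sigma L) (z - x)) z :=
    AnalyticAt.fun_comp (analyticAt_sigma L (z - x)).deriv (by fun_prop)
  exact ((h3.add (analyticAt_const.mul h2)).neg).div (h1.mul analyticAt_const)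
    (mul_ne_zero (sigma_ne_zero L hz) (sigma_ne_zero L hx))

lemma psi_add (L : PeriodPair) {w : ℂ} (hw : w ∈ L.lattice) (x z : ℂ) :
    psi L x (z + w) = Complex.exp (-(quasiPeriod L w * x)) * psi L x z := by
  obtain ⟨c, hc, h⟩ := exists_sigma_add L hw
  rw [psi, psi, show z + w - x = z - x + w by ring, h, h, mul_sub, sub_eq_add_neg, Complex.exp_add]
  have := Complex.exp_ne_zero (quasiPeriod L w * z)
  rcases eq_or_ne (sigma L z) 0 with h0 | h0
  · simp [h0]
  rcases eq_or_ne (sigma L x) 0 with h1 | h1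
  · simp [h1]
  field_simp

lemma dpsi_add (L : PeriodPair) {w : ℂ} (hw : w ∈ L.lattice) {x z : ℂ} (hx : x ∉ L.lattice)
    (hz : z ∉ L.lattice) : dpsi L x (z + w) =
      Complex.exp (-(quasiPeriod L w * x)) * (dpsi L x z - quasiPeriod L w * psi L x z) := by
  have h1 := hasDerivAt_psi L hx (z := z + w) (by rwa [add_mem_lattice_iff L hw])
  have h2 : HasDerivAt (fun x => Complex.exp (-(quasiPeriod L w * x)))
      (Complex.exp (-(quasiPeriod L w * x)) * (-quasiPeriod L w)) x := by
    simpa using! (((hasDerivAt_id x).const_mul (quasiPeriod L w)).neg).cexp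
  have h3 := h2.mul (hasDerivAt_psi L hx hz)
  have h4 := h1.unique (h3.congr_of_eventuallyEq (.of_forall fun u => psi_add L hw u z))
  rw [h4]
  ring

lemma deriv_sigma_neg (L : PeriodPair) (z : ℂ) : deriv (sigma L) (-z) = deriv (sigma L) z := by
  have h1 : HasDerivAt (fun z => sigma L (-z)) (-deriv (sigma L) (-z)) z := by
    simpa [-sigma_neg] using! ((differentiable_sigma L (-z)).hasDerivAt.scomp z (hasDerivAt_neg z))
  have h2 : HasDerivAt (fun z => sigma L (-z)) (-deriv (sigma L) z) z := by
    simpa using! (differentiable_sigma L z).hasDerivAt.neg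
  exact neg_injective (h1.unique h2)

lemma deriv_sigmaExcept_zero (L : PeriodPair) : deriv (sigmaExcept L) 0 = 0 := by
  have := logDeriv_sigmaExcept_zero L
  rwa [logDeriv_apply, sigmaExcept_zero, div_one] at this

/-! ### Expansions in the spectral parameter -/

/-- The expansion of `psi` at `z = 0`. -/
lemma exists_psi_expansion (L : PeriodPair) {x : ℂ} (hx : x ∉ L.lattice) :
    ∃ C : ℂ → ℂ, AnalyticAt ℂ C 0 ∧ C 0 = zeta L x ∧
      ∀ z ∉ L.lattice, psi L x z = -1 / z + C z := by
  have hσx := sigma_ne_zero L hx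
  -- `A` is `z ψ`, so the constant term of `ψ` is `A' 0 = σ'(-x) / σ(x) = ζ(x)`. This is what puts
  -- the values of `ζ` into the matrix `Q`.
  set A : ℂ → ℂ := fun z => sigma L (z - x) / (sigmaExcept L z * sigma L x) with hA
  have h1 : HasDerivAt (fun z => sigma L (z - x)) (deriv (sigma L) (0 - x)) 0 :=
    HasDerivAt.comp_sub_const 0 x (differentiable_sigma L (0 - x)).hasDerivAt
  have h2 := ((differentiable_sigmaExcept L 0).hasDerivAt.mul_const (sigma L x))
  have h3 : HasDerivAt A _ 0 := h1.div h2 (by simpa using hσx)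
  have hA0 : A 0 = -1 := by
    simp only [hA, zero_sub, sigma_neg, sigmaExcept_zero, one_mul]
    field_simp
  have hAa : AnalyticAt ℂ A 0 := by
    have h2 : AnalyticAt ℂ (fun z => sigma L (z - x)) 0 :=
      AnalyticAt.fun_comp (analyticAt_sigma L (0 - x)) (by fun_prop)
    exact h2.div (((differentiable_sigmaExcept L).analyticAt 0).mul analyticAt_const)
      (by simpa using hσx)
  refine ⟨dslope A 0, analyticAt_dslope hAa, ?_, fun z hz => ?_⟩
  · rw [dslope_same, h3.deriv, deriv_sigmaExcept_zero, zero_sub, deriv_sigma_neg, deriv_sigma L hx,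
      sigmaExcept_zero]
    field_simp
    ring
  · have hz0 : z ≠ 0 := by rintro rfl; exact hz (zero_mem _)
    have h0 := sigmaExcept_ne_zero L (.inr hz)
    rw [dslope_of_ne _ hz0, slope_def_field, hA0, psi, sigma_eq L z]
    simp only [hA, sub_zero]
    field_simp
    ring

/-- `dpsi` is regular at `z = 0`. -/
lemma exists_dpsi_expansion (L : PeriodPair) {x : ℂ} (hx : x ∉ L.lattice) :
    ∃ C : ℂ → ℂ, AnalyticAt ℂ C 0 ∧ C 0 = -L.weierstrassP x ∧
      ∀ z ∉ L.lattice, dpsi L x z = C z := by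
  have hσx := sigma_ne_zero L hx
  have hσd := (differentiable_sigma L).deriv
  set B : ℂ → ℂ := fun z => deriv (sigma L) (z - x) + zeta L x * sigma L (z - x) with hB
  have h1 : HasDerivAt (fun z => sigma L (z - x)) (deriv (sigma L) (0 - x)) 0 :=
    HasDerivAt.comp_sub_const 0 x (differentiable_sigma L (0 - x)).hasDerivAt
  have h2 : HasDerivAt (fun z => deriv (sigma L) (z - x)) (deriv (deriv (sigma L)) (0 - x)) 0 :=
    HasDerivAt.comp_sub_const 0 x (hσd (0 - x)).hasDerivAt
  have h3 : HasDerivAt B _ 0 := h2.add (h1.const_mul (zeta L x))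
  have hx' : -x ∉ L.lattice := by rwa [neg_mem_lattice_iff]
  have h4 : deriv (deriv (sigma L)) (-x) = (L.weierstrassP x - zeta L x ^ 2) * sigma L x := by
    have h5 : deriv (sigma L) =ᶠ[𝓝 (-x)] fun z => zeta L z * sigma L z := by
      filter_upwards [(isOpen_compl_lattice L).mem_nhds hx'] with u hu using deriv_sigma L hu
    have h6 : HasDerivAt (fun z => zeta L z * sigma L z) _ (-x) :=
      (hasDerivAt_zeta L hx').mul (hasDerivAt_sigma L hx')
    rw [h5.deriv_eq, h6.deriv, L.weierstrassP_neg, zeta_neg, sigma_neg]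
    ring
  -- The numerator vanishes at `z = 0` because `σ'` is even, `σ` is odd and `σ' = ζ σ`; this removes
  -- the pole coming from `1/σ(z)`.
  have hB0 : B 0 = 0 := by
    simp only [hB, zero_sub, sigma_neg, deriv_sigma_neg, deriv_sigma L hx]
    ring
  have hBa : AnalyticAt ℂ B 0 := by
    have : Differentiable ℂ B := by
      have := differentiable_sigma L
      fun_prop
    exact this.analyticAt 0
  refine ⟨fun z => -dslope B 0 z / (sigmaExcept L z * sigma L x), ?_, ?_, fun z hz => ?_⟩
  · exact (analyticAt_dslope hBa).neg.div
      (((differentiable_sigmaExcept L).analyticAt 0).mul analyticAt_const) (by simpa using hσx)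
  · simp only [dslope_same]
    rw [h3.deriv, zero_sub, h4, deriv_sigma_neg, deriv_sigma L hx, sigmaExcept_zero]
    field_simp
    ring
  · have hz0 : z ≠ 0 := by rintro rfl; exact hz (zero_mem _)
    have h0 := sigmaExcept_ne_zero L (.inr hz)
    simp only [dslope_of_ne _ hz0, slope_def_field, hB0, dpsi, sigma_eq L z, sub_zero]
    simp only [hB]
    field_simp

/-! ### Product and addition formulas -/

/-- An elliptic function with at most a double pole at the lattice is determined by the leading
coefficient and a zero. -/
lemma eq_mul_weierstrassP_sub (L : PeriodPair) {f : ℂ → ℂ}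
    (hper : ∀ w ∈ L.lattice, ∀ z ∉ L.lattice, f (z + w) = f z)
    (han : ∀ z ∉ L.lattice, AnalyticAt ℂ f z) {g : ℂ → ℂ} (hg : AnalyticAt ℂ g 0)
    (hfg : ∀ᶠ z in 𝓝[≠] 0, z ^ 2 * f z = g z) {u : ℂ} (hu : u ∉ L.lattice) (hfu : f u = 0) :
    ∀ z ∉ L.lattice, f z = g 0 * (L.weierstrassP z - L.weierstrassP u) := by
  obtain ⟨c₀, c, hc⟩ := exists_eq_sum_iteratedDeriv_weierstrassP L 2 hper han ⟨g, hg, hfg⟩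
  simp only [Nat.reduceSub, Finset.sum_range_one, iteratedDeriv_zero] at hc
  have hc0 : c 0 = g 0 := by
    have h1 : Tendsto g (𝓝[≠] 0) (𝓝 (g 0)) :=
      hg.continuousAt.tendsto.mono_left nhdsWithin_le_nhds
    have hcont : ContinuousAt
        (fun z => z ^ 2 * c₀ + c 0 + c 0 * z ^ 2 * L.weierstrassPExcept 0 z) 0 := by
      have := (L.analyticAt_weierstrassPExcept 0).continuousAt
      fun_prop
    have h2 : Tendsto g (𝓝[≠] 0) (𝓝 (c 0)) := by
      have h3 : Tendsto (fun z => z ^ 2 * c₀ + c 0 + c 0 * z ^ 2 * L.weierstrassPExcept 0 z)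
          (𝓝[≠] 0) (𝓝 (c 0)) := by
        simpa using hcont.tendsto.mono_left (nhdsWithin_le_nhds (s := ({0} : Set ℂ)ᶜ))
      refine h3.congr' ?_
      filter_upwards [hfg, eventually_notMem_lattice L 0, self_mem_nhdsWithin] with z hz hzL hz0
      have hz0 : z ≠ 0 := hz0
      rw [← hz, hc z hzL, weierstrassP_eq_inv_sq_add]
      field_simp
      ring
    exact tendsto_nhds_unique h2 h1
  intro z hz
  have h1 := hc u hu
  rw [hfu] at h1
  rw [hc z hz, ← hc0]
  linear_combination -h1

/-- `ψ(x) ψ(-x) = ℘(z) - ℘(x)`. -/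
lemma psi_mul_psi_neg (L : PeriodPair) {x z : ℂ} (hx : x ∉ L.lattice) (hz : z ∉ L.lattice) :
    psi L x z * psi L (-x) z = L.weierstrassP z - L.weierstrassP x := by
  have hx' : -x ∉ L.lattice := by rwa [neg_mem_lattice_iff]
  obtain ⟨C, hC, -, hCz⟩ := exists_psi_expansion L hx
  obtain ⟨D, hD, -, hDz⟩ := exists_psi_expansion L hx'
  -- The multipliers `exp (∓η x)` cancel, the double pole has coefficient `(-1)(-1) = 1`, and `ψ(x)`
  -- vanishes at `z = x`.
  have := eq_mul_weierstrassP_sub L (f := fun z => psi L x z * psi L (-x) z)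
    (g := fun z => (-1 + z * C z) * (-1 + z * D z)) (u := x) (fun w hw z _ => by
      simp only [psi_add L hw, mul_neg, neg_neg]
      rw [mul_mul_mul_comm, ← Complex.exp_add, neg_add_cancel, Complex.exp_zero, one_mul])
    (fun z hz => (analyticAt_psi L hx hz).mul (analyticAt_psi L hx' hz)) (by fun_prop) (by
      filter_upwards [eventually_notMem_lattice L 0, self_mem_nhdsWithin] with z hzL hz0
      have hz0 : z ≠ 0 := hz0
      rw [hCz z hzL, hDz z hzL]
      field_simp) hx (by simp [psi, sigma_eq_zero L (zero_mem _)]) z hz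
  simpa using this

/-- The addition formula for `ψ`. -/
lemma psi_mul_dpsi_sub (L : PeriodPair) {x y z : ℂ} (hx : x ∉ L.lattice) (hy : y ∉ L.lattice)
    (hxy : x + y ∉ L.lattice) (hz : z ∉ L.lattice) :
    psi L x z * dpsi L y z - dpsi L x z * psi L y z =
      (L.weierstrassP x - L.weierstrassP y) * psi L (x + y) z := by
  have hxy' : -(x + y) ∉ L.lattice := by rwa [neg_mem_lattice_iff]
  obtain ⟨A, hA, -, hAz⟩ := exists_psi_expansion L hx
  obtain ⟨B, hB, -, hBz⟩ := exists_psi_expansion L hy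
  obtain ⟨C, hC, -, hCz⟩ := exists_psi_expansion L hxy'
  obtain ⟨A', hA', hA0, hAz'⟩ := exists_dpsi_expansion L hx
  obtain ⟨B', hB', hB0, hBz'⟩ := exists_dpsi_expansion L hy
  set f : ℂ → ℂ := fun z => psi L x z * dpsi L y z - dpsi L x z * psi L y z with hf
  have hfan : ∀ z ∉ L.lattice, AnalyticAt ℂ f z := fun z hz =>
    ((analyticAt_psi L hx hz).mul (analyticAt_dpsi L hy hz)).sub
      ((analyticAt_dpsi L hx hz).mul (analyticAt_psi L hy hz))
  -- `f` has the multipliers of `ψ(x + y)`, since the `quasiPeriod` terms of the two `dpsi` cancel.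
  -- Multiplying by `ψ(-(x + y))` gives an elliptic function with leading coefficient `B' 0 - A' 0 =
  -- ℘(x) - ℘(y)` and a zero at `z = -(x + y)`; the product formula identifies it.
  have key : ∀ z ∉ L.lattice, f z * psi L (-(x + y)) z =
      ((L.weierstrassP x - L.weierstrassP y) * psi L (x + y) z) * psi L (-(x + y)) z := by
    intro z hz
    have := eq_mul_weierstrassP_sub L (f := fun z => f z * psi L (-(x + y)) z)
      (g := fun z => ((-1 + z * A z) * B' z - A' z * (-1 + z * B z)) * (-1 + z * C z))
      (u := -(x + y)) (fun w hw z hz => by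
        simp only [hf, psi_add L hw, dpsi_add L hw hx hz, dpsi_add L hw hy hz]
        rw [mul_neg, neg_neg, mul_add (quasiPeriod L w), Complex.exp_add, Complex.exp_neg,
          Complex.exp_neg]
        have h1 := Complex.exp_ne_zero (quasiPeriod L w * x)
        have h2 := Complex.exp_ne_zero (quasiPeriod L w * y)
        field_simp
        ring)
      (fun z hz => (hfan z hz).mul (analyticAt_psi L hxy' hz)) (by fun_prop) (by
        filter_upwards [eventually_notMem_lattice L 0, self_mem_nhdsWithin] with z hzL hz0
        have hz0 : z ≠ 0 := hz0
        simp only [hf]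
        rw [hCz z hzL, hBz z hzL, hAz z hzL, hAz' z hzL, hBz' z hzL]
        field_simp) hxy' (by simp [psi, sigma_eq_zero L (zero_mem _)]) z hz
    simp only [zero_mul, add_zero, hA0, hB0] at this
    rw [this, mul_assoc _ (psi L (x + y) z), psi_mul_psi_neg L hxy hz, L.weierstrassP_neg]
    ring
  -- The factor `ψ(-(x + y))` may vanish at `z` itself, so it is cancelled at nearby points and the
  -- identity passes to the limit.
  have h1 := (hfan z hz).continuousAt.tendsto.mono_left (nhdsWithin_le_nhds (s := {z}ᶜ))
  have h2 := ((analyticAt_psi L hxy hz).continuousAt.tendsto.const_mul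
    (L.weierstrassP x - L.weierstrassP y)).mono_left (nhdsWithin_le_nhds (s := {z}ᶜ))
  refine tendsto_nhds_unique h1 (h2.congr' ?_)
  have h3 : ∀ᶠ u in 𝓝[≠] z, u + (x + y) ∉ L.lattice := by
    have := eventually_nhdsNE_add (w := -(x + y)) (eventually_notMem_lattice L (z + (x + y)))
    simpa only [add_neg_cancel_right, sub_neg_eq_add] using this
  filter_upwards [h3, eventually_notMem_lattice L z] with u hu huL
  refine (mul_right_cancel₀ ?_ (key u huL)).symm
  refine div_ne_zero ?_ (mul_ne_zero (sigma_ne_zero L huL) (sigma_ne_zero L hxy'))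
  rw [sub_neg_eq_add]
  exact sigma_ne_zero L hu

lemma Phi_mul_Phi_neg (L : PeriodPair) {x z : ℂ} (hx : x ∉ L.lattice) (hz : z ∉ L.lattice) :
    Phi L x z * Phi L (-x) z = L.weierstrassP z - L.weierstrassP x := by
  rw [← psi_mul_psi_neg L hx hz, Phi_eq, Phi_eq, mul_mul_mul_comm, ← Complex.exp_add, mul_neg,
    add_neg_cancel, Complex.exp_zero, mul_one]

lemma Phi_mul_dPhi_sub (L : PeriodPair) {x y z : ℂ} (hx : x ∉ L.lattice) (hy : y ∉ L.lattice)
    (hxy : x + y ∉ L.lattice) (hz : z ∉ L.lattice) :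
    Phi L x z * dPhi L y z - dPhi L x z * Phi L y z =
      (L.weierstrassP x - L.weierstrassP y) * Phi L (x + y) z := by
  rw [Phi_eq L (x + y), ← mul_assoc, ← psi_mul_dpsi_sub L hx hy hxy hz, Phi_eq, Phi_eq, dPhi, dPhi,
    mul_add (zeta L z), Complex.exp_add]
  ring

/-- The derivative in `x` of `Phi_mul_Phi_neg`; the term `℘(z)` drops out. -/
lemma dPhi_mul_Phi_neg_sub (L : PeriodPair) {x z : ℂ} (hx : x ∉ L.lattice) (hz : z ∉ L.lattice) :
    dPhi L x z * Phi L (-x) z - Phi L x z * dPhi L (-x) z = -deriv L.weierstrassP x := by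
  have hx' : -x ∉ L.lattice := by rwa [neg_mem_lattice_iff]
  have h1 : HasDerivAt (fun x => Phi L (-x) z) (-dPhi L (-x) z) x := by
    simpa using! (hasDerivAt_Phi L hx' hz).scomp x (hasDerivAt_neg x)
  have h2 := (hasDerivAt_Phi L hx hz).mul h1
  have h3 : HasDerivAt (fun x => L.weierstrassP z - L.weierstrassP x)
      (-deriv L.weierstrassP x) x :=
    (analyticAt_weierstrassP L hx).differentiableAt.hasDerivAt.const_sub _
  have h4 := h2.unique (h3.congr_of_eventuallyEq ?_)
  · rw [← h4]
    ring
  · filter_upwards [(isOpen_compl_lattice L).mem_nhds hx] with u hu using Phi_mul_Phi_neg L hu hz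

end SpinCM

namespace SpinCM

/-! ### The Lax equation -/

/-- Jacobi's formula. -/
lemma hasDerivAt_det {n : Type*} [Fintype n] [DecidableEq n] {A : ℝ → Matrix n n ℂ}
    {A' : Matrix n n ℂ} {t : ℝ} (h : ∀ i j, HasDerivAt (fun s => A s i j) (A' i j) t) :
    HasDerivAt (fun s => (A s).det) ((A t).adjugate * A').trace t := by
  have h1 : HasDerivAt (fun s => (A s).det) (∑ σ : Equiv.Perm n, (Equiv.Perm.sign σ : ℂ) *
      ∑ i, (∏ j ∈ Finset.univ.erase i, A t (σ j) j) * A' (σ i) i) t := by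
    simp only [Matrix.det_apply']
    refine HasDerivAt.fun_sum fun σ _ => HasDerivAt.const_mul _ ?_
    have := HasDerivAt.fun_finsetProd (u := Finset.univ) (f := fun i s => A s (σ i) i)
      (f' := fun i => A' (σ i) i) (x := t) fun i _ => h (σ i) i
    simpa only [smul_eq_mul] using this
  convert! h1 using 1
  have h2 : ∀ i, ((A t).adjugate * A') i i = ((A t).updateCol i (fun j => A' j i)).det := by
    intro i
    rw [← Matrix.cramer_apply, Matrix.cramer_eq_adjugate_mulVec]
    rfl
  simp only [Matrix.trace, Matrix.diag_apply, h2, Matrix.det_apply']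
  rw [Finset.sum_comm]
  refine Finset.sum_congr rfl fun σ _ => ?_
  rw [Finset.mul_sum]
  refine Finset.sum_congr rfl fun i _ => ?_
  rw [← Finset.prod_erase_mul _ _ (Finset.mem_univ i)]
  congr 2
  · refine Finset.prod_congr rfl fun j hj => ?_
    rw [Matrix.updateCol_ne (Finset.ne_of_mem_erase hj)]
  · simp

/-- By cyclicity of the trace and `A adj A = adj A A = det A`, both terms equal `det A` times the
trace of `M`. -/
lemma trace_adjugate_mul_commutator {n : Type*} [Fintype n] [DecidableEq n]
    (A M : Matrix n n ℂ) : (A.adjugate * (M * A - A * M)).trace = 0 := by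
  rw [mul_sub, Matrix.trace_sub, ← mul_assoc, ← mul_assoc, Matrix.trace_mul_comm (A.adjugate * M),
    ← mul_assoc, Matrix.mul_adjugate, Matrix.adjugate_mul, sub_self]

variable {N l : ℕ}

/-- The second matrix of the Lax pair. -/
noncomputable def laxM (L : PeriodPair) (q : Phase N l) (μ : Fin N → ℂ) (z : ℂ) :
    Matrix (Fin N) (Fin N) ℂ :=
  Matrix.of fun i j => if i = j then μ i else -(F q i j * dPhi L (pos q i - pos q j) z)

/-- The equation for `b i` contributes a term `k = j` with the factor `f_jj`, the one for `a j` a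
term `k = i` with the factor `f_ii`. They cancel because both factors equal `2`. -/
lemma hasDerivAt_F {L : PeriodPair} {T : Set ℝ} {lam : ℝ → Fin N → ℂ} {γ : ℝ → Phase N l}
    (h : IsTrajectory L T lam γ) {t : ℝ} (ht : t ∈ T) {i j : Fin N} (hij : i ≠ j) :
    HasDerivAt (fun s => F (γ s) i j)
      (∑ k ∈ (Finset.univ.erase i).erase j, F (γ t) i k * F (γ t) k j *
        (L.weierstrassP (pos (γ t) i - pos (γ t) k) - L.weierstrassP (pos (γ t) k - pos (γ t) j)) +
        (lam t i - lam t j) * F (γ t) i j) t := by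
  have h1 : HasDerivAt (fun s => F (γ s) i j) _ t := HasDerivAt.fun_sum (u := Finset.univ) fun α _ =>
    (h.deriv_covec t ht i α).mul (h.deriv_vec t ht j α)
  convert! h1 using 1
  set q := γ t with hq
  have hF : ∀ i j, F q i j = ∑ α, covec q i α * vec q j α := fun i j => rfl
  have h2 : ∑ α, ((∑ k ∈ Finset.univ.erase i, covec q k α * F q i k *
      L.weierstrassP (pos q i - pos q k)) + lam t i * covec q i α) * vec q j α =
      ∑ k ∈ Finset.univ.erase i, F q i k * F q k j * L.weierstrassP (pos q i - pos q k) +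
        lam t i * F q i j := by
    simp only [add_mul, Finset.sum_add_distrib, Finset.sum_mul]
    rw [Finset.sum_comm]
    congr 1
    · refine Finset.sum_congr rfl fun k _ => ?_
      rw [hF k j, Finset.mul_sum, Finset.sum_mul]
      exact Finset.sum_congr rfl fun α _ => by ring
    · rw [hF i j, Finset.mul_sum]
      exact Finset.sum_congr rfl fun α _ => by ring
  have h3 : ∑ α, covec q i α * (-(∑ k ∈ Finset.univ.erase j, vec q k α * F q k j *
      L.weierstrassP (pos q j - pos q k)) - lam t j * vec q j α) =
      -(∑ k ∈ Finset.univ.erase j, F q i k * F q k j * L.weierstrassP (pos q k - pos q j)) -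
        lam t j * F q i j := by
    simp only [mul_sub, mul_neg, Finset.sum_sub_distrib, Finset.sum_neg_distrib, Finset.mul_sum]
    rw [Finset.sum_comm]
    congr 2
    · refine Finset.sum_congr rfl fun k _ => ?_
      rw [hF i k, Finset.sum_mul, Finset.sum_mul, ← neg_sub (pos q k), L.weierstrassP_neg]
      exact Finset.sum_congr rfl fun α _ => by ring
    · rw [hF i j, Finset.mul_sum]
      exact Finset.sum_congr rfl fun α _ => by ring
  rw [Finset.sum_add_distrib, h2, h3]
  have hii := (h.mem_phaseSpace t ht).2
  rw [← Finset.add_sum_erase (Finset.univ.erase i) _ (Finset.mem_erase.mpr ⟨hij.symm, Finset.mem_univ j⟩),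
    ← Finset.add_sum_erase (Finset.univ.erase j) _ (Finset.mem_erase.mpr ⟨hij, Finset.mem_univ i⟩),
    Finset.erase_right_comm (a := j) (b := i), hii i, hii j]
  simp only [mul_sub, Finset.sum_sub_distrib]
  ring

/-- The equations of motion imply the Lax equation. -/
lemma hasDerivAt_lax {L : PeriodPair} {T : Set ℝ} {lam : ℝ → Fin N → ℂ} {γ : ℝ → Phase N l}
    (h : IsTrajectory L T lam γ) {t : ℝ} (ht : t ∈ T) {z : ℂ} (hz : z ∉ L.lattice) (i j : Fin N) :
    HasDerivAt (fun s => lax L (γ s) z i j) ((laxM L (γ t) (lam t) z * lax L (γ t) z -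
      lax L (γ t) z * laxM L (γ t) (lam t) z) i j) t := by
  have hx := (h.mem_phaseSpace t ht).1
  rw [Matrix.sub_apply, Matrix.mul_apply, Matrix.mul_apply, ← Finset.sum_sub_distrib,
    ← Finset.add_sum_erase _ _ (Finset.mem_univ i)]
  rcases eq_or_ne i j with rfl | hij
  -- On the diagonal the term `k = i` vanishes, and the other terms give the force by the
  -- differentiated product formula.
  · have h1 : (fun s => lax L (γ s) z i i) = fun s => mom (γ s) i := by ext; simp [lax]
    rw [h1]
    convert! h.deriv_mom t ht i using 1
    rw [mul_comm, sub_self, zero_add]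
    refine Finset.sum_congr rfl fun k hk => ?_
    have hki := Finset.ne_of_mem_erase hk
    simp only [lax, laxM, Matrix.of_apply, if_neg hki, if_neg hki.symm]
    rw [← neg_sub (pos (γ t) i) (pos (γ t) k)]
    linear_combination (-F (γ t) i k * F (γ t) k i) * dPhi_mul_Phi_neg_sub L (hx i k hki.symm) hz
  · rw [← Finset.add_sum_erase _ _ (Finset.mem_erase.mpr ⟨hij.symm, Finset.mem_univ j⟩)]
    have h1 : (fun s => lax L (γ s) z i j) =
        fun s => F (γ s) i j * Phi L (pos (γ s) i - pos (γ s) j) z := by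
      ext; simp [lax, hij]
    rw [h1]
    have h2 := HasDerivAt.comp (h₂ := fun x => Phi L x z) t (hasDerivAt_Phi L (hx i j hij) hz)
      ((h.deriv_pos t ht i).sub (h.deriv_pos t ht j))
    convert! (hasDerivAt_F h ht hij).mul h2 using 1
    simp only [Function.comp_apply, Pi.sub_apply]
    rw [add_mul, Finset.sum_mul]
    -- Here the addition formula applies with arguments `x_i - x_k` and `x_k - x_j`. The terms `k =
    -- i` and `k = j` supply the velocities times `dPhi` and the gauge term `λ_i - λ_j`, which is
    -- why `λ` is the diagonal of `laxM`.
    have h3 : ∑ k ∈ (Finset.univ.erase i).erase j,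
        (laxM L (γ t) (lam t) z i k * lax L (γ t) z k j -
          lax L (γ t) z i k * laxM L (γ t) (lam t) z k j) =
        ∑ k ∈ (Finset.univ.erase i).erase j, F (γ t) i k * F (γ t) k j *
        (L.weierstrassP (pos (γ t) i - pos (γ t) k) - L.weierstrassP (pos (γ t) k - pos (γ t) j)) *
          Phi L (pos (γ t) i - pos (γ t) j) z := by
      refine Finset.sum_congr rfl fun k hk => ?_
      have hkj := Finset.ne_of_mem_erase hk
      have hki := Finset.ne_of_mem_erase (Finset.mem_of_mem_erase hk)
      have h4 := Phi_mul_dPhi_sub L (hx i k hki.symm) (hx k j hkj)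
        (by rw [sub_add_sub_cancel]; exact hx i j hij) hz
      rw [sub_add_sub_cancel] at h4
      simp only [lax, laxM, Matrix.of_apply, if_neg hkj, if_neg hki.symm]
      linear_combination (F (γ t) i k * F (γ t) k j) * h4
    rw [h3]
    simp only [lax, laxM, Matrix.of_apply, if_neg hij, if_true]
    ring

/-- The spectral curve does not depend on the time. -/
theorem R_eq_of_isTrajectory {L : PeriodPair} {T : Set ℝ} {lam : ℝ → Fin N → ℂ}
    {γ : ℝ → Phase N l} (hT : IsOpen T) (hT' : IsPreconnected T) (h : IsTrajectory L T lam γ)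
    {s t : ℝ} (hs : s ∈ T) (ht : t ∈ T) (k : ℂ) {z : ℂ} (hz : z ∉ L.lattice) :
    R L (γ s) k z = R L (γ t) k z := by
  have hd : ∀ t ∈ T, HasDerivAt (fun s => R L (γ s) k z) 0 t := by
    intro t ht
    set c : Matrix (Fin N) (Fin N) ℂ := (2 * k) • 1 with hc
    set M := laxM L (γ t) (lam t) z
    have h1 := hasDerivAt_det (A := fun s => c + lax L (γ s) z) (t := t)
      (fun i j => by
        have := (hasDerivAt_lax h ht hz i j).const_add (c i j)
        exact this)
    have h2 : M * lax L (γ t) z - lax L (γ t) z * M =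
        M * (c + lax L (γ t) z) - (c + lax L (γ t) z) * M := by
      simp only [hc, mul_add, add_mul, Matrix.mul_smul, Matrix.smul_mul, Matrix.mul_one,
        Matrix.one_mul, add_sub_add_left_eq_sub]
    rw [h2, trace_adjugate_mul_commutator] at h1
    exact h1
  exact hT.is_const_of_deriv_eq_zero hT'
    (fun t ht => (hd t ht).differentiableAt.differentiableWithinAt) (fun t ht => (hd t ht).deriv)
    hs ht

end SpinCM

/-! ### Determinants over rings of functions -/

namespace SpinCM

open Polynomial in
/-- The families of polynomials whose coefficients belong to a given ring of functions. -/
def polySubring {ι B : Type*} [CommRing B] (S : Subring (ι → B)) : Subring (ι → B[X]) where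
  carrier := {p | ∀ n, (fun z => (p z).coeff n) ∈ S}
  mul_mem' := by
    intro p q hp hq n
    have : (fun z => ((p * q) z).coeff n) =
        ∑ x ∈ Finset.HasAntidiagonal.antidiagonal n, (fun z => (p z).coeff x.1) * fun z => (q z).coeff x.2 := by
      ext z
      simp [Polynomial.coeff_mul]
    rw [this]
    exact S.sum_mem fun x _ => S.mul_mem (hp _) (hq _)
  one_mem' := by
    intro n
    simp only [Pi.one_apply, Polynomial.coeff_one]
    split_ifs
    · exact S.one_mem
    · exact S.zero_mem
  add_mem' := by
    intro p q hp hq n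
    simpa using! S.add_mem (hp n) (hq n)
  zero_mem' := by
    intro n
    exact S.zero_mem
  neg_mem' := by
    intro p hp n
    have := S.neg_mem (hp n)
    simpa only [Pi.neg_apply, Polynomial.coeff_neg] using! this

lemma C_mem_polySubring {ι B : Type*} [CommRing B] {S : Subring (ι → B)} {f : ι → B} (hf : f ∈ S) :
    (fun z => Polynomial.C (f z)) ∈ polySubring S := by
  intro n
  simp only [Polynomial.coeff_C]
  split_ifs
  · exact hf
  · exact S.zero_mem

lemma X_mem_polySubring {ι B : Type*} [CommRing B] {S : Subring (ι → B)} :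
    (fun _ => Polynomial.X) ∈ polySubring S := by
  intro n
  simp only [Polynomial.coeff_X]
  split_ifs
  · exact S.one_mem
  · exact S.zero_mem

/-- The determinant is an integer polynomial in the entries. With `polySubring`, iterated for two
variables, analyticity passes from the entries of a matrix to the coefficients of its polynomial
determinants. -/
lemma det_mem {ι B n : Type*} [CommRing B] [Fintype n] [DecidableEq n] (S : Subring (ι → B))
    {A : ι → Matrix n n B} (h : ∀ i j, (fun z => A z i j) ∈ S) : (fun z => (A z).det) ∈ S := by
  have : (fun z => (A z).det) =
      ∑ σ : Equiv.Perm n, ((Equiv.Perm.sign σ : ℤ) : ι → B) * ∏ i, fun z => A z (σ i) i := by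
    ext z
    simp [Matrix.det_apply']
  rw [this]
  exact S.sum_mem fun σ _ => S.mul_mem (intCast_mem S _) (S.prod_mem fun i _ => h _ _)

lemma charpoly_mem {ι B n : Type*} [CommRing B] [Fintype n] [DecidableEq n] {S : Subring (ι → B)}
    {A : ι → Matrix n n B} (h : ∀ i j, (fun z => A z i j) ∈ S) :
    (fun z => (A z).charpoly) ∈ polySubring S := by
  refine det_mem _ fun i j => ?_
  rcases eq_or_ne i j with rfl | hij
  · simpa using! (polySubring S).sub_mem X_mem_polySubring (C_mem_polySubring (h i i))
  · simp only [Matrix.charmatrix_apply_ne _ _ _ hij]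
    exact (polySubring S).neg_mem (C_mem_polySubring (h i j))

/-- The functions that are analytic at a point. -/
def analyticSubring (z₀ : ℂ) : Subring (ℂ → ℂ) where
  carrier := {f | AnalyticAt ℂ f z₀}
  mul_mem' := AnalyticAt.mul
  one_mem' := analyticAt_const
  add_mem' := AnalyticAt.add
  zero_mem' := analyticAt_const
  neg_mem' := AnalyticAt.neg

lemma analyticAt_coeff_charpoly {n : Type*} [Fintype n] [DecidableEq n] {A : ℂ → Matrix n n ℂ}
    {z₀ : ℂ} (h : ∀ i j, AnalyticAt ℂ (fun z => A z i j) z₀) (k : ℕ) :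
    AnalyticAt ℂ (fun z => (A z).charpoly.coeff k) z₀ :=
  charpoly_mem (S := analyticSubring z₀) h k

lemma charpoly_smul {K n : Type*} [Field K] [Infinite K] [Fintype n] [DecidableEq n] {c : K}
    (hc : c ≠ 0) (A : Matrix n n K) : (c • A).charpoly =
      Polynomial.C (c ^ Fintype.card n) * A.charpoly.comp (Polynomial.C c⁻¹ * Polynomial.X) := by
  refine Polynomial.funext fun x => ?_
  simp only [Matrix.eval_charpoly, Polynomial.eval_mul, Polynomial.eval_C, Polynomial.eval_comp,
    Polynomial.eval_X, ← Matrix.det_smul, smul_sub]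
  congr 2
  ext i j
  rcases eq_or_ne i j with rfl | hij
  · simp [hc]
  · simp [hij]

/-- The coefficient of `X^i` is homogeneous in the matrix, of degree the dimension minus `i`. With
`c = 1/z` this bounds the pole orders of the `r_i`. -/
lemma coeff_charpoly_smul {K n : Type*} [Field K] [Infinite K] [Fintype n] [DecidableEq n] {c : K}
    (hc : c ≠ 0) (A : Matrix n n K) (i : ℕ) :
    c ^ i * (c • A).charpoly.coeff i = c ^ Fintype.card n * A.charpoly.coeff i := by
  rw [charpoly_smul hc, Polynomial.coeff_C_mul, Polynomial.comp_C_mul_X_coeff, inv_pow]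
  have := pow_ne_zero i hc
  field_simp

variable {N l : ℕ}

/-! ### The spectral polynomial -/

/-- The Lax matrix after conjugation by a diagonal matrix that removes the essential
singularity. -/
noncomputable def laxR (L : PeriodPair) (q : Phase N l) (z : ℂ) : Matrix (Fin N) (Fin N) ℂ :=
  Matrix.of fun i j => if i = j then mom q i else F q i j * psi L (pos q i - pos q j) z

/-- The factor `exp (ζ(z)(x_i - x_j))` is a quotient of a function of `i` by the same function of
`j`, so the essential singularity does not affect the determinant. -/
lemma lax_eq_conj (L : PeriodPair) (q : Phase N l) (z : ℂ) :
    lax L q z = Matrix.diagonal (fun i => Complex.exp (zeta L z * pos q i)) * laxR L q z *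
      Matrix.diagonal fun i => Complex.exp (-(zeta L z * pos q i)) := by
  ext i j
  rw [Matrix.mul_diagonal, Matrix.diagonal_mul]
  rcases eq_or_ne i j with rfl | hij
  · simp only [lax, laxR, Matrix.of_apply, if_true]
    rw [mul_right_comm, ← Complex.exp_add, add_neg_cancel, Complex.exp_zero, one_mul]
  · simp only [lax, laxR, Matrix.of_apply, if_neg hij, Phi_eq]
    rw [mul_sub, sub_eq_add_neg (zeta L z * pos q i), Complex.exp_add]
    ring

lemma R_eq_det (L : PeriodPair) (q : Phase N l) (k z : ℂ) :
    R L q k z = ((2 * k) • (1 : Matrix (Fin N) (Fin N) ℂ) + laxR L q z).det := by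
  set D := Matrix.diagonal fun i => Complex.exp (zeta L z * pos q i)
  set D' := Matrix.diagonal fun i => Complex.exp (-(zeta L z * pos q i))
  have hDD : D * D' = 1 := by
    rw [Matrix.diagonal_mul_diagonal]
    simp_rw [← Complex.exp_add, add_neg_cancel, Complex.exp_zero]
    exact Matrix.diagonal_one
  have h : (2 * k) • (1 : Matrix (Fin N) (Fin N) ℂ) + lax L q z =
      D * ((2 * k) • (1 : Matrix (Fin N) (Fin N) ℂ) + laxR L q z) * D' := by
    rw [mul_add, add_mul, ← lax_eq_conj, Matrix.mul_smul, Matrix.smul_mul, mul_one, hDD]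
  rw [R, h, Matrix.det_mul, Matrix.det_mul, mul_right_comm, ← Matrix.det_mul, hDD, Matrix.det_one,
    one_mul]

lemma R_eq_eval_charpoly (L : PeriodPair) (q : Phase N l) (k z : ℂ) :
    R L q k z = 2 ^ N * ((-(1 / 2 : ℂ)) • laxR L q z).charpoly.eval k := by
  rw [R_eq_det, Matrix.eval_charpoly]
  have h := Matrix.det_smul (Matrix.scalar (Fin N) k - (-(1 / 2 : ℂ)) • laxR L q z) 2
  rw [Fintype.card_fin] at h
  rw [← h]
  congr 1
  ext i j
  rcases eq_or_ne i j with rfl | hij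
  · simp; ring
  · simp [hij]

lemma lax_add (L : PeriodPair) (q : Phase N l) {w : ℂ} (hw : w ∈ L.lattice) {z : ℂ}
    (hz : z ∉ L.lattice) : lax L q (z + w) = lax L q z := by
  ext i j
  simp only [lax, Matrix.of_apply, Phi_eq, psi_add L hw, zeta_add L hw hz]
  split_ifs
  · rfl
  · rw [add_mul, Complex.exp_add, Complex.exp_neg]
    have := Complex.exp_ne_zero (quasiPeriod L w * (pos q i - pos q j))
    field_simp

lemma analyticAt_laxR (L : PeriodPair) {q : Phase N l} (hq : q ∈ phaseSpace L N l) {z : ℂ}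
    (hz : z ∉ L.lattice) (i j : Fin N) : AnalyticAt ℂ (fun z => laxR L q z i j) z := by
  simp only [laxR, Matrix.of_apply]
  split_ifs with h
  · exact analyticAt_const
  · exact analyticAt_const.mul (analyticAt_psi L (hq.1 i j h) hz)

/-- The expansion of the Lax matrix at `z = 0`. -/
lemma exists_laxR_expansion (L : PeriodPair) {q : Phase N l} (hq : q ∈ phaseSpace L N l) :
    ∃ C : ℂ → Matrix (Fin N) (Fin N) ℂ, (∀ i j, AnalyticAt ℂ (fun z => C z i j) 0) ∧
      C 0 = Q L q ∧ ∀ z ∉ L.lattice, laxR L q z = C z + z⁻¹ • ((2 : ℂ) • 1 - F q) := by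
  have h : ∀ i j, ∃ c : ℂ → ℂ, AnalyticAt ℂ c 0 ∧ c 0 = Q L q i j ∧
      ∀ z ∉ L.lattice, laxR L q z i j = c z + z⁻¹ * ((2 : ℂ) • 1 - F q) i j := by
    intro i j
    rcases eq_or_ne i j with rfl | hij
    -- The diagonal of `laxR` has no pole; this agrees with `2 - F` precisely because `f_ii = 2`.
    · refine ⟨fun _ => mom q i, analyticAt_const, by simp [Q], fun z _ => ?_⟩
      rw [Matrix.sub_apply, hq.2 i]
      simp [laxR]
    · obtain ⟨c, hc, hc0, hcz⟩ := exists_psi_expansion L (hq.1 i j hij)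
      refine ⟨fun z => F q i j * c z, analyticAt_const.mul hc, by simp [Q, hij, hc0], fun z hz => ?_⟩
      simp only [laxR, Matrix.of_apply, if_neg hij, hcz z hz, Matrix.sub_apply, Matrix.smul_apply,
        Matrix.one_apply_ne hij, smul_zero]
      ring
  choose c hc hc0 hcz using h
  refine ⟨fun z => Matrix.of fun i j => c i j z, fun i j => hc i j, ?_, fun z hz => ?_⟩
  · ext i j
    exact hc0 i j
  · ext i j
    exact hcz i j z hz

/-- After multiplication by `z` the spectral polynomial extends analytically to `z = 0`. -/
lemma exists_regularized_laxR (L : PeriodPair) {q : Phase N l} (hq : q ∈ phaseSpace L N l) :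
    ∃ B : ℂ → Matrix (Fin N) (Fin N) ℂ, (∀ i j, AnalyticAt ℂ (fun z => B z i j) 0) ∧
      B 0 = (1 / 2 : ℂ) • F q - 1 ∧
      ∀ z ∉ L.lattice, (-(1 / 2 : ℂ)) • laxR L q z = z⁻¹ • B z := by
  obtain ⟨C, hC, -, hCz⟩ := exists_laxR_expansion L hq
  refine ⟨fun z => (-(z / 2)) • C z + (1 / 2 : ℂ) • F q - 1, fun i j => ?_, by simp, fun z hz => ?_⟩
  · have := hC i j
    simp only [Matrix.sub_apply, Matrix.add_apply, Matrix.smul_apply, smul_eq_mul]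
    fun_prop
  · have hz0 : z ≠ 0 := by rintro rfl; exact hz (zero_mem _)
    rw [hCz z hz]
    ext i j
    rcases eq_or_ne i j with rfl | hij
    · simp
      field_simp
      ring
    · simp [hij]
      field_simp
      ring

/-- The coefficients of the spectral polynomial are combinations of derivatives of `℘`. -/
theorem exists_R_eq_sum (L : PeriodPair) {q : Phase N l} (hq : q ∈ phaseSpace L N l) :
    ∃ (I₀ : Fin (N + 1) → ℂ) (I : Fin (N + 1) → ℕ → ℂ), ∀ z ∉ L.lattice, ∀ k,
      R L q k z = ∑ i : Fin (N + 1), (I₀ i + ∑ s ∈ Finset.range (N - 1 - i),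
        I i s * iteratedDeriv s L.weierstrassP z) * k ^ (i : ℕ) := by
  set P : ℂ → Polynomial ℂ := fun z => ((-(1 / 2 : ℂ)) • laxR L q z).charpoly with hP
  have hPan : ∀ z ∉ L.lattice, ∀ i, AnalyticAt ℂ (fun z => (P z).coeff i) z := fun z hz i =>
    analyticAt_coeff_charpoly (fun i j => analyticAt_const.mul (analyticAt_laxR L hq hz i j)) i
  have hper : ∀ w ∈ L.lattice, ∀ z ∉ L.lattice, P (z + w) = P z := by
    intro w hw z hz
    refine Polynomial.funext fun k => ?_
    have h1 := R_eq_eval_charpoly L q k (z + w)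
    have h2 := R_eq_eval_charpoly L q k z
    rw [R, lax_add L q hw hz, ← R, h2] at h1
    exact (mul_left_cancel₀ (pow_ne_zero _ two_ne_zero) h1).symm
  obtain ⟨B, hB, -, hBz⟩ := exists_regularized_laxR L hq
  have key : ∀ i : Fin (N + 1), ∃ (c₀ : ℂ) (c : ℕ → ℂ), ∀ z ∉ L.lattice,
      2 ^ N * (P z).coeff i =
        c₀ + ∑ s ∈ Finset.range (N - i - 1), c s * iteratedDeriv s L.weierstrassP z := by
    intro i
    -- Up to a constant, the `i`-th coefficient is homogeneous of degree `N - i` in `z⁻¹ B(z)`, so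
    -- its pole has order at most `N - i`. For `i = N` the truncated range is empty and the
    -- coefficient is constant.
    refine exists_eq_sum_iteratedDeriv_weierstrassP L (N - i)
      (f := fun z => 2 ^ N * (P z).coeff i) (fun w hw z hz => by rw [hper w hw z hz])
      (fun z hz => analyticAt_const.mul (hPan z hz i))
      ⟨fun z => 2 ^ N * (B z).charpoly.coeff i,
        analyticAt_const.mul (analyticAt_coeff_charpoly hB i), ?_⟩
    filter_upwards [eventually_notMem_lattice L 0, self_mem_nhdsWithin] with z hzL hz0
    have hz0 : z ≠ 0 := hz0
    have h1 := coeff_charpoly_smul (inv_ne_zero hz0) (B z) i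
    rw [← hBz z hzL, Fintype.card_fin] at h1
    have h2 : z ^ N = z ^ (N - (i : ℕ)) * z ^ (i : ℕ) := by
      rw [← pow_add, Nat.sub_add_cancel (Nat.lt_succ_iff.mp i.2)]
    have h3 := pow_ne_zero i hz0
    have h4 := pow_ne_zero N hz0
    rw [inv_pow, inv_pow] at h1
    field_simp at h1
    rw [h2] at h1
    have h5 : z ^ (N - (i : ℕ)) * (P z).coeff i = (B z).charpoly.coeff i :=
      mul_left_cancel₀ h3 (by linear_combination h1)
    rw [← h5]
    ring
  choose I₀ I hI using key
  refine ⟨I₀, I, fun z hz k => ?_⟩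
  rw [R_eq_eval_charpoly, Polynomial.eval_eq_sum_range, Matrix.charpoly_natDegree_eq_dim,
    Fintype.card_fin, Finset.sum_range, Finset.mul_sum]
  refine Finset.sum_congr rfl fun i _ => ?_
  rw [← mul_assoc, hI i z hz, Nat.sub_right_comm]

end SpinCM

namespace SpinCM

open Polynomial

/-! ### Roots of families of polynomials -/

lemma exists_eq_prod_X_sub_C (n : ℕ) : ∀ {p : ℂ[X]}, p.Monic → p.natDegree = n →
    ∃ μ : Fin n → ℂ, p = ∏ j, (X - C (μ j)) := by
  induction n with
  | zero =>
    intro p hp hn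
    exact ⟨Fin.elim0, by simpa using hp.natDegree_eq_zero.mp hn⟩
  | succ n ih =>
    intro p hp hn
    obtain ⟨r, hr⟩ := IsAlgClosed.exists_root p (by
      rw [Polynomial.degree_eq_natDegree hp.ne_zero, hn]
      exact_mod_cast n.succ_ne_zero)
    obtain ⟨q, hq⟩ := Polynomial.dvd_iff_isRoot.mpr hr
    have hqm : q.Monic := Polynomial.Monic.of_mul_monic_left (Polynomial.monic_X_sub_C r) (hq ▸ hp)
    have hqn : q.natDegree = n := by
      rw [hq, (Polynomial.monic_X_sub_C r).natDegree_mul hqm, Polynomial.natDegree_X_sub_C] at hn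
      omega
    obtain ⟨μ, hμ⟩ := ih hqm hqn
    refine ⟨Fin.cons r μ, ?_⟩
    rw [Fin.prod_univ_succ, hq, hμ]
    simp

/-- Take the root nearest to `x`: the value at `x` is the product of the distances from `x` to all
roots. -/
lemma exists_root_norm_pow_le {n : ℕ} {p : ℂ[X]} (hp : p.Monic) (hn : p.natDegree = n + 1) (x : ℂ) :
    ∃ r, p.IsRoot r ∧ ‖x - r‖ ^ (n + 1) ≤ ‖p.eval x‖ := by
  obtain ⟨μ, hμ⟩ := exists_eq_prod_X_sub_C (n + 1) hp hn
  obtain ⟨j, -, hj⟩ := Finset.exists_min_image Finset.univ (fun j => ‖x - μ j‖) ⟨0, Finset.mem_univ _⟩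
  refine ⟨μ j, ?_, ?_⟩
  · rw [hμ, Polynomial.IsRoot, Polynomial.eval_prod]
    exact Finset.prod_eq_zero (Finset.mem_univ j) (by simp)
  · rw [hμ, Polynomial.eval_prod, norm_prod]
    have h1 : ‖x - μ j‖ ^ (n + 1) = ∏ _i : Fin (n + 1), ‖x - μ j‖ := by simp
    rw [h1]
    refine Finset.prod_le_prod (fun _ _ => norm_nonneg _) fun i hi => ?_
    simpa using hj i hi

/-- **Continuity of roots**: if the coefficients of a family of monic polynomials converge, then
the roots can be numbered so that they converge. -/
theorem exists_roots_tendsto {α : Type*} {f : Filter α} (n : ℕ) : ∀ {p : α → ℂ[X]},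
    (∀ a, (p a).Monic) → (∀ a, (p a).natDegree = n) → ∀ {ν : Fin n → ℂ},
    (∀ i, Tendsto (fun a => (p a).coeff i) f (𝓝 ((∏ j, (X - C (ν j))).coeff i))) →
    ∃ μ : Fin n → α → ℂ, (∀ a, p a = ∏ j, (X - C (μ j a))) ∧ ∀ j, Tendsto (μ j) f (𝓝 (ν j)) := by
  induction n with
  | zero =>
    intro p hp hn ν _
    exact ⟨Fin.elim0, fun a => by simpa using (hp a).natDegree_eq_zero.mp (hn a), fun j => j.elim0⟩
  | succ n ih =>
    intro p hp hn ν hlim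
    set p₀ : ℂ[X] := ∏ j, (X - C (ν j)) with hp₀
    set r₀ : ℂ[X] := ∏ j : Fin n, (X - C (ν j.succ)) with hr₀
    have hpr₀ : p₀ = (X - C (ν 0)) * r₀ := Fin.prod_univ_succ _
    have hr₀n : r₀.natDegree = n := by
      rw [hr₀, Polynomial.natDegree_prod_of_monic _ _ fun j _ => Polynomial.monic_X_sub_C _]
      simp
    have hp₀n : p₀.natDegree = n + 1 := by
      rw [hp₀, Polynomial.natDegree_prod_of_monic _ _ fun j _ => Polynomial.monic_X_sub_C _]
      simp
    -- Peel off the root nearest to `ν 0`. It tends to `ν 0` because the value of `p a` there tends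
    -- to `0`.
    choose b hb hbn using fun a => exists_root_norm_pow_le (hp a) (hn a) (ν 0)
    have heval : Tendsto (fun a => (p a).eval (ν 0)) f (𝓝 0) := by
      have h0 : p₀.eval (ν 0) = 0 := by rw [hpr₀]; simp
      rw [← h0, Polynomial.eval_eq_sum_range, hp₀n]
      simp only [Polynomial.eval_eq_sum_range, hn]
      exact tendsto_finsetSum _ fun i _ => (hlim i).mul_const _
    have hb0 : Tendsto b f (𝓝 (ν 0)) := by
      have h1 : Tendsto (fun a => ‖ν 0 - b a‖ ^ (n + 1)) f (𝓝 0) :=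
        squeeze_zero (fun a => by positivity) hbn (by simpa using heval.norm)
      rw [tendsto_iff_norm_sub_tendsto_zero]
      have h2 := h1.rpow_const (p := ((n + 1 : ℕ) : ℝ)⁻¹) (.inr (by positivity))
      rw [Real.zero_rpow (by positivity)] at h2
      refine h2.congr fun a => ?_
      rw [Real.pow_rpow_inv_natCast (norm_nonneg _) n.succ_ne_zero, norm_sub_rev]
    choose r hr using fun a => Polynomial.dvd_iff_isRoot.mpr (hb a)
    have hrm : ∀ a, (r a).Monic := fun a =>
      Polynomial.Monic.of_mul_monic_left (Polynomial.monic_X_sub_C (b a)) (hr a ▸ hp a)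
    have hrn : ∀ a, (r a).natDegree = n := fun a => by
      have h := hn a
      rw [hr a, (Polynomial.monic_X_sub_C (b a)).natDegree_mul (hrm a),
        Polynomial.natDegree_X_sub_C] at h
      omega
    have hrec : ∀ (c : ℂ) (s : ℂ[X]) (i : ℕ),
        s.coeff i = ((X - C c) * s).coeff (i + 1) + c * s.coeff (i + 1) := by
      intro c s i
      rw [sub_mul, Polynomial.coeff_sub, Polynomial.coeff_X_mul, Polynomial.coeff_C_mul]
      ring
    -- Synthetic division: `hrec` recovers the coefficients of the quotient from the top down, so
    -- they converge by induction on the distance `d` from degree `n + 1`, where they are all `0`.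
    have hrlim : ∀ d i, n + 1 ≤ i + d → Tendsto (fun a => (r a).coeff i) f (𝓝 (r₀.coeff i)) := by
      intro d
      induction d with
      | zero =>
        intro i hi
        have h1 : ∀ a, (r a).coeff i = r₀.coeff i := fun a => by
          rw [Polynomial.coeff_eq_zero_of_natDegree_lt (by rw [hrn a]; omega),
            Polynomial.coeff_eq_zero_of_natDegree_lt (by rw [hr₀n]; omega)]
        simp only [h1]
        exact tendsto_const_nhds
      | succ d ihd =>
        intro i hi
        have h1 := (hlim (i + 1)).add (hb0.mul (ihd (i + 1) (by omega)))
        rw [hpr₀, ← hrec] at h1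
        refine h1.congr fun a => ?_
        rw [hrec (b a) (r a) i, ← hr a]
    obtain ⟨μ, hμ, hμlim⟩ := ih hrm hrn (ν := fun j => ν j.succ) fun i =>
      hrlim (n + 1) i (by omega)
    refine ⟨Fin.cons b μ, fun a => ?_, fun j => ?_⟩
    · rw [Fin.prod_univ_succ, hr a, hμ a]
      simp
    · refine Fin.cases ?_ (fun j => ?_) j
      · simpa using hb0
      · simpa using hμlim j

/-- A simple root of a polynomial extends to an analytic root of an analytic family. -/
theorem exists_analyticAt_root {P : ℂ → ℂ[X]} {n : ℕ} (hn : ∀ z, (P z).natDegree ≤ n)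
    (hP : ∀ i, AnalyticAt ℂ (fun z => (P z).coeff i) 0) {r : ℂ} (hr : (P 0).eval r = 0)
    (hr' : (P 0).derivative.eval r ≠ 0) :
    ∃ ρ : ℂ → ℂ, AnalyticAt ℂ ρ 0 ∧ ρ 0 = r ∧ ∀ᶠ z in 𝓝 0, (P z).eval (ρ z) = 0 := by
  set f : ℂ × ℂ → ℂ := fun u => (P u.1).eval u.2 with hf
  have hfs : f = fun u => ∑ i ∈ Finset.range (n + 1), (P u.1).coeff i * u.2 ^ i :=
    funext fun u => Polynomial.eval_eq_sum_range' (Nat.lt_succ_of_le (hn u.1)) u.2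
  have hfa : AnalyticAt ℂ f (0, r) := by
    rw [hfs]
    refine Finset.analyticAt_fun_sum _ fun i _ => ?_
    have h1 : AnalyticAt ℂ (fun u : ℂ × ℂ => (P u.1).coeff i) (0, r) :=
      AnalyticAt.fun_comp (g := fun z => (P z).coeff i) (hP i) analyticAt_fst
    exact h1.mul (analyticAt_snd.pow i)
  have hcd : ContDiffAt ℂ ⊤ f (0, r) := hfa.contDiffAt
  -- The partial derivative in the second variable is multiplication by `(P 0)' r ≠ 0`, as the
  -- implicit function theorem requires.
  have hinv : (fderiv ℂ f (0, r) ∘L .inr ℂ ℂ ℂ).IsInvertible := by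
    have h1 : HasFDerivAt (fun w : ℂ => f (0, w)) (fderiv ℂ f (0, r) ∘L .inr ℂ ℂ ℂ) r :=
      hfa.differentiableAt.hasFDerivAt.comp r (hasFDerivAt_prodMk_right 0 r)
    have h2 : HasDerivAt (fun w : ℂ => f (0, w)) ((P 0).derivative.eval r) r :=
      (P 0).hasDerivAt r
    rw [h1.unique h2.hasFDerivAt]
    exact ⟨ContinuousLinearEquiv.smulLeft (Units.mk0 _ hr'), by ext; simp [Units.smul_def]⟩
  refine ⟨hcd.implicitFunction (by simp) hinv, ?_, hcd.implicitFunction_apply_self (by simp) hinv, ?_⟩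
  · exact (hcd.contDiffAt_implicitFunction (by simp) hinv).analyticAt
  · have := hcd.eventually_apply_implicitFunction (by simp) hinv
    filter_upwards [this] with z hz
    simpa [hf, hr] using hz

lemma eq_prod_X_sub_C_of_injective {n : ℕ} {p : ℂ[X]} (hp : p.Monic) (hn : p.natDegree = n)
    {μ : Fin n → ℂ} (hμ : Function.Injective μ) (hr : ∀ i, p.eval (μ i) = 0) :
    p = ∏ i, (X - C (μ i)) := by
  have hm : (∏ i, (X - C (μ i))).Monic :=
    Polynomial.monic_prod_of_monic _ _ fun i _ => Polynomial.monic_X_sub_C _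
  refine Polynomial.eq_of_monic_of_dvd_of_natDegree_le hm hp ?_ ?_
  · refine Finset.prod_dvd_of_coprime (fun i _ j _ hij => ?_) fun i _ => ?_
    · exact Polynomial.pairwise_coprime_X_sub_C hμ hij
    · exact Polynomial.dvd_iff_isRoot.mpr (hr i)
  · rw [hn, Polynomial.natDegree_prod_of_monic _ _ fun j _ => Polynomial.monic_X_sub_C _]
    simp

end SpinCM

namespace SpinCM

open Polynomial

/-! ### The pencil `2κ + A + sF` -/

variable {N l : ℕ}

/-- `det (2κ + A + sF)` as a polynomial in `κ` (inner variable) and `s` (outer variable). -/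
noncomputable def pencil (A B : Matrix (Fin N) (Fin N) ℂ) : ℂ[X][X] :=
  Matrix.det (Matrix.of fun i j : Fin N =>
    C (C (A i j) + if i = j then 2 * X else 0) + X * C (C (B i j)))

lemma kernelPoly_eq (L : PeriodPair) (q : Phase N l) :
    kernelPoly L q = (pencil (Q L q) (F q)).coeff (min l N) := rfl

lemma eval_eval_pencil (A B : Matrix (Fin N) (Fin N) ℂ) (s κ : ℂ) :
    ((pencil A B).eval (C s)).eval κ = ((2 * κ) • (1 : Matrix (Fin N) (Fin N) ℂ) + A + s • B).det := by
  rw [pencil, ← coe_evalRingHom, ← coe_evalRingHom, RingHom.map_det, RingHom.map_det]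
  congr 1
  ext i j
  rcases eq_or_ne i j with rfl | hij
  · simp; ring
  · simp only [coe_evalRingHom, RingHom.mapMatrix_apply, Matrix.map_apply, Matrix.of_apply, if_neg hij,
      eval_add, eval_mul, eval_C, eval_X, Matrix.add_apply, Matrix.smul_apply, Matrix.one_apply_ne hij,
      smul_eq_mul, mul_zero, zero_add, add_zero]

lemma natDegree_det_le {n R : Type*} [Fintype n] [DecidableEq n] [CommRing R]
    (M : Matrix n n R[X]) (d : n → ℕ) (h : ∀ i j, (M i j).natDegree ≤ d j) :
    M.det.natDegree ≤ ∑ j, d j := by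
  rw [Matrix.det_apply]
  refine natDegree_sum_le_of_forall_le _ _ fun σ _ => ?_
  refine (natDegree_smul_le _ _).trans ((natDegree_prod_le _ _).trans ?_)
  exact Finset.sum_le_sum fun j _ => h _ _

/-- `F` factors through dimension `l`. By the Schur complement the pencil is a determinant of size
`N + l` in which `s` occurs only in the last `l` columns. -/
lemma natDegree_pencil_le (A : Matrix (Fin N) (Fin N) ℂ) (q : Phase N l) :
    (pencil A (F q)).natDegree ≤ min l N := by
  refine le_min ?_ ?_
  · set M : Matrix (Fin N) (Fin N) ℂ[X][X] := Matrix.of fun i j : Fin N =>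
      C (C (A i j) + if i = j then 2 * X else 0)
    set V : Matrix (Fin N) (Fin l) ℂ[X][X] := Matrix.of fun i α => -(X * C (C (covec q i α)))
    set W : Matrix (Fin l) (Fin N) ℂ[X][X] := Matrix.of fun α j => C (C (vec q j α))
    have h1 : pencil A (F q) = (Matrix.fromBlocks M V W 1).det := by
      rw [Matrix.det_fromBlocks_one₂₂, pencil]
      congr 1
      ext1 i j
      simp only [M, V, W, Matrix.sub_apply, Matrix.mul_apply, Matrix.of_apply, F, map_sum,
        Finset.mul_sum, map_mul]
      rw [sub_eq_add_neg, ← Finset.sum_neg_distrib]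
      congr 1
      exact Finset.sum_congr rfl fun α _ => by ring
    rw [h1]
    refine (natDegree_det_le _ (Sum.elim (fun _ => 0) fun _ => 1) ?_).trans (by simp)
    rintro (i | i) (j | j)
    · simp [M]
    · simp only [Matrix.fromBlocks_apply₁₂, V, Matrix.of_apply, natDegree_neg, Sum.elim_inr]
      exact natDegree_mul_le.trans (by simp)
    · simp [W]
    · simp only [Matrix.fromBlocks_apply₂₂, Sum.elim_inr]
      rcases eq_or_ne i j with rfl | hij
      · simp
      · simp [hij]
  · refine (natDegree_det_le _ (fun _ => 1) fun i j => ?_).trans (by simp)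
    rw [Matrix.of_apply]
    refine (natDegree_add_le _ _).trans (max_le (by simp) (natDegree_mul_le.trans (by simp)))

lemma analyticAt_coeff_pencil {A B : ℂ → Matrix (Fin N) (Fin N) ℂ} {z₀ : ℂ}
    (hA : ∀ i j, AnalyticAt ℂ (fun z => A z i j) z₀)
    (hB : ∀ i j, AnalyticAt ℂ (fun z => B z i j) z₀) (j i : ℕ) :
    AnalyticAt ℂ (fun z => ((pencil (A z) (B z)).coeff j).coeff i) z₀ := by
  set S := analyticSubring z₀
  have h2 : ∀ a b : Fin N,
      (fun _ => if a = b then 2 * X else 0 : ℂ → ℂ[X]) ∈ polySubring S := fun a b => by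
    split_ifs
    · exact Subring.mul_mem _ (ofNat_mem _ 2) X_mem_polySubring
    · exact Subring.zero_mem _
  refine det_mem (polySubring (polySubring S)) (fun a b => ?_) j i
  exact Subring.add_mem _ (C_mem_polySubring (Subring.add_mem _ (C_mem_polySubring (hA a b)) (h2 a b)))
    (Subring.mul_mem _ X_mem_polySubring (C_mem_polySubring (C_mem_polySubring (hB a b))))

/-- The substitution `κ ↦ ε κ`, `s ↦ ε s`. -/
noncomputable def scaleHom (ε : ℂ) : ℂ[X][X] →+* ℂ[X][X] :=
  (compRingHom (C (C ε) * X)).comp (mapRingHom (compRingHom (C ε * X)))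

lemma coeff_coeff_scaleHom (ε : ℂ) (p : ℂ[X][X]) (j i : ℕ) :
    ((scaleHom ε p).coeff j).coeff i = ε ^ (i + j) * (p.coeff j).coeff i := by
  have h1 : scaleHom ε p = (p.map (compRingHom (C ε * X))).comp (C (C ε) * X) := rfl
  rw [h1, comp_C_mul_X_coeff, coeff_map, coe_compRingHom_apply, ← C_pow, coeff_mul_C,
    comp_C_mul_X_coeff, pow_add]
  ring

/-- The determinant is homogeneous of degree `N` in `(A, κ, s)` jointly. Letting `ε → 0` isolates
the part that is free of `A`. -/
lemma coeff_pencil_smul (ε : ℂ) (A B : Matrix (Fin N) (Fin N) ℂ) (j i : ℕ) :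
    ε ^ (i + j) * ((pencil (ε • A) B).coeff j).coeff i =
      ε ^ N * ((pencil A B).coeff j).coeff i := by
  have h : scaleHom ε (pencil (ε • A) B) = (C (C ε)) ^ N * pencil A B := by
    rw [pencil, pencil, RingHom.map_det]
    have h1 := Matrix.det_smul (Matrix.of fun i j : Fin N =>
      C (C (A i j) + if i = j then 2 * X else 0) + X * C (C (B i j))) (C (C ε))
    rw [Fintype.card_fin] at h1
    rw [← h1]
    congr 1
    ext1 i j
    rcases eq_or_ne i j with rfl | hij
    · simp [scaleHom]
      ring
    · simp [scaleHom, hij]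
      ring
  rw [← coeff_coeff_scaleHom, h, ← C_pow, ← C_pow, coeff_C_mul, coeff_C_mul]

lemma tendsto_coeff_pencil_smul (A B : Matrix (Fin N) (Fin N) ℂ) (j i : ℕ) :
    Tendsto (fun ε : ℂ => ((pencil (ε • A) B).coeff j).coeff i) (𝓝[≠] 0)
      (𝓝 (((pencil 0 B).coeff j).coeff i)) := by
  have h := analyticAt_coeff_pencil (A := fun ε => ε • A) (B := fun _ => B) (z₀ := 0)
    (fun a b => by
      simp only [Matrix.smul_apply, smul_eq_mul]
      fun_prop) (fun a b => analyticAt_const) j i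
  have h2 := h.continuousAt.tendsto.mono_left (nhdsWithin_le_nhds (s := ({0} : Set ℂ)ᶜ))
  simpa only [zero_smul] using h2

/-- The pencil has total degree at most `N`. -/
lemma coeff_pencil_eq_zero (A B : Matrix (Fin N) (Fin N) ℂ) {j i : ℕ} (h : N < i + j) :
    ((pencil A B).coeff j).coeff i = 0 := by
  obtain ⟨d, hd⟩ := Nat.exists_eq_add_of_lt h
  -- By homogeneity the coefficient equals this expression for every `ε ≠ 0`, since `i + j = N + d +
  -- 1`.
  have h1 : Tendsto (fun ε : ℂ => ε ^ (d + 1) * ((pencil (ε • A) B).coeff j).coeff i) (𝓝[≠] 0)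
      (𝓝 0) := by
    have h2 : Tendsto (fun ε : ℂ => ε ^ (d + 1)) (𝓝[≠] 0) (𝓝 0) := by
      have : Continuous fun ε : ℂ => ε ^ (d + 1) := by fun_prop
      simpa using (this.tendsto 0).mono_left (nhdsWithin_le_nhds (s := ({0} : Set ℂ)ᶜ))
    simpa using h2.mul (tendsto_coeff_pencil_smul A B j i)
  refine tendsto_nhds_unique (tendsto_const_nhds.congr' ?_) h1
  filter_upwards [self_mem_nhdsWithin] with ε hε
  have hε : ε ≠ 0 := hε
  have h3 := coeff_pencil_smul ε A B j i
  rw [hd, add_assoc, pow_add, mul_assoc] at h3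
  exact (mul_left_cancel₀ (pow_ne_zero N hε) h3).symm

lemma natDegree_coeff_pencil_le (A B : Matrix (Fin N) (Fin N) ℂ) (j : ℕ) :
    ((pencil A B).coeff j).natDegree ≤ N - j :=
  natDegree_le_iff_coeff_eq_zero.mpr fun i hi => coeff_pencil_eq_zero A B (by omega)

/-- The part of top degree of the pencil does not depend on `A`. -/
lemma coeff_pencil_eq_of_add_eq (A B : Matrix (Fin N) (Fin N) ℂ) {j i : ℕ} (h : i + j = N) :
    ((pencil A B).coeff j).coeff i = ((pencil 0 B).coeff j).coeff i := by
  refine tendsto_nhds_unique (tendsto_const_nhds.congr' ?_) (tendsto_coeff_pencil_smul A B j i)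
  filter_upwards [self_mem_nhdsWithin] with ε hε
  have hε : ε ≠ 0 := hε
  have h3 := coeff_pencil_smul ε A B j i
  rw [h] at h3
  exact (mul_left_cancel₀ (pow_ne_zero N hε) h3).symm

lemma eq_of_eval_eval_C {p q : ℂ[X][X]}
    (h : ∀ s κ, (p.eval (C s)).eval κ = (q.eval (C s)).eval κ) : p = q := by
  refine eq_of_infinite_eval_eq p q ((Set.infinite_range_of_injective (C_injective (R := ℂ))).mono ?_)
  rintro _ ⟨s, rfl⟩
  exact Polynomial.funext (h s)

lemma pencil_zero_eq_prod {B : Matrix (Fin N) (Fin N) ℂ} {e : Fin N → ℂ}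
    (he : B.charpoly = ∏ i, (X - C (e i))) :
    pencil 0 B = ∏ i, (X * C (C (e i)) + C (2 * X)) := by
  refine eq_of_eval_eval_C fun s κ => ?_
  rw [eval_eval_pencil, add_zero, eval_prod, eval_prod]
  simp only [eval_add, eval_mul, eval_C, eval_X, eval_ofNat]
  rcases eq_or_ne s 0 with rfl | hs
  · simp
  · have h1 := congrArg (eval (-(2 * κ) / s)) he
    rw [Matrix.eval_charpoly, eval_prod] at h1
    have h2 := Matrix.det_smul (Matrix.scalar (Fin N) (-(2 * κ) / s) - B) (-s)
    rw [h1, ← Finset.card_univ, ← Finset.prod_const, ← Finset.prod_mul_distrib] at h2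
    have h3 : (2 * κ) • (1 : Matrix (Fin N) (Fin N) ℂ) + s • B =
        -s • (Matrix.scalar (Fin N) (-(2 * κ) / s) - B) := by
      ext i j
      rcases eq_or_ne i j with rfl | hij
      · simp
        field_simp
        ring
      · simp [hij]
    rw [h3, h2]
    refine Finset.prod_congr rfl fun i _ => ?_
    simp
    field_simp
    ring

/-- The leading coefficient of the coefficient of `s ^ m` in the pencil. -/
lemma coeff_pencil_top {m : ℕ} (hm : m ≤ N) (A : Matrix (Fin N) (Fin N) ℂ)
    {B : Matrix (Fin N) (Fin N) ℂ} {e : Fin N → ℂ} (he : B.charpoly = ∏ i, (X - C (e i)))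
    (he0 : ∀ i : Fin N, m ≤ i → e i = 0) :
    ((pencil A B).coeff m).coeff (N - m) = 2 ^ (N - m) * ∏ i : Fin m, e (Fin.castLE hm i) := by
  obtain ⟨k, rfl⟩ := Nat.exists_eq_add_of_le hm
  rw [coeff_pencil_eq_of_add_eq A B (by omega), pencil_zero_eq_prod he, Fin.prod_univ_add]
  have h1 : ∀ i : Fin k, e (Fin.natAdd m i) = 0 := fun i => he0 _ (by simp)
  simp only [h1, map_zero, mul_zero, zero_add, Finset.prod_const, Finset.card_univ,
    Fintype.card_fin]
  have h2 := coeff_prod_of_natDegree_le Finset.univ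
    (fun i : Fin m => X * C (C (e (Fin.castAdd k i))) + C (2 * X)) 1 (fun i _ => by
      refine (natDegree_add_le _ _).trans (max_le (natDegree_mul_le.trans (by simp))
        ((natDegree_C _).le.trans zero_le_one)))
  rw [Finset.card_univ, Fintype.card_fin, mul_one] at h2
  rw [← C_pow, coeff_mul_C, h2]
  have h3 : ∀ i : Fin m, (X * C (C (e (Fin.castAdd k i))) + C (2 * X) : ℂ[X][X]).coeff 1 =
      C (e (Fin.castAdd k i)) := fun i => by
    rw [coeff_add, coeff_mul_C, coeff_X_one, coeff_C_succ, one_mul, add_zero]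
  simp only [h3]
  rw [← map_prod, coeff_C_mul, mul_pow, Nat.add_sub_cancel_left]
  have h4 : (2 : ℂ[X]) ^ k = C (2 ^ k) := by rw [map_pow]; rfl
  rw [h4, coeff_C_mul, coeff_X_pow_self]
  simp only [mul_one]
  rw [mul_comm]
  rfl

/-! ### The eigenvalues of `F` -/

lemma F_eq_mul (q : Phase N l) :
    F q = (Matrix.of (covec q) : Matrix (Fin N) (Fin l) ℂ) * (Matrix.of (vec q)).transpose := by
  ext i j
  simp [F, Matrix.mul_apply]

/-- `F` is a product of an `N × l` and an `l × N` matrix; exchanging the factors changes the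
characteristic polynomial only by a power of `X`. The forced zeros are numbered last, and they
become the `ν_i = 1`. -/
lemma exists_charpoly_F_eq (q : Phase N l) : ∃ e : Fin N → ℂ,
    (∀ i : Fin N, l ≤ i → e i = 0) ∧ (F q).charpoly = ∏ i, (X - C (e i)) := by
  rcases le_total l N with h | h
  · have h1 := Matrix.charpoly_mul_comm_of_le (R := ℂ) (Matrix.of (covec q)) (Matrix.of (vec q)).transpose
      (by simpa using h)
    obtain ⟨μ, hμ⟩ := exists_eq_prod_X_sub_C l
      (Matrix.charpoly_monic ((Matrix.of (vec q)).transpose * Matrix.of (covec q))) (by simp)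
    rw [← F_eq_mul, hμ] at h1
    simp only [Fintype.card_fin] at h1
    obtain ⟨k, rfl⟩ := Nat.exists_eq_add_of_le h
    refine ⟨Fin.addCases μ fun _ => 0, fun i hi => ?_, ?_⟩
    · obtain ⟨j, rfl⟩ : ∃ j, i = Fin.natAdd l j := ⟨⟨i - l, by omega⟩, by ext; simp; omega⟩
      simp
    · rw [Fin.prod_univ_add, h1]
      simp [mul_comm]
  · obtain ⟨μ, hμ⟩ := exists_eq_prod_X_sub_C N (Matrix.charpoly_monic (F q)) (by simp)
    exact ⟨μ, fun i hi => absurd i.2 (by omega), hμ⟩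

lemma mem_spectrum_iff_of_charpoly_eq {B : Matrix (Fin N) (Fin N) ℂ} {e : Fin N → ℂ}
    (he : B.charpoly = ∏ i, (X - C (e i))) (x : ℂ) : x ∈ spectrum ℂ B ↔ ∃ i, e i = x := by
  rw [Matrix.mem_spectrum_iff_isRoot_charpoly, he, IsRoot, eval_prod, Finset.prod_eq_zero_iff]
  simp [sub_eq_zero, eq_comm]

/-- At most `m` of the `e i` can be nonzero, so `m` distinct nonzero values use all of these
indices, each once. -/
lemma ne_zero_and_injOn_of_ncard {B : Matrix (Fin N) (Fin N) ℂ} {e : Fin N → ℂ}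
    (he : B.charpoly = ∏ i, (X - C (e i))) {m : ℕ}
    (he0 : ∀ i : Fin N, m ≤ i → e i = 0) (hcard : (spectrum ℂ B \ {0}).ncard = m) :
    (∀ i : Fin N, (i : ℕ) < m → e i ≠ 0) ∧
      ∀ i j : Fin N, (i : ℕ) < m → (j : ℕ) < m → e i = e j → i = j := by
  set s : Finset (Fin N) := Finset.univ.filter fun i => (i : ℕ) < m with hs
  have hscard : s.card ≤ m := by
    have h1 : s.card ≤ (Finset.range m).card :=
      Finset.card_le_card_of_injOn (fun i : Fin N => (i : ℕ)) (fun i hi => by simpa [hs] using hi)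
        fun i _ j _ h => Fin.ext h
    simpa using h1
  set u := s.filter fun i => e i ≠ 0 with hu
  have h2 : spectrum ℂ B \ {0} = (u.image e : Set ℂ) := by
    ext x
    simp only [Set.mem_sdiff, mem_spectrum_iff_of_charpoly_eq he, Set.mem_singleton_iff,
      Finset.coe_image, Set.mem_image, Finset.mem_coe, hu, hs, Finset.mem_filter, Finset.mem_univ,
      true_and]
    constructor
    · rintro ⟨⟨i, rfl⟩, hx⟩
      exact ⟨i, ⟨lt_of_not_ge fun h => hx (he0 i h), hx⟩, rfl⟩
    · rintro ⟨i, ⟨-, h⟩, rfl⟩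
      exact ⟨⟨i, rfl⟩, h⟩
  rw [h2, Set.ncard_coe_finset] at hcard
  have h3 : u.card ≤ s.card := Finset.card_filter_le _ _
  have h4 : (u.image e).card ≤ u.card := Finset.card_image_le
  have h5 : u = s := Finset.eq_of_subset_of_card_le (Finset.filter_subset _ _) (by omega)
  have h6 : Set.InjOn e u := Finset.card_image_iff.mp (by omega)
  have h7 : ∀ i : Fin N, (i : ℕ) < m → i ∈ u := fun i hi => h5 ▸ by simpa [hs] using hi
  exact ⟨fun i hi => (Finset.mem_filter.mp (h7 i hi)).2,
    fun i j hi hj h => h6 (h7 i hi) (h7 j hj) h⟩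

lemma charpoly_half_sub_one {B : Matrix (Fin N) (Fin N) ℂ} {e : Fin N → ℂ}
    (he : B.charpoly = ∏ i, (X - C (e i))) :
    ((1 / 2 : ℂ) • B - 1).charpoly = ∏ i, (X - C (e i / 2 - 1)) := by
  refine Polynomial.funext fun x => ?_
  have h1 := congrArg (eval (2 * (x + 1))) he
  rw [Matrix.eval_charpoly, eval_prod] at h1
  have h2 := Matrix.det_smul (Matrix.scalar (Fin N) (2 * (x + 1)) - B) (1 / 2)
  rw [h1, ← Finset.card_univ, ← Finset.prod_const, ← Finset.prod_mul_distrib] at h2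
  rw [Matrix.eval_charpoly, eval_prod]
  have h3 : Matrix.scalar (Fin N) x - ((1 / 2 : ℂ) • B - 1) =
      (1 / 2 : ℂ) • (Matrix.scalar (Fin N) (2 * (x + 1)) - B) := by
    ext i j
    rcases eq_or_ne i j with rfl | hij
    · simp
      ring
    · simp [hij]
  rw [h3, h2]
  refine Finset.prod_congr rfl fun i _ => ?_
  simp
  ring

end SpinCM

namespace SpinCM

open Polynomial

variable {N l : ℕ}

/-! ### Factorization of the spectral curve near `z = 0` -/

lemma R_eq_mul_charpoly (L : PeriodPair) (q : Phase N l) {B : ℂ → Matrix (Fin N) (Fin N) ℂ} {z : ℂ}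
    (hz : z ≠ 0) (hB : (-(1 / 2 : ℂ)) • laxR L q z = z⁻¹ • B z) (k : ℂ) :
    R L q k z = 2 ^ N * ((z⁻¹) ^ N * (B z).charpoly.eval (z * k)) := by
  rw [R_eq_eval_charpoly, hB, charpoly_smul (inv_ne_zero hz)]
  simp

lemma eventually_ne_zero_and_notMem (L : PeriodPair) : ∀ᶠ z in 𝓝[≠] (0 : ℂ), z ≠ 0 ∧ z ∉ L.lattice := by
  filter_upwards [self_mem_nhdsWithin, eventually_notMem_lattice L 0] with z hz hz'
  exact ⟨hz, hz'⟩

/-- The roots in `k`, multiplied by `z`, are the eigenvalues `μ i z` of `B z`, and can be numbered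
to converge to `e i / 2 - 1`. This limit is `-ν i`, and the deviation from it, divided by `-z`, is
`h i`. -/
theorem exists_factorization (L : PeriodPair) {q : Phase N l} (hq : q ∈ phaseSpace L N l) :
    ∃ (ν : Fin N → ℂ) (h : Fin N → ℂ → ℂ), (∀ i : Fin N, l ≤ (i : ℕ) → ν i = 1) ∧
      (∀ᶠ z in 𝓝[≠] (0 : ℂ), z ∉ L.lattice ∧ ∀ k : ℂ,
        R L q k z = 2 ^ N * ∏ i, (k + ν i / z + h i z)) ∧
      ∀ i, Tendsto (fun z => z * h i z) (𝓝[≠] 0) (𝓝 0) := by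
  obtain ⟨B, hB, hB0, hBz⟩ := exists_regularized_laxR L hq
  obtain ⟨e, hel, he⟩ := exists_charpoly_F_eq q
  have h0 : (B 0).charpoly = ∏ i, (X - C (e i / 2 - 1)) := by rw [hB0, charpoly_half_sub_one he]
  obtain ⟨μ, hμ, hμt⟩ := exists_roots_tendsto (f := 𝓝[≠] (0 : ℂ)) N (p := fun z => (B z).charpoly)
    (fun z => Matrix.charpoly_monic _) (fun z => by simp) (ν := fun i => e i / 2 - 1) (fun i => by
      rw [← h0]
      exact (analyticAt_coeff_charpoly hB i).continuousAt.tendsto.mono_left nhdsWithin_le_nhds)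
  refine ⟨fun i => 1 - e i / 2, fun i z => -(μ i z - (e i / 2 - 1)) / z,
    fun i hi => by simp [hel i hi], ?_, fun i => ?_⟩
  · filter_upwards [eventually_ne_zero_and_notMem L] with z ⟨hz, hzL⟩
    refine ⟨hzL, fun k => ?_⟩
    rw [R_eq_mul_charpoly L q hz (hBz z hzL), hμ, eval_prod]
    have h1 : (z⁻¹) ^ N = ∏ _i : Fin N, z⁻¹ := by simp
    rw [h1, ← Finset.prod_mul_distrib]
    congr 1
    refine Finset.prod_congr rfl fun i _ => ?_
    simp only [eval_sub, eval_X, eval_C]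
    field_simp
    ring
  · have h1 : Tendsto (fun z => -(μ i z - (e i / 2 - 1))) (𝓝[≠] 0) (𝓝 0) := by
      simpa using ((hμt i).sub_const (e i / 2 - 1)).neg
    refine h1.congr' ?_
    filter_upwards [self_mem_nhdsWithin] with z hz
    have hz : z ≠ 0 := hz
    field_simp

lemma eval_derivative_prod_ne_zero {ι : Type*} [Fintype ι] [DecidableEq ι] {μ : ι → ℂ} {i : ι}
    (h : ∀ j, j ≠ i → μ j ≠ μ i) : (∏ j, (X - C (μ j))).derivative.eval (μ i) ≠ 0 := by
  rw [← Finset.mul_prod_erase Finset.univ _ (Finset.mem_univ i), derivative_mul]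
  simp only [derivative_sub, derivative_X, derivative_C, sub_zero, one_mul, eval_add, eval_mul,
    eval_sub, eval_X, eval_C, sub_self, zero_mul, add_zero, eval_prod]
  refine Finset.prod_ne_zero_iff.mpr fun j hj => ?_
  exact sub_ne_zero.mpr (h j (Finset.ne_of_mem_erase hj)).symm

/-- A simple eigenvalue of `F` gives an analytic branch of the spectral curve. -/
lemma exists_branch_of_eigenvalue (L : PeriodPair) {q : Phase N l} (hq : q ∈ phaseSpace L N l)
    {e : Fin N → ℂ} (he : (F q).charpoly = ∏ i, (X - C (e i))) {i : Fin N}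
    (hi : ∀ j, j ≠ i → e j ≠ e i) :
    ∃ h : ℂ → ℂ, AnalyticAt ℂ h 0 ∧
      ∀ᶠ z in 𝓝[≠] (0 : ℂ), R L q (-((1 - e i / 2) / z + h z)) z = 0 := by
  obtain ⟨B, hB, hB0, hBz⟩ := exists_regularized_laxR L hq
  have h0 : (B 0).charpoly = ∏ i, (X - C (e i / 2 - 1)) := by rw [hB0, charpoly_half_sub_one he]
  obtain ⟨ρ, hρ, hρ0, hρz⟩ := exists_analyticAt_root (P := fun z => (B z).charpoly) (n := N)
    (r := e i / 2 - 1) (fun z => by simp) (fun k => analyticAt_coeff_charpoly hB k)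
    (by
      rw [h0, eval_prod]
      exact Finset.prod_eq_zero (Finset.mem_univ i) (by simp))
    (by
      rw [h0]
      exact eval_derivative_prod_ne_zero (μ := fun i => e i / 2 - 1) fun j hj h => hi j hj (by
        linear_combination 2 * h))
  refine ⟨fun z => -dslope ρ 0 z, (analyticAt_dslope hρ).neg, ?_⟩
  filter_upwards [eventually_ne_zero_and_notMem L, hρz.filter_mono nhdsWithin_le_nhds]
    with z ⟨hz, hzL⟩ hr
  rw [R_eq_mul_charpoly L q hz (hBz z hzL)]
  have h1 : z * -((1 - e i / 2) / z + -dslope ρ 0 z) = ρ z := by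
    rw [dslope_of_ne _ hz, slope_def_field, hρ0]
    field_simp
    ring
  rw [h1, hr]
  simp

/-- Reversal of a polynomial of degree at most `m`. -/
lemma neg_pow_mul_eval_neg_inv {K : Type*} [Field K] {p : K[X]} {m : ℕ} (hp : p.natDegree ≤ m)
    {z : K} (hz : z ≠ 0) : (-z) ^ m * p.eval (-z⁻¹) =
      ∑ j ∈ Finset.range (m + 1), (-1) ^ (m + j) * z ^ (m - j) * p.coeff j := by
  rw [eval_eq_sum_range' (Nat.lt_succ_of_le hp), Finset.mul_sum]
  refine Finset.sum_congr rfl fun j hj => ?_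
  obtain ⟨d, rfl⟩ := Nat.exists_eq_add_of_le (Nat.le_of_lt_succ (Finset.mem_range.mp hj))
  rw [Nat.add_sub_cancel_left, neg_pow z, neg_pow z⁻¹, inv_pow, pow_add z, pow_add (-1) (j + d)]
  field_simp

/-- A simple root of `kernelPoly` gives an analytic branch of the spectral curve. -/
lemma exists_branch_of_root_kernelPoly (L : PeriodPair) {q : Phase N l}
    (hq : q ∈ phaseSpace L N l) {r : ℂ} (hr : (kernelPoly L q).eval r = 0)
    (hr' : (kernelPoly L q).derivative.eval r ≠ 0) :
    ∃ h : ℂ → ℂ, AnalyticAt ℂ h 0 ∧ h 0 = -r ∧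
      ∀ᶠ z in 𝓝[≠] (0 : ℂ), R L q (-(1 / z + h z)) z = 0 := by
  obtain ⟨A, hA, hA0, hAz⟩ := exists_laxR_expansion L hq
  set m := min l N with hm
  -- `E z` is `(-z)^m` times the pencil at `s = -1/z`, written without negative powers so that it is
  -- analytic at `0`. Only the term `j = m` survives at `z = 0`, and it is `kernelPoly`.
  obtain ⟨E, hE⟩ : ∃ E : ℂ → ℂ[X], ∀ z, E z = ∑ j ∈ Finset.range (m + 1),
    C ((-1) ^ (m + j) * z ^ (m - j)) * (pencil (A z) (F q)).coeff j := ⟨_, fun _ => rfl⟩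
  have hE0 : E 0 = kernelPoly L q := by
    rw [hE, Finset.sum_range_succ, Finset.sum_eq_zero, kernelPoly_eq, hA0]
    · simp [← two_mul, hm]
    · intro j hj
      have hj' : m - j ≠ 0 := by
        have := Finset.mem_range.mp hj
        omega
      simp [hj']
  have hEdeg : ∀ z, (E z).natDegree ≤ N := fun z => by
    rw [hE]
    refine natDegree_sum_le_of_forall_le _ _ fun j _ => ?_
    exact (natDegree_C_mul_le _ _).trans ((natDegree_coeff_pencil_le _ _ _).trans (Nat.sub_le _ _))
  have hEan : ∀ i, AnalyticAt ℂ (fun z => (E z).coeff i) 0 := fun i => by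
    simp only [hE, finsetSum_coeff, coeff_C_mul]
    refine Finset.analyticAt_fun_sum _ fun j _ => ?_
    have h1 := analyticAt_coeff_pencil (B := fun _ => F q) hA (fun _ _ => analyticAt_const) j i
    have h2 : AnalyticAt ℂ (fun z : ℂ => (-1 : ℂ) ^ (m + j) * z ^ (m - j)) 0 := by fun_prop
    exact h2.fun_mul h1
  obtain ⟨ρ, hρ, hρ0, hρz⟩ := exists_analyticAt_root hEdeg hEan (r := r)
    (by rw [hE0, hr]) (by rwa [hE0])
  refine ⟨fun z => -ρ z, hρ.neg, congrArg Neg.neg hρ0, ?_⟩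
  filter_upwards [eventually_ne_zero_and_notMem L, hρz.filter_mono nhdsWithin_le_nhds]
    with z ⟨hz, hzL⟩ hr
  -- With `k = -1/z + ρ` the scalar part of the pole `(2 - F)/z` cancels, leaving the pencil at `κ =
  -- ρ`, `s = -1/z`.
  have h1 : (2 * -(1 / z + -ρ z)) • (1 : Matrix (Fin N) (Fin N) ℂ) + laxR L q z =
      (2 * ρ z) • (1 : Matrix (Fin N) (Fin N) ℂ) + A z + (-z⁻¹) • F q := by
    rw [hAz z hzL]
    ext i j
    rcases eq_or_ne i j with rfl | hij
    · simp
      ring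
    · simp [hij]
  rw [R_eq_det, h1, ← eval_eval_pencil]
  have h2 : (-z) ^ m * (((pencil (A z) (F q)).eval (C (-z⁻¹))).eval (ρ z)) = 0 := by
    have h3 := neg_pow_mul_eval_neg_inv (m := m)
      ((natDegree_map_le (f := evalRingHom (ρ z))).trans (natDegree_pencil_le (A z) q)) hz
    have h4 : (((pencil (A z) (F q)).eval (C (-z⁻¹))).eval (ρ z)) =
        ((pencil (A z) (F q)).map (evalRingHom (ρ z))).eval (-z⁻¹) := by
      rw [eval_map, eval₂_eq_sum_range, eval_eq_sum_range (p := pencil (A z) (F q)),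
        eval_finsetSum]
      simp
    rw [h4, h3, ← hr]
    simp only [hE, eval_finsetSum, coeff_map, eval_mul, eval_C, coe_evalRingHom]
  exact (mul_eq_zero.mp h2).resolve_left (pow_ne_zero _ (neg_ne_zero.mpr hz))

lemma exists_injective_roots {p : ℂ[X]} (hp : p.Separable) {n : ℕ} (hn : p.natDegree = n) :
    ∃ r : Fin n → ℂ, Function.Injective r ∧ ∀ i, p.eval (r i) = 0 := by
  have h1 : p.roots.toFinset.card = n := by
    rw [Multiset.toFinset_card_of_nodup (nodup_roots hp), ← hn,
      (IsAlgClosed.splits p).natDegree_eq_card_roots]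
  refine ⟨fun i => (p.roots.toFinset.equivFinOfCardEq h1).symm i, fun i j h => ?_, fun i => ?_⟩
  · exact (Equiv.injective _) (Subtype.ext h)
  · have := ((p.roots.toFinset.equivFinOfCardEq h1).symm i).2
    rw [Multiset.mem_toFinset] at this
    exact isRoot_of_mem_roots this

/-- The `m` simple nonzero eigenvalues give branches with distinct `ν ≠ 1`; the `N - m` roots of
`kernelPoly` give branches with `ν = 1` and distinct `h 0`. For small `z ≠ 0` these are `N`
different roots of a polynomial of degree `N`, hence all of them. -/
theorem exists_analytic_factorization (L : PeriodPair) {q : Phase N l}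
    (hq : q ∈ phaseSpace L N l) (hg : IsGeneric L q) :
    ∃ (ν : Fin N → ℂ) (h : Fin N → ℂ → ℂ), (∀ i : Fin N, l ≤ (i : ℕ) → ν i = 1) ∧
      (∀ᶠ z in 𝓝[≠] (0 : ℂ), z ∉ L.lattice ∧ ∀ k : ℂ,
        R L q k z = 2 ^ N * ∏ i, (k + ν i / z + h i z)) ∧
      ∀ i, AnalyticAt ℂ (h i) 0 := by
  obtain ⟨e, hel, he⟩ := exists_charpoly_F_eq q
  set m := min l N with hm
  have hem : ∀ i : Fin N, m ≤ i → e i = 0 := fun i hi => hel i (by omega)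
  obtain ⟨hne, hinj⟩ := ne_zero_and_injOn_of_ncard he hem hg.1
  have hdeg : (kernelPoly L q).natDegree = N - m := by
    -- The top coefficient is a power of `2` times the product of the nonzero eigenvalues of `F`, so
    -- no root of `kernelPoly` is missing.
    refine natDegree_eq_of_le_of_coeff_ne_zero (natDegree_coeff_pencil_le _ _ _) ?_
    rw [kernelPoly_eq, ← hm, coeff_pencil_top (min_le_right l N) _ he hem]
    refine mul_ne_zero (pow_ne_zero _ two_ne_zero) (Finset.prod_ne_zero_iff.mpr fun i _ => ?_)
    exact hne _ i.2
  obtain ⟨r, hrinj, hr⟩ := exists_injective_roots hg.2 hdeg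
  have hbranch : ∀ i : Fin N, ∃ (ν : ℂ) (h : ℂ → ℂ), AnalyticAt ℂ h 0 ∧
      (∀ᶠ z in 𝓝[≠] (0 : ℂ), R L q (-(ν / z + h z)) z = 0) ∧ ν = 1 - e i / 2 ∧
      ∀ hi : m ≤ i, h 0 = -r ⟨i - m, by omega⟩ := by
    intro i
    rcases lt_or_ge (i : ℕ) m with hi | hi
    · obtain ⟨h, ha, hz⟩ := exists_branch_of_eigenvalue L hq he (i := i) (fun j hj hje => by
        rcases lt_or_ge (j : ℕ) m with hj' | hj'
        · exact hj (hinj _ _ hj' hi hje)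
        · exact hne i hi (by rw [← hje, hem j hj']))
      exact ⟨_, h, ha, hz, rfl, fun hi' => absurd hi' (not_le.mpr hi)⟩
    · obtain ⟨h, ha, h0, hz⟩ := exists_branch_of_root_kernelPoly L hq
        (hr ⟨i - m, by omega⟩) (hg.2.eval₂_derivative_ne_zero (RingHom.id ℂ) (hr _))
      exact ⟨1, h, ha, hz, by simp [hem i hi], fun _ => h0⟩
  choose ν h ha hroot hν h0 using hbranch
  -- Two branches separate by their polar parts if `ν i ≠ ν j`. Otherwise both belong to the
  -- eigenvalue `0`, and the values `h 0` differ because the roots `r` do.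
  have hdist : ∀ i j, i ≠ j → ∀ᶠ z in 𝓝[≠] (0 : ℂ), ν i / z + h i z ≠ ν j / z + h j z := by
    intro i j hij
    have hc : ∀ i, Tendsto (h i) (𝓝[≠] 0) (𝓝 (h i 0)) := fun i =>
      (ha i).continuousAt.tendsto.mono_left nhdsWithin_le_nhds
    by_cases hνij : ν i = ν j
    · have h00 : h i 0 - h j 0 ≠ 0 := by
        have heij : e i = e j := by
          rw [hν, hν] at hνij
          linear_combination -2 * hνij
        have him : m ≤ i := by
          by_contra! hi
          rcases lt_or_ge (j : ℕ) m with hj | hj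
          · exact hij (hinj _ _ hi hj heij)
          · exact hne i hi (by rw [heij, hem j hj])
        have hjm : m ≤ j := by
          by_contra! hj
          exact hne j hj (by rw [← heij, hem i him])
        rw [h0 i him, h0 j hjm]
        intro h
        have h1 : r ⟨i - m, by omega⟩ = r ⟨j - m, by omega⟩ := by linear_combination -h
        have h2 := hrinj h1
        rw [Fin.mk.injEq] at h2
        exact hij (Fin.ext (by omega))
      filter_upwards [((hc i).sub (hc j)).eventually_ne h00] with z hz hz'
      exact hz (by rw [hνij] at hz'; linear_combination hz')
    · have h1 : Tendsto (fun z : ℂ => (ν i - ν j) + z * (h i z - h j z)) (𝓝[≠] 0)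
          (𝓝 ((ν i - ν j) + 0 * (h i 0 - h j 0))) :=
        ((tendsto_id.mono_left nhdsWithin_le_nhds).mul ((hc i).sub (hc j))).const_add _
      rw [zero_mul, add_zero] at h1
      filter_upwards [h1.eventually_ne (sub_ne_zero.mpr hνij), self_mem_nhdsWithin] with z hz hz0 hz'
      have hz0 : z ≠ 0 := hz0
      refine hz ?_
      field_simp at hz'
      linear_combination hz'
  refine ⟨ν, h, fun i hi => by rw [hν, hel i hi]; simp, ?_, ha⟩
  filter_upwards [eventually_all.mpr hroot, eventually_notMem_lattice L 0,
    eventually_all.mpr fun i => eventually_all.mpr fun j =>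
      eventually_imp_distrib_left.mpr (hdist i j)] with z hz hzL hd
  refine ⟨hzL, fun k => ?_⟩
  have h1 := eq_prod_X_sub_C_of_injective (n := N)
    (Matrix.charpoly_monic ((-(1 / 2 : ℂ)) • laxR L q z)) (by simp)
    (μ := fun i => -(ν i / z + h i z)) (fun i j hij => by
      by_contra hne
      exact hd i j hne (neg_injective hij)) (fun i => by
      have := hz i
      rw [R_eq_eval_charpoly] at this
      exact (mul_eq_zero.mp this).resolve_left (pow_ne_zero _ two_ne_zero))
  rw [R_eq_eval_charpoly, h1, eval_prod]
  congr 1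
  refine Finset.prod_congr rfl fun i _ => ?_
  simp
  ring

/-- The factorization at one time serves for all times, as `R` is conserved; that time is chosen
generic whenever possible. An empty `T` needs arbitrary witnesses. -/
theorem IsTrajectory.exists_factorization {L : PeriodPair} {T : Set ℝ} {lam : ℝ → Fin N → ℂ}
    {γ : ℝ → Phase N l} (hT : IsOpen T) (hT' : IsPreconnected T) (hγ : IsTrajectory L T lam γ) :
    ∃ (ν : Fin N → ℂ) (h : Fin N → ℂ → ℂ),
      (∀ i : Fin N, l ≤ (i : ℕ) → ν i = 1) ∧
      (∀ᶠ z in 𝓝[≠] (0 : ℂ), ∀ t ∈ T, ∀ k : ℂ,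
        R L (γ t) k z = 2 ^ N * ∏ i, (k + ν i / z + h i z)) ∧
      (∀ i, Tendsto (fun z => z * h i z) (𝓝[≠] 0) (𝓝 0)) ∧
      ((∃ t ∈ T, IsGeneric L (γ t)) → ∀ i, AnalyticAt ℂ (h i) 0) := by
  by_cases hg : ∃ t ∈ T, IsGeneric L (γ t)
  · obtain ⟨t₀, ht₀, hg₀⟩ := hg
    obtain ⟨ν, h, hν, hR, ha⟩ := exists_analytic_factorization L (hγ.mem_phaseSpace t₀ ht₀) hg₀
    refine ⟨ν, h, hν, ?_, fun i => ?_, fun _ => ha⟩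
    · filter_upwards [hR] with z hz t ht k
      rw [← hz.2 k, R_eq_of_isTrajectory hT hT' hγ ht ht₀ k hz.1]
    · have h1 := (continuousAt_id (x := (0 : ℂ))).mul (ha i).continuousAt
      simpa using! h1.tendsto.mono_left (nhdsWithin_le_nhds (s := ({0} : Set ℂ)ᶜ))
  · rcases T.eq_empty_or_nonempty with rfl | ⟨t₀, ht₀⟩
    · exact ⟨fun _ => 1, fun _ _ => 0, by simp, by simp, by simp, by simp⟩
    · obtain ⟨ν, h, hν, hR, ht⟩ := SpinCM.exists_factorization L (hγ.mem_phaseSpace t₀ ht₀)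
      refine ⟨ν, h, hν, ?_, ht, fun h => absurd h hg⟩
      filter_upwards [hR] with z hz t ht k
      rw [← hz.2 k, R_eq_of_isTrajectory hT hT' hγ ht ht₀ k hz.1]

theorem IsTrajectory.exists_R_eq_sum {L : PeriodPair} {T : Set ℝ} {lam : ℝ → Fin N → ℂ}
    {γ : ℝ → Phase N l} (hT : IsOpen T) (hT' : IsPreconnected T) (hγ : IsTrajectory L T lam γ) :
    ∃ (r : Fin (N + 1) → ℂ → ℂ) (I₀ : Fin (N + 1) → ℂ) (I : Fin (N + 1) → ℕ → ℂ),
      (∀ i, IsElliptic L (r i)) ∧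
      (∀ i, ∀ z ∉ L.lattice, r i z =
        I₀ i + ∑ s ∈ Finset.range (N - 1 - i), I i s * iteratedDeriv s L.weierstrassP z) ∧
      ∀ t ∈ T, ∀ z ∉ L.lattice, ∀ k : ℂ,
        R L (γ t) k z = ∑ i : Fin (N + 1), r i z * k ^ (i : ℕ) := by
  obtain ⟨I₀, I, hI⟩ : ∃ (I₀ : Fin (N + 1) → ℂ) (I : Fin (N + 1) → ℕ → ℂ), ∀ t ∈ T,
      ∀ z ∉ L.lattice, ∀ k, R L (γ t) k z = ∑ i : Fin (N + 1), (I₀ i +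
        ∑ s ∈ Finset.range (N - 1 - i), I i s * iteratedDeriv s L.weierstrassP z) * k ^ (i : ℕ) := by
    rcases T.eq_empty_or_nonempty with rfl | ⟨t₀, ht₀⟩
    · exact ⟨0, 0, by simp⟩
    · obtain ⟨I₀, I, hI⟩ := SpinCM.exists_R_eq_sum L (hγ.mem_phaseSpace t₀ ht₀)
      refine ⟨I₀, I, fun t ht z hz k => ?_⟩
      rw [← hI z hz, R_eq_of_isTrajectory hT hT' hγ ht ht₀ k hz]
  refine ⟨fun i z => I₀ i + ∑ s ∈ Finset.range (N - 1 - i),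
    I i s * iteratedDeriv s L.weierstrassP z, I₀, I, fun i => ⟨?_, fun w hw z => ?_⟩,
    fun _ _ _ => rfl, hI⟩
  · intro z
    refine MeromorphicAt.fun_add (.const _ _) (MeromorphicAt.fun_sum fun s _ => ?_)
    exact MeromorphicAt.fun_mul (.const _ _) (meromorphic_iteratedDeriv_weierstrassP L s z)
  · simp only [iteratedDeriv_weierstrassP_add L _ hw z]

end SpinCM

namespace SpinCM

open Polynomial

/-! ### Analytic families of polynomials with simple roots -/

/-- The polynomial `p` has degree `n` and simple roots. -/
def IsSimple (p : ℂ[X]) (n : ℕ) : Prop := p.Separable ∧ p.natDegree = n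

/-- Simplicity of an analytic family of polynomials of degree at most `n` is the nonvanishing of an
analytic function. -/
lemma exists_analyticOnNhd_discriminant {U : Set ℂ} {f : ℂ → ℂ[X]} {n : ℕ}
    (hn : ∀ τ ∈ U, (f τ).natDegree ≤ n)
    (hf : ∀ τ ∈ U, ∀ i, AnalyticAt ℂ (fun τ => (f τ).coeff i) τ) :
    ∃ D : ℂ → ℂ, AnalyticOnNhd ℂ D U ∧ ∀ τ ∈ U, D τ ≠ 0 ↔ IsSimple (f τ) n := by
  rcases Nat.eq_zero_or_pos n with rfl | hpos
  · refine ⟨fun τ => (f τ).coeff 0, fun τ hτ => hf τ hτ 0, fun τ hτ => ⟨fun h => ?_, fun h h0 => ?_⟩⟩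
    · have h1 := eq_C_of_natDegree_le_zero (hn τ hτ)
      refine ⟨?_, Nat.le_zero.mp (hn τ hτ)⟩
      rw [h1]
      exact (separable_C _).mpr (isUnit_iff_ne_zero.mpr h)
    · have h1 := eq_C_of_natDegree_le_zero (hn τ hτ)
      rw [show (f τ).coeff 0 = 0 from h0, map_zero] at h1
      exact h.1.ne_zero h1
  · have hdeg : ∀ τ ∈ U, (f τ).derivative.natDegree ≤ n - 1 := fun τ hτ =>
      (natDegree_derivative_le _).trans (Nat.sub_le_sub_right (hn τ hτ) 1)
    -- The first factor detects a drop of the degree, the second a root shared with the derivative.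
    -- The formal degrees `n` and `n - 1` are fixed, so the resultant is a determinant of constant
    -- size with analytic entries.
    refine ⟨fun τ => (f τ).coeff n * resultant (f τ) (f τ).derivative n (n - 1),
      fun τ hτ => (hf τ hτ n).mul ?_, fun τ hτ => ?_⟩
    · refine det_mem (analyticSubring τ) fun i j => ?_
      induction j using Fin.addCases with
      | left j =>
        simp only [sylvester, Matrix.of_apply, Fin.addCases_left]
        split_ifs
        · simp only [coeff_derivative]
          exact (hf τ hτ _).mul analyticAt_const
        · exact analyticAt_const
      | right j =>
        simp only [sylvester, Matrix.of_apply, Fin.addCases_right]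
        split_ifs
        · exact hf τ hτ _
        · exact analyticAt_const
    · rw [mul_ne_zero_iff]
      constructor
      · rintro ⟨h1, h2⟩
        refine ⟨?_, natDegree_eq_of_le_of_coeff_ne_zero (hn τ hτ) h1⟩
        obtain ⟨a, b, -, -, hab⟩ := exists_mul_add_mul_eq_C_resultant (f τ) (f τ).derivative
          (hn τ hτ) (hdeg τ hτ) (Or.inl hpos.ne')
        refine ⟨C (resultant (f τ) (f τ).derivative n (n - 1))⁻¹ * a,
          C (resultant (f τ) (f τ).derivative n (n - 1))⁻¹ * b, ?_⟩
        have h3 := congrArg (C (resultant (f τ) (f τ).derivative n (n - 1))⁻¹ * ·) hab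
        simp only [← C_mul, inv_mul_cancel₀ h2, C_1] at h3
        linear_combination h3
      · rintro ⟨h1, h2⟩
        have h3 : (f τ).coeff n ≠ 0 := by
          rw [← h2, coeff_natDegree]
          exact leadingCoeff_ne_zero.mpr h1.ne_zero
        refine ⟨h3, ?_⟩
        have h4 : (f τ).derivative.natDegree = n - 1 := by
          rw [← h2]
          exact natDegree_eq_of_degree_eq_some (degree_derivative (by omega))
        have h5 := resultant_ne_zero _ _ h1
        rwa [h2, h4] at h5

/-- Identity theorem: the discriminant is nonzero at `τ₁`, so its zeros cannot accumulate at `τ₀` in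
the connected set `U`. -/
lemma eventually_isSimple {U : Set ℂ} (hU : IsPreconnected U) {f : ℂ → ℂ[X]} {n : ℕ}
    (hn : ∀ τ ∈ U, (f τ).natDegree ≤ n)
    (hf : ∀ τ ∈ U, ∀ i, AnalyticAt ℂ (fun τ => (f τ).coeff i) τ) {τ₀ τ₁ : ℂ} (h₀ : τ₀ ∈ U)
    (h₁ : τ₁ ∈ U) (h : IsSimple (f τ₁) n) (hU₀ : U ∈ 𝓝 τ₀) :
    ∀ᶠ τ in 𝓝[≠] τ₀, IsSimple (f τ) n := by
  obtain ⟨D, hD, hDs⟩ := exists_analyticOnNhd_discriminant hn hf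
  have h1 : ¬ ∃ᶠ τ in 𝓝[≠] τ₀, D τ = 0 := fun h2 =>
    (hDs τ₁ h₁).mpr h (hD.eqOn_zero_of_preconnected_of_frequently_eq_zero hU h₀ h2 h₁)
  filter_upwards [not_frequently.mp h1, nhdsWithin_le_nhds hU₀] with τ hτ hτU
  exact (hDs τ hτU).mp hτ

/-! ### Analytic paths in the phase space -/

variable {N l : ℕ}

/-- Interpolate linearly, then rescale each `b i` by `2 / g i` to restore `f_ii = 2`. The `g i` are
polynomials in `τ` with value `2` at `0`, so finitely many times are excluded; for complex times the
rest is connected. Fixed positions keep the values `ζ(x_i - x_j)` constant. -/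
lemma exists_path (L : PeriodPair) {q q₁ : Phase N l} (hq : q ∈ phaseSpace L N l)
    (hq₁ : q₁ ∈ phaseSpace L N l) (hpos : pos q₁ = pos q) :
    ∃ (U : Set ℂ) (γ : ℂ → Phase N l), IsOpen U ∧ IsPreconnected U ∧ 0 ∈ U ∧ 1 ∈ U ∧ γ 0 = q ∧
      γ 1 = q₁ ∧ (∀ τ, pos (γ τ) = pos q) ∧ (∀ τ ∈ U, γ τ ∈ phaseSpace L N l) ∧
      (∀ τ ∈ U, ∀ i, AnalyticAt ℂ (fun τ => mom (γ τ) i) τ) ∧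
      (∀ τ ∈ U, ∀ i α, AnalyticAt ℂ (fun τ => vec (γ τ) i α) τ) ∧
      ∀ τ ∈ U, ∀ i α, AnalyticAt ℂ (fun τ => covec (γ τ) i α) τ := by
  set a : ℂ → Fin N → Fin l → ℂ := fun τ i α => vec q i α + τ * (vec q₁ i α - vec q i α) with ha
  set b : ℂ → Fin N → Fin l → ℂ := fun τ i α => covec q i α + τ * (covec q₁ i α - covec q i α) with hb
  set g : ℂ → Fin N → ℂ := fun τ i => ∑ α, b τ i α * a τ i α with hg
  set U : Set ℂ := {τ | ∀ i, g τ i ≠ 0} with hU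
  have hgc : ∀ i, Continuous fun τ => g τ i := fun i => by fun_prop
  have hga : ∀ i τ, AnalyticAt ℂ (fun τ => g τ i) τ := fun i τ => by
    refine Finset.analyticAt_fun_sum _ fun α _ => ?_
    fun_prop
  have hg0 : ∀ i, g 0 i = 2 := fun i => by
    have := hq.2 i
    simpa [g, a, b, F] using this
  have hg1 : ∀ i, g 1 i = 2 := fun i => by
    have := hq₁.2 i
    simpa [g, a, b, F] using this
  have hfin : (⋃ i, {τ | g τ i = 0}).Finite := by
    refine Set.finite_iUnion fun i => ?_
    set P : ℂ[X] := ∑ α, (C (covec q i α) + X * C (covec q₁ i α - covec q i α)) *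
      (C (vec q i α) + X * C (vec q₁ i α - vec q i α)) with hP
    have hPg : ∀ τ, P.eval τ = g τ i := fun τ => by
      simp only [hP, hg, ha, hb, eval_finsetSum, eval_mul, eval_add, eval_C, eval_X]
    have hP0 : P ≠ 0 := by
      intro h
      have := hPg 0
      rw [h, eval_zero, hg0] at this
      norm_num at this
    refine (Multiset.finite_toSet P.roots).subset fun τ hτ => ?_
    exact (mem_roots hP0).mpr ((hPg τ).trans hτ)
  have hUc : U = (⋃ i, {τ | g τ i = 0})ᶜ := by
    ext τ
    simp [hU]
  refine ⟨U, fun τ => (pos q, fun i => mom q i + τ * (mom q₁ i - mom q i), a τ,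
    fun i α => 2 / g τ i * b τ i α), ?_, ?_, fun i => by simp [hg0], fun i => by simp [hg1], ?_, ?_,
    fun _ => rfl, fun τ hτ => ⟨hq.1, fun i => ?_⟩, fun τ _ i => ?_, fun τ _ i α => ?_,
    fun τ hτ i α => ?_⟩
  · rw [hUc, isOpen_compl_iff]
    exact hfin.isClosed
  · rw [hUc]
    exact (hfin.countable.isConnected_compl_of_one_lt_rank (by simp)).isPreconnected
  · simp only [hg0]
    simp [a, b]
    rfl
  · simp only [hg1]
    simp [a, b]
    rw [← hpos]
    rfl
  · have h1 : F (pos q, fun i => mom q i + τ * (mom q₁ i - mom q i), a τ,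
        fun i α => 2 / g τ i * b τ i α) i i = 2 / g τ i * g τ i := by
      simp only [F, Matrix.of_apply, covec, vec, hg, Finset.mul_sum, mul_assoc]
    rw [h1, div_mul_cancel₀ _ (hτ i)]
  · simp only [mom]
    fun_prop
  · simp only [vec, a]
    fun_prop
  · exact (analyticAt_const.div (hga i τ) (hτ i)).mul (by fun_prop)

lemma continuousAt_phase {γ : ℂ → Phase N l} {τ : ℂ} (hp : ∀ i, ContinuousAt (fun τ => pos (γ τ) i) τ)
    (hm : ∀ i, ContinuousAt (fun τ => mom (γ τ) i) τ)
    (hv : ∀ i α, ContinuousAt (fun τ => vec (γ τ) i α) τ)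
    (hc : ∀ i α, ContinuousAt (fun τ => covec (γ τ) i α) τ) : ContinuousAt γ τ :=
  (continuousAt_pi.mpr hp).prodMk ((continuousAt_pi.mpr hm).prodMk
    ((continuousAt_pi.mpr fun i => continuousAt_pi.mpr (hv i)).prodMk
      (continuousAt_pi.mpr fun i => continuousAt_pi.mpr (hc i))))

/-- If two families of polynomials, depending analytically on the matrices `F` and `Q`, are simple
at one point each, with the positions of `q`, then arbitrarily close to `q` both are. -/
lemma mem_closure_of_isSimple (L : PeriodPair) {f : Phase N l → ℂ[X]} {n : ℕ}
    (hn : ∀ q, (f q).natDegree ≤ n)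
    (hf : ∀ (γ : ℂ → Phase N l) (τ : ℂ), (∀ i j, AnalyticAt ℂ (fun τ => F (γ τ) i j) τ) →
      (∀ i j, AnalyticAt ℂ (fun τ => Q L (γ τ) i j) τ) →
      ∀ i, AnalyticAt ℂ (fun τ => (f (γ τ)).coeff i) τ)
    {g : Phase N l → ℂ[X]} {m : ℕ} (hm : ∀ q, (g q).natDegree ≤ m)
    (hg : ∀ (γ : ℂ → Phase N l) (τ : ℂ), (∀ i j, AnalyticAt ℂ (fun τ => F (γ τ) i j) τ) →
      (∀ i j, AnalyticAt ℂ (fun τ => Q L (γ τ) i j) τ) →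
      ∀ i, AnalyticAt ℂ (fun τ => (g (γ τ)).coeff i) τ)
    {q q₁ q₂ : Phase N l} (hq : q ∈ phaseSpace L N l) (hq₁ : q₁ ∈ phaseSpace L N l)
    (hq₂ : q₂ ∈ phaseSpace L N l) (hpos₁ : pos q₁ = pos q) (hpos₂ : pos q₂ = pos q)
    (h₁ : IsSimple (f q₁) n) (h₂ : IsSimple (g q₂) m) :
    q ∈ closure {q | q ∈ phaseSpace L N l ∧ IsSimple (f q) n ∧ IsSimple (g q) m} := by
  have key : ∀ q q' : Phase N l, q ∈ phaseSpace L N l → q' ∈ phaseSpace L N l → pos q' = pos q →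
      ∃ γ : ℂ → Phase N l, Tendsto γ (𝓝[≠] 0) (𝓝 q) ∧
        (∀ᶠ τ in 𝓝[≠] 0, γ τ ∈ phaseSpace L N l ∧ pos (γ τ) = pos q) ∧
        (IsSimple (f q) n ∨ IsSimple (f q') n → ∀ᶠ τ in 𝓝[≠] 0, IsSimple (f (γ τ)) n) ∧
        (IsSimple (g q) m ∨ IsSimple (g q') m → ∀ᶠ τ in 𝓝[≠] 0, IsSimple (g (γ τ)) m) := by
    intro q q' hq hq' hpos
    obtain ⟨U, γ, hUo, hU, h0, h1, hγ0, hγ1, hγp, hγU, hγm, hγv, hγc⟩ := exists_path L hq hq' hpos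
    have hF : ∀ τ ∈ U, ∀ i j, AnalyticAt ℂ (fun τ => F (γ τ) i j) τ := fun τ hτ i j =>
      Finset.analyticAt_fun_sum Finset.univ fun α _ => (hγc τ hτ i α).fun_mul (hγv τ hτ j α)
    have hQ : ∀ τ ∈ U, ∀ i j, AnalyticAt ℂ (fun τ => Q L (γ τ) i j) τ := fun τ hτ i j => by
      simp only [Q, Matrix.of_apply, hγp]
      split_ifs
      · exact hγm τ hτ i
      · exact (hF τ hτ i j).mul analyticAt_const
    have hs : ∀ (f : Phase N l → ℂ[X]) (n : ℕ), (∀ q, (f q).natDegree ≤ n) →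
        (∀ τ ∈ U, ∀ i, AnalyticAt ℂ (fun τ => (f (γ τ)).coeff i) τ) →
        IsSimple (f q) n ∨ IsSimple (f q') n → ∀ᶠ τ in 𝓝[≠] 0, IsSimple (f (γ τ)) n := by
      rintro f n hn hf (h | h)
      · exact eventually_isSimple hU (f := fun τ => f (γ τ)) (fun τ _ => hn _) hf h0 h0
          (by rwa [hγ0]) (hUo.mem_nhds h0)
      · exact eventually_isSimple hU (f := fun τ => f (γ τ)) (fun τ _ => hn _) hf h0 h1
          (by rwa [hγ1]) (hUo.mem_nhds h0)
    refine ⟨γ, ?_, ?_, hs f n hn fun τ hτ => hf γ τ (hF τ hτ) (hQ τ hτ),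
      hs g m hm fun τ hτ => hg γ τ (hF τ hτ) (hQ τ hτ)⟩
    · have hc : ContinuousAt γ 0 := continuousAt_phase (fun i => by simp only [hγp]; fun_prop)
        (fun i => (hγm 0 h0 i).continuousAt) (fun i α => (hγv 0 h0 i α).continuousAt)
        fun i α => (hγc 0 h0 i α).continuousAt
      have h2 := hc.tendsto.mono_left (nhdsWithin_le_nhds (s := ({0} : Set ℂ)ᶜ))
      rwa [hγ0] at h2
    · filter_upwards [nhdsWithin_le_nhds (hUo.mem_nhds h0)] with τ hτ
      exact ⟨hγU τ hτ, hγp τ⟩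
  -- Two moves: towards `q₁` to make `f` simple, then from the point reached towards `q₂` to make
  -- `g` simple. The second keeps `f` simple because `f` is so at its starting point.
  obtain ⟨γ, hγ, hγp, hγf, -⟩ := key q q₁ hq hq₁ hpos₁
  refine closure_minimal (s := {q' | q' ∈ phaseSpace L N l ∧ pos q' = pos q ∧ IsSimple (f q') n})
    ?_ isClosed_closure (mem_closure_of_tendsto hγ ?_)
  · rintro q' ⟨hq', hp', hf'⟩
    obtain ⟨γ, hγ, hγp, hγf, hγg⟩ := key q' q₂ hq' hq₂ (hpos₂.trans hp'.symm)
    refine mem_closure_of_tendsto hγ ?_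
    filter_upwards [hγp, hγf (Or.inl hf'), hγg (Or.inr h₂)] with τ h1 h2 h3
    exact ⟨h1.1, h2, h3⟩
  · filter_upwards [hγp, hγf (Or.inr h₁)] with τ h1 h2
    exact ⟨h1.1, h1.2, h2⟩

end SpinCM

namespace SpinCM

open Polynomial

variable {N l : ℕ}

/-! ### Distinct nonzero eigenvalues of `F` -/

lemma natDegree_charpolyRev_le {R n : Type*} [CommRing R] [Fintype n] [DecidableEq n]
    (M : Matrix n n R) : M.charpolyRev.natDegree ≤ Fintype.card n := by
  nontriviality R
  rw [← M.reverse_charpoly]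
  exact (reverse_natDegree_le _).trans (by simp)

lemma charpolyRev_mul_comm {R m n : Type*} [CommRing R] [Fintype m] [DecidableEq m] [Fintype n]
    [DecidableEq n] (A : Matrix m n R) (B : Matrix n m R) :
    (A * B).charpolyRev = (B * A).charpolyRev := by
  rw [Matrix.charpolyRev, Matrix.charpolyRev, Matrix.map_mul, Matrix.map_mul, ← Matrix.smul_mul,
    Matrix.det_one_sub_mul_comm, Matrix.mul_smul]

/-- `det (1 - s F)` ignores the eigenvalue `0` and is unchanged when the two factors of `F` are
exchanged. Unlike the characteristic polynomial it can have simple roots when `0` is a multiple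
eigenvalue. -/
lemma natDegree_charpolyRev_F_le (q : Phase N l) : (F q).charpolyRev.natDegree ≤ min l N := by
  refine le_min ?_ (by simpa using natDegree_charpolyRev_le (F q))
  rw [F_eq_mul, charpolyRev_mul_comm]
  simpa using natDegree_charpolyRev_le ((Matrix.of (vec q)).transpose * Matrix.of (covec q))

lemma eval_charpolyRev_eq_det (M : Matrix (Fin N) (Fin N) ℂ) (s : ℂ) :
    M.charpolyRev.eval s = (1 - s • M).det := by
  rw [Matrix.charpolyRev, ← coe_evalRingHom, RingHom.map_det]
  congr 1
  ext i j
  rcases eq_or_ne i j with rfl | hij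
  · simp; ring
  · simp [hij]; ring

lemma analyticAt_coeff_charpolyRev {M : ℂ → Matrix (Fin N) (Fin N) ℂ} {τ : ℂ}
    (h : ∀ i j, AnalyticAt ℂ (fun τ => M τ i j) τ) (k : ℕ) :
    AnalyticAt ℂ (fun τ => (M τ).charpolyRev.coeff k) τ := by
  refine det_mem (polySubring (analyticSubring τ)) (fun i j => ?_) k
  have h1 : (fun _ => (1 : Matrix (Fin N) (Fin N) ℂ[X]) i j) ∈ polySubring (analyticSubring τ) := by
    simp only [Matrix.one_apply]
    split_ifs
    · exact Subring.one_mem _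
    · exact Subring.zero_mem _
  exact Subring.sub_mem _ h1 (Subring.mul_mem _ X_mem_polySubring (C_mem_polySubring (h i j)))

/-- The roots of the reversed polynomial are the inverses of the nonzero eigenvalues. -/
lemma ncard_spectrum_of_isSimple {M : Matrix (Fin N) (Fin N) ℂ} {m : ℕ}
    (h : IsSimple M.charpolyRev m) : (spectrum ℂ M \ {0}).ncard = m := by
  have h1 : M.charpolyRev.roots.toFinset.card = m := by
    rw [Multiset.toFinset_card_of_nodup (nodup_roots h.1), ← h.2,
      (IsAlgClosed.splits _).natDegree_eq_card_roots]
  have hmem : ∀ x : ℂ, x ≠ 0 → (x ∈ spectrum ℂ M ↔ M.charpolyRev.eval x⁻¹ = 0) := by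
    intro x hx
    rw [Matrix.mem_spectrum_iff_isRoot_charpoly, IsRoot, Matrix.eval_charpoly,
      eval_charpolyRev_eq_det]
    have h2 := Matrix.det_smul (1 - x⁻¹ • M) x
    have h3 : x • (1 - x⁻¹ • M) = Matrix.scalar (Fin N) x - M := by
      rw [smul_sub, smul_smul, mul_inv_cancel₀ hx, one_smul, Matrix.smul_one_eq_diagonal]
      rfl
    rw [h3] at h2
    rw [h2, mul_eq_zero, or_iff_right (pow_ne_zero _ hx)]
  have h2 : spectrum ℂ M \ {0} = (M.charpolyRev.roots.toFinset.image (·⁻¹) : Finset ℂ) := by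
    ext x
    simp only [Set.mem_sdiff, Set.mem_singleton_iff, Finset.coe_image, Set.mem_image, Finset.mem_coe,
      Multiset.mem_toFinset, mem_roots h.1.ne_zero, IsRoot]
    constructor
    · rintro ⟨hx, hx0⟩
      exact ⟨x⁻¹, (hmem x hx0).mp hx, inv_inv x⟩
    · rintro ⟨y, hy, rfl⟩
      have hy0 : y ≠ 0 := by
        rintro rfl
        simp at hy
      exact ⟨(hmem _ (inv_ne_zero hy0)).mpr (by rwa [inv_inv]), inv_ne_zero hy0⟩
  rw [h2, Set.ncard_coe_finset, Finset.card_image_of_injective _ inv_injective, h1]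

lemma isSimple_prod {m : ℕ} {c : Fin m → ℂ} (hc : Function.Injective c) (hc0 : ∀ i, c i ≠ 0) :
    IsSimple (∏ i, (1 - C (c i) * X)) m := by
  have h1 : ∀ i, 1 - C (c i) * X = C (-c i) * (X - C (c i)⁻¹) := fun i => by
    rw [mul_sub, ← C_mul, neg_mul, mul_inv_cancel₀ (hc0 i)]
    simp
    ring
  simp only [h1, Finset.prod_mul_distrib, ← map_prod]
  have h2 : ∏ i, -c i ≠ 0 := Finset.prod_ne_zero_iff.mpr fun i _ => neg_ne_zero.mpr (hc0 i)
  refine ⟨?_, ?_⟩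
  · rw [(associated_unit_mul_left _ _ ((isUnit_iff_ne_zero.mpr h2).map C)).separable_iff]
    exact separable_prod_X_sub_C_iff.mpr fun i j h => hc (inv_injective h)
  · rw [natDegree_C_mul h2, natDegree_finsetProd_X_sub_C_eq_card]
    simp

/-- A configuration of vectors and covectors for which `F` has simple nonzero eigenvalues, coming
from the discrete Fourier transform. -/
lemma exists_isSimple_charpolyRev_F (hl : 0 < N → 0 < l) (x : Fin N → ℂ) :
    ∃ q : Phase N l, pos q = x ∧ (∀ i, F q i i = 2) ∧ IsSimple (F q).charpolyRev (min l N) := by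
  rcases Nat.eq_zero_or_pos N with rfl | hN
  · refine ⟨(x, 0, 0, 0), rfl, fun i => i.elim0, ?_, ?_⟩
    · simp [Matrix.charpolyRev]
    · simp [Matrix.charpolyRev]
  set m := min l N with hm
  have hm0 : 0 < m := lt_min (hl hN) hN
  set w : ℂ := Complex.exp (2 * Real.pi * Complex.I / N) with hw
  have hprim : IsPrimitiveRoot w N := Complex.isPrimitiveRoot_exp N hN.ne'
  have hw0 : w ≠ 0 := Complex.exp_ne_zero _
  -- Proportional to `j + 1` to be distinct and nonzero, and normalized to have sum `2`, because
  -- this sum is every diagonal entry of `F`. The nonzero eigenvalues of `F` will be `N μ j`, `j <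
  -- m`.
  set μ : ℕ → ℂ := fun j => if j < m then 4 * (j + 1) / (m * (m + 1)) else 0 with hμ
  have hm' : (m : ℂ) ≠ 0 := Nat.cast_ne_zero.mpr hm0.ne'
  have hm1 : (m : ℂ) + 1 ≠ 0 := Nat.cast_add_one_ne_zero m
  have hsum : ∑ j : Fin l, μ j = 2 := by
    rw [Fin.sum_univ_eq_sum_range (fun j => μ j) l]
    have h1 : ∑ j ∈ Finset.range l, μ j = ∑ j ∈ Finset.range m, 4 / (m * (m + 1)) * ((j : ℂ) + 1) := by
      rw [← Finset.sum_subset (Finset.range_mono (min_le_left l N))]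
      · refine Finset.sum_congr rfl fun j hj => ?_
        simp only [hμ, if_pos (Finset.mem_range.mp hj)]
        ring
      · intro j _ hj
        exact if_neg fun h => hj (Finset.mem_range.mpr h)
    have h2 : ∀ k : ℕ, ∑ j ∈ Finset.range k, ((j : ℂ) + 1) = k * (k + 1) / 2 := fun k => by
      induction k with
      | zero => simp
      | succ k ih => rw [Finset.sum_range_succ, ih]; push_cast; ring
    rw [h1, ← Finset.mul_sum, h2]
    field_simp
    norm_num
  set q : Phase N l := (x, 0, fun i j => if (j : ℕ) < m then w ^ ((i : ℕ) * j) else 0,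
    fun i j => μ j * (w ^ ((i : ℕ) * j))⁻¹) with hq
  have horth : ∀ j k : ℕ, j < m → k < m → j ≠ k →
      ∑ i : Fin N, w ^ ((i : ℕ) * j) * (w ^ ((i : ℕ) * k))⁻¹ = 0 := by
    intro j k hj hk hjk
    -- Orthogonality of characters: a geometric sum over an `N`-th root of unity `u ≠ 1`.
    set u : ℂ := w ^ j * (w ^ k)⁻¹ with hu
    have hu1 : u ≠ 1 := by
      intro h
      rw [hu, mul_inv_eq_one₀ (pow_ne_zero _ hw0)] at h
      exact hjk (hprim.pow_inj (by omega) (by omega) h)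
    have huN : u ^ N = 1 := by
      rw [hu, mul_pow, inv_pow, ← pow_mul, ← pow_mul, mul_comm j, mul_comm k, pow_mul, pow_mul,
        hprim.pow_eq_one]
      simp
    have h1 : ∀ i : Fin N, w ^ ((i : ℕ) * j) * (w ^ ((i : ℕ) * k))⁻¹ = u ^ (i : ℕ) := fun i => by
      rw [hu, mul_pow, inv_pow, ← pow_mul, ← pow_mul, mul_comm j, mul_comm k]
    simp only [h1]
    rw [Fin.sum_univ_eq_sum_range (fun i => u ^ i) N, geom_sum_eq hu1, huN, sub_self, zero_div]
  have hF : (Matrix.of (vec q)).transpose * Matrix.of (covec q) =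
      Matrix.diagonal fun j : Fin l => N * μ j := by
    ext j k
    simp only [Matrix.mul_apply, Matrix.transpose_apply, Matrix.of_apply, q, vec, covec,
      Matrix.diagonal_apply]
    by_cases hj : (j : ℕ) < m
    · simp only [if_pos hj]
      rcases eq_or_ne j k with rfl | hjk
      · have h1 : ∀ i : Fin N, w ^ ((i : ℕ) * j) * (μ j * (w ^ ((i : ℕ) * j))⁻¹) = μ j := fun i => by
          have := pow_ne_zero ((i : ℕ) * j) hw0
          field_simp
        simp [h1]
      · rw [if_neg hjk]
        by_cases hk : (k : ℕ) < m
        · have h1 := horth j k hj hk (fun h => hjk (Fin.ext h))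
          simp only [mul_left_comm _ (μ k)]
          rw [← Finset.mul_sum, h1, mul_zero]
        · simp [hμ, hk]
    · simp only [if_neg hj, zero_mul, Finset.sum_const_zero]
      simp [hμ, hj]
  refine ⟨q, rfl, fun i => ?_, ?_⟩
  · rw [← hsum]
    simp only [F, Matrix.of_apply, q, vec, covec]
    refine Finset.sum_congr rfl fun j _ => ?_
    split_ifs with hj
    · have := pow_ne_zero ((i : ℕ) * j) hw0
      field_simp
    · simp [hμ, hj]
  · have h1 : (F q).charpolyRev = ∏ j : Fin m, (1 - C (N * μ j) * X) := by
      rw [F_eq_mul, charpolyRev_mul_comm, hF, Matrix.charpolyRev]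
      have h2 : (1 : Matrix (Fin l) (Fin l) ℂ[X]) - (X : ℂ[X]) •
          (Matrix.diagonal fun j : Fin l => (N : ℂ) * μ j).map C =
          Matrix.diagonal fun j : Fin l => 1 - C (N * μ j) * X := by
        ext1 i j
        rcases eq_or_ne i j with rfl | hij
        · simp [mul_comm]
        · simp [hij]
      rw [h2, Matrix.det_diagonal, Fin.prod_univ_eq_prod_range (fun j => 1 - C (N * μ j) * X) l,
        Fin.prod_univ_eq_prod_range (fun j => 1 - C (N * μ j) * X) m]
      refine (Finset.prod_subset (Finset.range_mono (min_le_left l N)) fun j _ hj => ?_).symm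
      have h3 : μ j = 0 := if_neg fun h => hj (Finset.mem_range.mpr h)
      simp [h3]
    rw [h1]
    have hN' : (N : ℂ) ≠ 0 := Nat.cast_ne_zero.mpr hN.ne'
    refine isSimple_prod (c := fun j : Fin m => N * μ j) (fun i j hij => ?_) fun i => ?_
    · simp only [hμ, i.2, j.2, if_true] at hij
      field_simp at hij
      exact Fin.ext (by exact_mod_cast (add_right_cancel hij))
    · simp only [hμ, i.2, if_true]
      have := Nat.cast_add_one_ne_zero (R := ℂ) (i : ℕ)
      exact mul_ne_zero hN' (div_ne_zero (mul_ne_zero (by norm_num) this) (mul_ne_zero hm' hm1))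

end SpinCM

namespace SpinCM

open Polynomial

variable {N l : ℕ}

/-! ### Simple roots of `kernelPoly` -/

lemma IsSimple.C_mul {p : ℂ[X]} {n : ℕ} (h : IsSimple p n) {a : ℂ} (ha : a ≠ 0) :
    IsSimple (C a * p) n := by
  refine ⟨?_, by rw [natDegree_C_mul ha, h.2]⟩
  rw [(associated_unit_mul_left _ _ ((isUnit_iff_ne_zero.mpr ha).map C)).separable_iff]
  exact h.1

lemma IsSimple.comp_C_mul_X {p : ℂ[X]} {n : ℕ} (h : IsSimple p n) {a : ℂ} (ha : a ≠ 0) :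
    IsSimple (p.comp (C a * X)) n := by
  refine ⟨?_, by rw [natDegree_comp, natDegree_C_mul_X a ha, h.2, mul_one]⟩
  have h1 := IsCoprime.map h.1 (compRingHom (C a * X))
  rw [coe_compRingHom_apply, coe_compRingHom_apply] at h1
  rw [Separable, derivative_comp]
  simp only [derivative_mul, derivative_C, zero_mul, derivative_X, mul_one, zero_add]
  exact (isCoprime_mul_unit_left_right ((isUnit_iff_ne_zero.mpr ha).map C) _ _).mpr h1

/-- The pencil for a block diagonal `F`, with blocks of rank one given by a colouring of the
particles. -/
lemma pencil_of_coloring (c : Fin N → Fin l) (p : Fin N → ℂ) :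
    pencil (Matrix.diagonal p) (Matrix.of fun i j => if c i = c j then 2 else 0) =
      ∏ k, (C (∏ i with c i = k, (2 * X + C (p i))) +
        X * C (derivative (∏ i with c i = k, (2 * X + C (p i))))) := by
  refine eq_of_eval_eval_C fun s κ₀ => congrArg (eval κ₀) ?_
  -- Infinitely many `κ` suffice, so the diagonal part `d` may be taken invertible. It splits off,
  -- and in `det (1 + U W) = det (1 + W U)` the small matrix is diagonal, with one entry for each
  -- colour.
  have hinf : (⋃ i, {κ : ℂ | 2 * κ + p i = 0})ᶜ.Infinite := by
    refine Set.Finite.infinite_compl (Set.finite_iUnion fun i => ?_)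
    refine (Set.finite_singleton (-p i / 2)).subset fun κ hκ => ?_
    have hκ : 2 * κ + p i = 0 := hκ
    rw [Set.mem_singleton_iff]
    linear_combination hκ / 2
  refine eq_of_infinite_eval_eq _ _ (hinf.mono fun κ hκ => ?_)
  have hd : ∀ i, 2 * κ + p i ≠ 0 := by simpa using hκ
  set d : Fin N → ℂ := fun i => 2 * κ + p i with hd'
  set U : Matrix (Fin N) (Fin l) ℂ := Matrix.of fun i k => s * (d i)⁻¹ * if c i = k then 2 else 0
  set W : Matrix (Fin l) (Fin N) ℂ := Matrix.of fun k j => if c j = k then 1 else 0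
  have h1 : (2 * κ) • (1 : Matrix (Fin N) (Fin N) ℂ) + Matrix.diagonal p +
      s • (Matrix.of fun i j => if c i = c j then 2 else 0) = Matrix.diagonal d * (1 + U * W) := by
    have hUW : ∀ i j, (U * W) i j = s * (d i)⁻¹ * if c i = c j then 2 else 0 := fun i j => by
      simp [U, W, Matrix.mul_apply]
    ext i j
    rw [Matrix.diagonal_mul, Matrix.add_apply _ (U * W), hUW]
    have := hd i
    rcases eq_or_ne i j with rfl | hij
    · simp [hd']
      field_simp
    · simp [hij, hd']
      split_ifs <;> field_simp
  have h2 : W * U = Matrix.diagonal fun k => s * ∑ i with c i = k, 2 / d i := by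
    ext k k'
    simp only [W, U, Matrix.mul_apply, Matrix.of_apply, Matrix.diagonal_apply, Finset.sum_filter]
    rcases eq_or_ne k k' with rfl | hk
    · rw [if_pos rfl, Finset.mul_sum]
      refine Finset.sum_congr rfl fun i _ => ?_
      split_ifs
      · ring
      · ring
    · rw [if_neg hk]
      refine Finset.sum_eq_zero fun i _ => ?_
      split_ifs with h3 h4
      · exact absurd (h3.symm.trans h4) hk
      · ring
      · ring
      · ring
  rw [Set.mem_ofPred_eq, eval_eval_pencil, h1, Matrix.det_mul, Matrix.det_diagonal, Matrix.det_one_add_mul_comm, h2,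
    ← Matrix.diagonal_one, Matrix.diagonal_add, Matrix.det_diagonal, eval_prod, eval_prod,
    ← Finset.prod_fiberwise _ c, ← Finset.prod_mul_distrib]
  refine Finset.prod_congr rfl fun k _ => ?_
  simp only [eval_add, eval_C, eval_mul, eval_X, derivative_prod_finset, eval_finsetSum, eval_prod,
    eval_ofNat, derivative_add, derivative_C, derivative_mul, derivative_X]
  rw [mul_add, mul_one, mul_left_comm, Finset.mul_sum]
  congr 2
  refine Finset.sum_congr rfl fun i hi => ?_
  rw [← Finset.mul_prod_erase _ _ hi]
  have := hd i
  simp [hd']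
  field_simp

lemma coeff_prod_C_add_X_mul_C {R : Type*} [CommRing R] (a b : Fin l → R) :
    (∏ k, (C (a k) + X * C (b k))).coeff l = ∏ k, b k := by
  have h := coeff_prod_of_natDegree_le Finset.univ (fun k => C (a k) + X * C (b k)) 1 fun k _ =>
    (natDegree_add_le _ _).trans (max_le ((natDegree_C _).le.trans zero_le_one)
      (natDegree_mul_le.trans (by
        have h1 := natDegree_X_le (R := R)
        have h2 := (natDegree_C (b k)).le
        omega)))
  rw [Finset.card_univ, Fintype.card_fin, mul_one] at h
  rw [h]
  simp

/-- The top coefficient in `s` is the product of the derivatives of the colour polynomials. A colour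
with a single particle contributes the constant `2`, so all colours but one get one particle, and
the last polynomial is chosen to have a derivative with simple roots. -/
lemma exists_isSimple_coeff_pencil_diagonal (hl : 0 < l) (hlN : l < N) :
    ∃ (c : Fin N → Fin l) (p : Fin N → ℂ),
      IsSimple ((pencil (Matrix.diagonal p) (Matrix.of fun i j => if c i = c j then 2 else 0)).coeff l)
        (N - l) := by
  obtain ⟨l, rfl⟩ := Nat.exists_eq_succ_of_ne_zero hl.ne'
  obtain ⟨n, rfl⟩ := Nat.exists_eq_add_of_le (show l ≤ N by omega)
  have hn : 2 ≤ n := by omega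
  -- The derivative `n X^(n-1) + 1` has simple roots. Here `l` already stands for one less than the
  -- number of colours, and `n` is the number of particles of the last colour.
  have hmonic : (X ^ n + X : ℂ[X]).Monic := monic_X_pow_add (by rw [degree_X]; exact_mod_cast hn)
  obtain ⟨μ, hμ⟩ := exists_eq_prod_X_sub_C n hmonic (by
    rw [natDegree_add_eq_left_of_natDegree_lt] <;> simp
    omega)
  set c : Fin (l + n) → Fin (l + 1) := Fin.addCases Fin.castSucc fun _ => Fin.last l with hc
  set p : Fin (l + n) → ℂ := Fin.addCases 0 fun j => -2 * μ j with hp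
  have hc1 : ∀ k : Fin l, c (Fin.castAdd n k) = k.castSucc := fun k => Fin.addCases_left k
  have hc2 : ∀ j : Fin n, c (Fin.natAdd l j) = Fin.last l := fun j => Fin.addCases_right j
  have hp1 : ∀ k : Fin l, p (Fin.castAdd n k) = 0 := fun k => Fin.addCases_left k
  have hp2 : ∀ j : Fin n, p (Fin.natAdd l j) = -2 * μ j := fun j => Fin.addCases_right j
  refine ⟨c, p, ?_⟩
  rw [pencil_of_coloring, coeff_prod_C_add_X_mul_C, Fin.prod_univ_castSucc]
  have h1 : ∀ k : Fin l, derivative (∏ i with c i = k.castSucc, (2 * X + C (p i))) = C 2 := fun k => by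
    rw [Finset.prod_filter, Fin.prod_univ_add]
    simp only [hc1, hc2, hp1, (Fin.castSucc_lt_last _).ne', if_false, Fin.castSucc_inj]
    simp
    rfl
  have h2 : derivative (∏ i with c i = Fin.last l, (2 * X + C (p i))) =
      C ((2 : ℂ) ^ n * n) * (X ^ (n - 1) - C (-(n : ℂ)⁻¹)) := by
    have h3 : ∏ j, (2 * X + C (-2 * μ j) : ℂ[X]) = C ((2 : ℂ) ^ n) * (X ^ n + X) := by
      have h4 : ∀ j, (2 * X + C (-2 * μ j) : ℂ[X]) = C 2 * (X - C (μ j)) := fun j => by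
        rw [map_mul, map_neg]
        simp only [map_ofNat]
        ring
      simp only [h4, Finset.prod_mul_distrib]
      rw [hμ, map_pow]
      simp
    rw [Finset.prod_filter, Fin.prod_univ_add]
    simp only [hc1, hc2, hp2, (Fin.castSucc_lt_last _).ne, if_true, if_false, Finset.prod_const_one,
      one_mul, h3]
    have h4 : C (n : ℂ) * C (-(n : ℂ)⁻¹) = (-1 : ℂ[X]) := by
      rw [← C_mul, mul_neg, mul_inv_cancel₀ (Nat.cast_ne_zero.mpr (by omega)), map_neg, C_1]
    rw [derivative_C_mul, derivative_add, derivative_X_pow, derivative_X, C_mul]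
    linear_combination C ((2 : ℂ) ^ n) * h4
  rw [h2, Finset.prod_congr rfl fun k _ => h1 k]
  rw [Finset.prod_const, ← C_pow, show l + n - (l + 1) = n - 1 by omega]
  have hn0 : (n : ℂ) ≠ 0 := Nat.cast_ne_zero.mpr (by omega)
  refine IsSimple.C_mul (IsSimple.C_mul ⟨?_, ?_⟩ (mul_ne_zero (by simp) hn0)) (by simp)
  · exact separable_X_pow_sub_C _ (Nat.cast_ne_zero.mpr (by omega)) (by simpa using hn0)
  · exact natDegree_X_pow_sub_C

/-- The off-diagonal part of `Q` is forced by the positions, but momenta of size `1/ε` dominate it: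
`ε Q` is a small perturbation of the diagonal case. Homogeneity of the pencil turns the factor `ε`
into a rescaling of `κ`. -/
lemma exists_isSimple_kernelPoly (L : PeriodPair) (hl : 0 < l) (hlN : l < N) (x : Fin N → ℂ) :
    ∃ q : Phase N l, pos q = x ∧ (∀ i, F q i i = 2) ∧ IsSimple (kernelPoly L q) (N - l) := by
  obtain ⟨c, p, hcp⟩ := exists_isSimple_coeff_pencil_diagonal hl hlN
  set B : Matrix (Fin N) (Fin N) ℂ := Matrix.of fun i j => if c i = c j then 2 else 0 with hB
  set q : ℂ → Phase N l := fun ε => (x, fun i => ε⁻¹ * p i, fun i α => if c i = α then 1 else 0,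
    fun i α => if c i = α then 2 else 0) with hq
  have hF : ∀ ε, F (q ε) = B := fun ε => by
    ext i j
    simp [F, hB, hq, covec, vec]
  set Z : Matrix (Fin N) (Fin N) ℂ :=
    Matrix.of fun i j => if i = j then 0 else B i j * zeta L (x i - x j) with hZ
  have hQ : ∀ ε, ε ≠ 0 → ε • Q L (q ε) = Matrix.diagonal p + ε • Z := fun ε hε => by
    ext i j
    rcases eq_or_ne i j with rfl | hij
    · simp [Q, hZ, hq, mom, hε]
    · have hx : pos (q ε) = x := rfl
      simp only [Matrix.smul_apply, Q, Matrix.of_apply, if_neg hij, hF, Matrix.add_apply,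
        Matrix.diagonal_apply_ne _ hij, hZ, zero_add, hx]
  have h1 := eventually_isSimple (U := Set.univ) isPreconnected_univ
    (f := fun ε => (pencil (Matrix.diagonal p + ε • Z) B).coeff l) (n := N - l)
    (fun ε _ => natDegree_coeff_pencil_le _ _ _)
    (fun ε _ i => analyticAt_coeff_pencil (A := fun ε => Matrix.diagonal p + ε • Z)
      (B := fun _ => B) (fun a b => by
        simp only [Matrix.add_apply, Matrix.smul_apply, smul_eq_mul]
        fun_prop) (fun _ _ => analyticAt_const) l i)
    (Set.mem_univ 0) (Set.mem_univ 0) (by simpa using hcp) Filter.univ_mem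
  obtain ⟨ε, hε, hε0⟩ := (h1.and self_mem_nhdsWithin).exists
  have hε0 : ε ≠ 0 := hε0
  refine ⟨q ε, rfl, fun i => by rw [hF]; simp [hB], ?_⟩
  have h2 : kernelPoly L (q ε) = C ((ε ^ N)⁻¹ * ε ^ l) *
      ((pencil (Matrix.diagonal p + ε • Z) B).coeff l).comp (C ε * X) := by
    ext i
    have h3 := coeff_pencil_smul ε (Q L (q ε)) B l i
    rw [hQ ε hε0, pow_add] at h3
    rw [kernelPoly_eq, min_eq_left hlN.le, coeff_C_mul, comp_C_mul_X_coeff, hF]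
    have := pow_ne_zero N hε0
    field_simp
    linear_combination -h3
  rw [h2]
  exact (hε.comp_C_mul_X hε0).C_mul (mul_ne_zero (inv_ne_zero (pow_ne_zero _ hε0))
    (pow_ne_zero _ hε0))

/-! ### Density of the generic points -/

/-- Here `kernelPoly` is the constant `det F`, the product of the nonzero eigenvalues, so the second
genericity condition follows from the first. -/
lemma isSimple_kernelPoly_of_le (L : PeriodPair) (h : N ≤ l) {q : Phase N l}
    (hq : IsSimple (F q).charpolyRev (min l N)) : IsSimple (kernelPoly L q) (N - min l N) := by
  obtain ⟨e, -, he⟩ := exists_charpoly_F_eq q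
  have hm : min l N = N := min_eq_right h
  have h0 : ∀ i : Fin N, N ≤ i → e i = 0 := fun i hi => absurd i.2 (by omega)
  have hne := (ne_zero_and_injOn_of_ncard he h0
    (by rw [ncard_spectrum_of_isSimple hq, hm])).1
  rw [kernelPoly_eq, hm]
  have h1 : ((pencil (Q L q) (F q)).coeff N).natDegree ≤ 0 :=
    (natDegree_coeff_pencil_le _ _ _).trans (Nat.sub_self N).le
  have h2 := coeff_pencil_top le_rfl (Q L q) he h0
  rw [Nat.sub_self] at h2 ⊢
  refine ⟨?_, Nat.le_zero.mp h1⟩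
  rw [eq_C_of_natDegree_le_zero h1, h2]
  refine (separable_C _).mpr (isUnit_iff_ne_zero.mpr ?_)
  rw [pow_zero, one_mul]
  exact Finset.prod_ne_zero_iff.mpr fun i _ => hne _ i.2

theorem phaseSpace_subset_closure_isGeneric (L : PeriodPair) (N l : ℕ) :
    phaseSpace L N l ⊆ closure {q | q ∈ phaseSpace L N l ∧ IsGeneric L q} := by
  intro q hq
  -- For `l = 0 < N` the phase space is empty, since `f_ii` would be an empty sum.
  have hl : 0 < N → 0 < l := by
    intro hN
    by_contra h
    obtain rfl : l = 0 := by omega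
    simpa [F] using hq.2 ⟨0, hN⟩
  obtain ⟨q₁, hpos₁, hF₁, h₁⟩ := exists_isSimple_charpolyRev_F (l := l) hl (pos q)
  obtain ⟨q₂, hpos₂, hF₂, h₂⟩ : ∃ q₂ : Phase N l, pos q₂ = pos q ∧ (∀ i, F q₂ i i = 2) ∧
      IsSimple (kernelPoly L q₂) (N - min l N) := by
    rcases lt_or_ge l N with h | h
    · rw [min_eq_left h.le]
      exact exists_isSimple_kernelPoly L (hl (by omega)) h (pos q)
    · exact ⟨q₁, hpos₁, hF₁, isSimple_kernelPoly_of_le L h h₁⟩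
  refine closure_mono ?_ (mem_closure_of_isSimple L (f := fun q => (F q).charpolyRev)
    natDegree_charpolyRev_F_le (fun γ τ hF _ => analyticAt_coeff_charpolyRev hF)
    (g := kernelPoly L) (fun q => natDegree_coeff_pencil_le _ _ _)
    (fun γ τ hF hQ => analyticAt_coeff_pencil hQ hF _) hq ⟨hpos₁ ▸ hq.1, hF₁⟩ ⟨hpos₂ ▸ hq.1, hF₂⟩
    hpos₁ hpos₂ h₁ h₂)
  rintro q ⟨hq, h1, h2⟩
  exact ⟨hq, ncard_spectrum_of_isSimple h1, h2.1⟩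

end SpinCM

theorem proposition3p1 (L : PeriodPair) (N l : ℕ) :
    -- the generic points are dense in the phase space
    SpinCM.phaseSpace L N l ⊆
      closure {q | q ∈ SpinCM.phaseSpace L N l ∧ SpinCM.IsGeneric L q} ∧
    ∀ (T : Set ℝ) (lam : ℝ → Fin N → ℂ) (γ : ℝ → SpinCM.Phase N l),
      IsOpen T → IsPreconnected T → SpinCM.IsTrajectory L T lam γ →
      -- the coefficients `r i` do not depend on the time `t`
      (∃ (r : Fin (N + 1) → ℂ → ℂ) (I₀ : Fin (N + 1) → ℂ) (I : Fin (N + 1) → ℕ → ℂ),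
        (∀ i, SpinCM.IsElliptic L (r i)) ∧
        (∀ i, ∀ z ∉ L.lattice, r i z =
          I₀ i + ∑ s ∈ Finset.range (N - 1 - i), I i s * iteratedDeriv s L.weierstrassP z) ∧
        ∀ t ∈ T, ∀ z ∉ L.lattice, ∀ k : ℂ,
          SpinCM.R L (γ t) k z = ∑ i : Fin (N + 1), r i z * k ^ (i : ℕ)) ∧
      -- factorization near `z = 0`
      (∃ (ν : Fin N → ℂ) (h : Fin N → ℂ → ℂ),
        (∀ i : Fin N, l ≤ (i : ℕ) → ν i = 1) ∧
        (∀ᶠ z in 𝓝[≠] (0 : ℂ), ∀ t ∈ T, ∀ k : ℂ,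
          SpinCM.R L (γ t) k z = 2 ^ N * ∏ i, (k + ν i / z + h i z)) ∧
        (∀ i, Tendsto (fun z => z * h i z) (𝓝[≠] 0) (𝓝 0)) ∧
        ((∃ t ∈ T, SpinCM.IsGeneric L (γ t)) → ∀ i, AnalyticAt ℂ (h i) 0)) := by
  refine ⟨SpinCM.phaseSpace_subset_closure_isGeneric L N l, fun T lam γ hT hT' hγ => ?_⟩
  exact ⟨hγ.exists_R_eq_sum hT hT', hγ.exists_factorization hT hT'⟩
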